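/- Let $v_1=(\frac{\sqrt3}{2},\frac12)$, $v_2=(\frac{\sqrt3}{2},-\frac12)$ span the triangular lattice $\Lambda_h=\mathbb Zv_1\oplus\mathbb Zv_2\subset\mathbb R^2$, with dual basis $k_1=q(\frac12,\frac{\sqrt3}2)$, $k_2=q(\frac12,-\frac{\sqrt3}2)$, $q=\frac{4\pi}{\sqrt3}$, and let $K=\frac13(k_1-k_2)$. Let $a_1,b_1,a_2,b_2\in\mathbb Z$ with $a_1b_2-a_2b_1=1$, and set $\mathfrak v_j=a_jv_1+b_jv_2$, $\mathfrak K_1=b_2k_1-a_2k_2$, $\mathfrak K_2=-b_1k_1+a_1k_2$, so that $\mathfrak K_i\cdot\mathfrak v_j=2\pi\delta_{ij}$. Let $\Omega=\{s\mathfrak v_1+t\mathfrak v_2:0\le s,t\le1\}$ and let $\Omega_\Sigma=\{s\mathfrak v_1+t\mathfrak v_2:0\le s\le1,\ t\in\mathbb R\}$ be a fundamental domain of the cylinder $\Sigma=\mathbb R^2/\mathbb Z\mathfrak v_1$. Let $L^2_{k_\parallel}(\Sigma)$ be the space of measurable $f:\mathbb R^2\to\mathbb C$ with $f(x+\mathfrak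 v_1)=e^{ik_\parallel}f(x)$ for a.e. $x$ and $f\in L^2(\Omega_\Sigma)$; let $L^2_{\mathbf k}$ be the space of measurable $\phi$ with $\phi(x+v)=e^{i\mathbf k\cdot v}\phi(x)$ for all $v\in\Lambda_h$ and a.e. $x$, and $\phi\in L^2(\Omega)$. Inner products are $\langle f,g\rangle=\int\bar f g$. Let $V\in C^\infty(\mathbb R^2;\mathbb R)$ be $\Lambda_h$-periodic (for instance a honeycomb potential). For $|\lambda|\le\frac12$ let $E_1\le E_2\le\cdots$ be all eigenvalues of $-\Delta+V$ on $L^2_{\mathbf k}$, $\mathbf k=K+\lambda\mathfrak K_2$, repeated according to multiplicity, with eigenfunctions $\Phi_b(\cdot;\mathbf k)$ (Floquet–Bloch modes; weak $L^2_{\mathbf k}$ solutions) orthonormal in $L^2(\Omega)$, and put $p_b(x;\mathbf k)=e^{-i\mathbf k\cdot x}\Phi_b(x;\mathbf k)$. For a family $\phi(\cdot;\lambda)$ and $f\in L^2_{K\cdot\mathfrak v_1}(\Sigma)$, the coefficient $\lambda\mapsto\langle\phi(\cdot;\lambda),f\rangle_\Sigma$ means the limit in $L^2([-\frac12,\frac12];d\lambda)$,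 as $R\to\infty$, of $\int_{\{s\mathfrak v_1+t\mathfrak v_2:\,0\le s\le1,\,|t|\le R\}}\overline{\phi(x;\lambda)}f(x)\,dx$. **Theorem.** 1. The modes $\Phi_b(x;K+\lambda\mathfrak K_2)$, $|\lambda|\le\frac12$, can be chosen jointly measurable in $(x,\lambda)$. For every such choice and every $f\in L^2_{k_\parallel=K\cdot\mathfrak v_1}(\Sigma)$, the coefficients $\tilde f_b(\lambda)=\langle\Phi_b(\cdot;K+\lambda\mathfrak K_2),f\rangle_\Sigma$ exist in $L^2([-\frac12,\frac12])$ and agree, for a.e. $\lambda$ for which $\overline{\Phi_b(\cdot;K+\lambda\mathfrak K_2)}f\in L^1(\Omega_\Sigma)$, with $\int_{\Omega_\Sigma}\overline{\Phi_b(x;K+\lambda\mathfrak K_2)}f(x)\,dx$. For each $b$ the integral $\int_{-1/2}^{1/2}\tilde f_b(\lambda)\Phi_b(x;K+\lambda\mathfrak K_2)\,d\lambda$ converges absolutely for a.e. $x$ and defines an element of $L^2_{k_\parallel=K\cdot\mathfrak v_1}(\Sigma)$, and $$f(x)=\sum_{b\ge1}\int_{-1/2}^{1/2}\tilde f_b(\lambda)\Phi_b(x;K+\lambda\mathfrak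 K_2)\,d\lambda,\qquad e^{-iK\cdot x}f(x)=\sum_{b\ge1}\int_{-1/2}^{1/2}e^{i\lambda\mathfrak K_2\cdot x}\tilde f_b(\lambda)p_b(x;K+\lambda\mathfrak K_2)\,d\lambda,$$ where both series converge unconditionally in the $L^2(\Omega_\Sigma)$ norm. 2. If $V\equiv0$, then for every $\lambda$ the plane waves $|\Omega|^{-1/2}e^{i(K+\lambda\mathfrak K_2+m_1\mathfrak K_1+m_2\mathfrak K_2)\cdot x}$, $m\in\mathbb Z^2$, are an orthonormal family of Floquet–Bloch modes exhausting all eigenvalues $|K+\lambda\mathfrak K_2+m_1\mathfrak K_1+m_2\mathfrak K_2|^2$ with multiplicity, and every $f\in L^2_{k_\parallel=K\cdot\mathfrak v_1}(\Sigma)$ has the Fourier decomposition $$f(x)=\sum_{m\in\mathbb Z^2}e^{i(K+m_1\mathfrak K_1+m_2\mathfrak K_2)\cdot x}\int_{-1/2}^{1/2}\hat f_m(\lambda)e^{i\lambda\mathfrak K_2\cdot x}\,d\lambda,\qquad \hat f_m(\lambda)=\Big\langle \tfrac1{|\Omega|}e^{i(K+\lambda\mathfrak K_2+m_1\mathfrak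 K_1+m_2\mathfrak K_2)\cdot x},f\Big\rangle_\Sigma,$$ where the coefficients exist in the same sense and the series converges unconditionally in the $L^2(\Omega_\Sigma)$ norm. -/

import Mathlib

open MeasureTheory Filter Topology Complex
open scoped ContDiff ENNReal

noncomputable section

namespace FloquetBloch

/-- The Euclidean plane, home of positions `x` and of quasi-momenta `k`. -/
abbrev Plane : Type := EuclideanSpace ℝ (Fin 2)

/-- The plane wave `e^{i k · x}`. -/
def phase (k x : Plane) : ℂ := Complex.exp (Complex.I * ((inner ℝ k x : ℝ) : ℂ))

/-! ### The triangular lattice and its dual -/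

/-- First basis vector of the equilateral triangular lattice. -/
def v₁ : Plane := !₂[Real.sqrt 3 / 2, 1 / 2]

/-- Second basis vector of the equilateral triangular lattice. -/
def v₂ : Plane := !₂[Real.sqrt 3 / 2, -(1 / 2)]

/-- First dual basis vector, `q (1/2, √3/2)` with `q = 4π/√3`. -/
def k₁ : Plane := (4 * Real.pi / Real.sqrt 3) • !₂[1 / 2, Real.sqrt 3 / 2]

/-- Second dual basis vector, `q (1/2, -√3/2)` with `q = 4π/√3`. -/
def k₂ : Plane := (4 * Real.pi / Real.sqrt 3) • !₂[1 / 2, -(Real.sqrt 3 / 2)]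

/-- The vertex `K = (k₁ - k₂)/3` of the hexagonal Brillouin zone. -/
def K : Plane := (1 / 3 : ℝ) • (k₁ - k₂)

/-- The element `m v₁ + n v₂` of the triangular lattice. -/
def latticeVec (m n : ℤ) : Plane := (m : ℝ) • v₁ + (n : ℝ) • v₂

/-- A rational edge together with a companion vector: integers with `a₁ b₂ - a₂ b₁ = 1`. -/
structure Edge where
  a₁ : ℤ
  b₁ : ℤ
  a₂ : ℤ
  b₂ : ℤ
  det_eq_one : a₁ * b₂ - a₂ * b₁ = 1

namespace Edge

variable (e : Edge)

/-- The edge direction `𝔳₁ = a₁ v₁ + b₁ v₂`. -/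
def vv₁ : Plane := latticeVec e.a₁ e.b₁

/-- The transverse lattice vector `𝔳₂ = a₂ v₁ + b₂ v₂`. -/
def vv₂ : Plane := latticeVec e.a₂ e.b₂

/-- The dual vector `𝔎₁ = b₂ k₁ - a₂ k₂`. -/
def KK₁ : Plane := (e.b₂ : ℝ) • k₁ - (e.a₂ : ℝ) • k₂

/-- The dual vector `𝔎₂ = -b₁ k₁ + a₁ k₂`. -/
def KK₂ : Plane := -((e.b₁ : ℝ) • k₁) + (e.a₁ : ℝ) • k₂

/-- The dual lattice vector `m₁ 𝔎₁ + m₂ 𝔎₂`. -/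
def dualVec (m : ℤ × ℤ) : Plane := (m.1 : ℝ) • e.KK₁ + (m.2 : ℝ) • e.KK₂

/-- The period cell `Ω`, spanned by `𝔳₁` and `𝔳₂`. -/
def cell : Set Plane :=
  {x | ∃ s t : ℝ, 0 ≤ s ∧ s ≤ 1 ∧ 0 ≤ t ∧ t ≤ 1 ∧ x = s • e.vv₁ + t • e.vv₂}

/-- The fundamental domain `Ω_Σ` of the cylinder `Σ = ℝ² / ℤ𝔳₁`. -/
def strip : Set Plane :=
  {x | ∃ s t : ℝ, 0 ≤ s ∧ s ≤ 1 ∧ x = s • e.vv₁ + t • e.vv₂}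

/-- The part `|t| ≤ R` of the fundamental domain of the cylinder. -/
def stripUpTo (R : ℝ) : Set Plane :=
  {x | ∃ s t : ℝ, 0 ≤ s ∧ s ≤ 1 ∧ |t| ≤ R ∧ x = s • e.vv₁ + t • e.vv₂}

/-- The parallel quasi-momentum `k_∥ = K · 𝔳₁`. -/
def kpar : ℝ := inner ℝ K e.vv₁

/-- The quasi-momentum `K + λ 𝔎₂` on the dual slice. -/
def slice (l : ℝ) : Plane := K + l • e.KK₂

/-! ### Function spaces -/

/-- Membership in `L²_k`. -/
structure MemL2k (k : Plane) (φ : Plane → ℂ) : Prop where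
  aestronglyMeasurable : AEStronglyMeasurable φ volume
  pseudoperiodic : ∀ m n : ℤ, ∀ᵐ x : Plane,
    φ (x + latticeVec m n) = phase k (latticeVec m n) * φ x
  memLp : MemLp (fun x => phase (-k) x * φ x) 2 (volume.restrict e.cell)

/-- Membership in `L²_{k_∥}(Σ)`, for any real `k_∥`. -/
structure MemL2kpar (kp : ℝ) (f : Plane → ℂ) : Prop where
  aestronglyMeasurable : AEStronglyMeasurable f volume
  pseudoperiodic : ∀ᵐ x : Plane,
    f (x + e.vv₁) = Complex.exp (Complex.I * (kp : ℂ)) * f x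
  memLp : MemLp (fun x => phase (-((kp / (2 * Real.pi)) • e.KK₁)) x * f x) 2
    (volume.restrict e.strip)

/-- Unconditional convergence of `∑ᵢ uᵢ` to `f` in the `L²` norm over the cylinder. -/
def HasSumL2 {ι : Type} (u : ι → Plane → ℂ) (f : Plane → ℂ) : Prop :=
  Tendsto (fun s : Finset ι =>
    eLpNorm (fun x => (∑ i ∈ s, u i x) - f x) 2 (volume.restrict e.strip)) atTop (𝓝 0)

/-! ### Floquet-Bloch modes -/

/-- `(-Δ + V) ψ`, for smooth `ψ`. -/
def schrodinger (V : Plane → ℝ) (ψ : Plane → ℂ) (x : Plane) : ℂ :=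
  -(Laplacian.laplacian ψ x) + (V x : ℂ) * ψ x

/-- `φ` is an `L²_k` solution of `(-Δ + V) φ = E φ`, in the weak sense: it is tested against
smooth `k`-pseudo-periodic functions over a period cell. -/
structure IsFloquetBlochState (V : Plane → ℝ) (k : Plane) (E : ℝ) (φ : Plane → ℂ) : Prop where
  memL2k : e.MemL2k k φ
  weak_eq : ∀ ψ : Plane → ℂ, ContDiff ℝ ∞ ψ →
    (∀ (m n : ℤ) (x : Plane), ψ (x + latticeVec m n) = phase k (latticeVec m n) * ψ x) →
    ∫ x in e.cell, starRingEnd ℂ (schrodinger V ψ x) * φ x =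
      (E : ℂ) * ∫ x in e.cell, starRingEnd ℂ (ψ x) * φ x

/-- `E` lists all eigenvalues at quasi-momentum `k`, repeated according to multiplicity, and
`φ` lists corresponding eigenfunctions, orthonormal in `L²_k`. -/
structure IsFloquetBlochFamily {ι : Type} [DecidableEq ι] (V : Plane → ℝ) (k : Plane)
    (E : ι → ℝ) (φ : ι → Plane → ℂ) : Prop where
  state : ∀ b, e.IsFloquetBlochState V k (E b) (φ b)
  orthonormal : ∀ b c : ι,
    ∫ x in e.cell, starRingEnd ℂ (φ b x) * φ c x = if b = c then 1 else 0
  exhaustive : ∀ (E' : ℝ) (χ : Plane → ℂ), e.IsFloquetBlochState V k E' χ →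
    ∃ (s : Finset ι) (α : ι → ℂ), (∀ b ∈ s, E b = E') ∧
      ∀ᵐ x : Plane, χ x = ∑ b ∈ s, α b * φ b x

/-- Lebesgue measure on the parameter interval `|λ| ≤ 1/2` of the dual slice. -/
def sliceMeasure : Measure ℝ := volume.restrict (Set.Icc (-(1 / 2)) (1 / 2))

/-- A measurable choice of Floquet-Bloch modes `Φ b l x = Φ_b(x; K + l 𝔎₂)`, with energies
`E b l = E_b(K + l 𝔎₂)` in nondecreasing order of `b`, along the dual slice. -/
structure IsSliceModes (V : Plane → ℝ) (E : ℕ → ℝ → ℝ) (Φ : ℕ → ℝ → Plane → ℂ) : Prop where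
  family : ∀ l ∈ Set.Icc (-(1 / 2) : ℝ) (1 / 2),
    e.IsFloquetBlochFamily V (e.slice l) (fun b => E b l) (fun b => Φ b l)
  ordered : ∀ l ∈ Set.Icc (-(1 / 2) : ℝ) (1 / 2), Monotone (fun b => E b l)
  aestronglyMeasurable : ∀ b,
    AEStronglyMeasurable (fun q : ℝ × Plane => Φ b q.1 q.2) (sliceMeasure.prod volume)

/-- `c l = ⟨φ l, f⟩` over the cylinder, as a function of the slice parameter `l`. As for the
Fourier transform on `L²`, the integral over the cylinder need not converge absolutely: it is
the limit in `L²(dl)` of the integrals over bounded parts of the cylinder, and it is the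
absolutely convergent integral wherever there is one. -/
structure IsSliceCoeff (φ : ℝ → Plane → ℂ) (f : Plane → ℂ) (c : ℝ → ℂ) : Prop where
  memLp : MemLp c 2 sliceMeasure
  tendsto : Tendsto (fun R : ℝ =>
    eLpNorm (fun l => (∫ x in e.stripUpTo R, starRingEnd ℂ (φ l x) * f x) - c l) 2 sliceMeasure)
    atTop (𝓝 0)
  eq_integral : ∀ᵐ l ∂sliceMeasure,
    IntegrableOn (fun x => starRingEnd ℂ (φ l x) * f x) e.strip →
      c l = ∫ x in e.strip, starRingEnd ℂ (φ l x) * f x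

/-- The superposition `∫_{|l| ≤ 1/2} c(l) φ(x; l) dl`. -/
def superpose (c : ℝ → ℂ) (φ : ℝ → Plane → ℂ) (x : Plane) : ℂ :=
  ∫ l, c l * φ l x ∂sliceMeasure

/-- The periodic part `p(x; k) = e^{-i k · x} Φ(x; k)` of a mode, at `k = K + l 𝔎₂`. -/
def periodicPart (φ : ℝ → Plane → ℂ) (l : ℝ) (x : Plane) : ℂ :=
  phase (-(e.slice l)) x * φ l x

/-- The area of the period cell. -/
def area : ℝ := volume.real e.cell

/-- The plane wave `e^{i (K + l 𝔎₂ + m₁ 𝔎₁ + m₂ 𝔎₂) · x}`. -/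
def planeWave (m : ℤ × ℤ) (l : ℝ) (x : Plane) : ℂ := phase (e.slice l + e.dualVec m) x

end Edge

end FloquetBloch

end

/-! The Bloch transform turns the cylinder into a family of period cells. For `f` square integrable
on the strip, put `F(l, x) = ∑ₙ e^{-i k·n𝔳₂} f(x + n𝔳₂)` with `k = K + l𝔎₂`. Since `𝔎₂·𝔳₂ = 2π`, the
values of `f` on the `n`-th tile are, up to a unimodular constant, the Fourier coefficients in `l`
of `F(l, x)`. Parseval in `l` makes `f ↦ F` an isometry into `L²(dl × cell)`
(`exists_blochTransform`, `lintegral_strip_eq_of_blochCoef`). For almost every `l`, `F(l, ·)` is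
expanded in an orthonormal basis of modes of the cell with coefficients `⟨Φ_b(l), F(l)⟩`. Dominated
convergence in `l` makes the expansion converge in `L²(dl × cell)`, and the isometry carries it back
to the strip (`IsSliceBasis.hasSumL2`). The coefficients are those over the cylinder because this is
plain algebra for truncated `f`, and truncation errors are controlled by Cauchy–Schwarz and the
isometry (`IsSliceField.isSliceCoeff`).

It remains to produce the bases. In Fourier coefficients of the periodic part, the weak eigenvalue
equation becomes `|k + m|² pₘ + (Wp)ₘ = E pₘ`, where `W` is multiplication by `V`
(`coefState_of_isFloquetBlochState`, `isFloquetBlochState_of_coefState`). For `C` large the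
resolvent `(-Δ + V + C)⁻¹` at quasi-momentum `k` is compact, positive, injective and measurable in
`l` (`exists_resolvent_field`). Such a field has a measurable eigenbasis, obtained by repeatedly
splitting off a top eigenvector (`IsCompactPositiveField.exists_measurable_eigenbasis`).
Eigenvectors have summable Fourier coefficients, so their Fourier series give pointwise defined,
jointly measurable modes. Any other choice of modes is complete as well, because its exhaustiveness
lets it reproduce this one (`IsSliceModes.complete`). For `V = 0` the Fourier basis itself serves as
the basis of modes. -/

noncomputable section

namespace FloquetBloch

/-! ### Measurable diagonalization of fields of compact positive operators. -/

section MeasurableSpectral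

open scoped InnerProductSpace ComplexOrder

variable {α H : Type*} [MeasurableSpace α] [NormedAddCommGroup H] [InnerProductSpace ℂ H]

/-- A compact positive operator has its norm as an eigenvalue. -/
lemma exists_eigenvector_norm [CompleteSpace H] {A : H →L[ℂ] H} (hA : A.IsPositive)
    (hc : IsCompactOperator A) (h0 : A ≠ 0) : ∃ w : H, w ≠ 0 ∧ A w = (‖A‖ : ℂ) • w := by
  have : Nontrivial H := by
    by_contra h
    rw [not_nontrivial_iff_subsingleton] at h
    exact h0 (ContinuousLinearMap.ext fun x => Subsingleton.elim _ _)
  obtain ⟨z, hz, hzn⟩ := spectrum.exists_nnnorm_eq_spectralRadius A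
  rw [A.spectralRadius_eq_nnnorm hA.isSelfAdjoint] at hzn
  have hzn' : ‖z‖ = ‖A‖ := by simpa using congrArg ENNReal.toReal hzn
  have hz0 : z ≠ 0 := by
    rintro rfl
    exact h0 (by simpa using hzn'.symm)
  have hev := (hc.hasEigenvalue_iff_mem_spectrum hz0).2 hz
  obtain ⟨w, hw⟩ := hev.exists_hasEigenvector
  refine ⟨w, hw.2, ?_⟩
  have hAw : A w = z • w := hw.apply_eq_smul
  -- So far only `‖z‖ = ‖A‖` is known; positivity gives `z‖w‖² ≥ 0`, which singles out `z = ‖A‖`.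
  have h1 : (0 : ℂ) ≤ ⟪w, A w⟫_ℂ := hA.inner_nonneg_right w
  rw [hAw, inner_smul_right, inner_self_eq_norm_sq_to_K] at h1
  have hpos : (0 : ℂ) < (((‖w‖ ^ 2)⁻¹ : ℝ) : ℂ) := by
    have := norm_pos_iff.2 hw.2
    exact_mod_cast (by positivity : (0 : ℝ) < (‖w‖ ^ 2)⁻¹)
  have h2 : (0 : ℂ) ≤ z := by
    have := mul_nonneg h1 hpos.le
    have hw' : ((‖w‖ : ℝ) : ℂ) ≠ 0 := by exact_mod_cast (norm_pos_iff.2 hw.2).ne'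
    have h3 : z * ((‖w‖ : ℝ) : ℂ) ^ 2 * (((‖w‖ ^ 2)⁻¹ : ℝ) : ℂ) = z := by
      push_cast
      field_simp
    rwa [show ((RCLike.ofReal ‖w‖ : ℂ)) = ((‖w‖ : ℝ) : ℂ) from rfl, h3] at this
  rw [hAw, ← hzn', Complex.norm_of_nonneg' h2]

/-- Even powers of a self-adjoint contraction converge strongly. -/
lemma exists_tendsto_even_pow [CompleteSpace H] {B : H →L[ℂ] H} (hB : B.IsSymmetric)
    (h1 : ‖B‖ ≤ 1) (x : H) : ∃ y, Tendsto (fun n : ℕ => (B ^ (2 * n)) x) atTop (𝓝 y) := by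
  have hsucc : ∀ n, ‖(B ^ (n + 1)) x‖ ≤ ‖(B ^ n) x‖ := by
    intro n
    rw [pow_succ']
    calc ‖B ((B ^ n) x)‖ ≤ ‖B‖ * ‖(B ^ n) x‖ := B.le_opNorm _
      _ ≤ 1 * ‖(B ^ n) x‖ := by gcongr
      _ = _ := one_mul _
  have hanti : Antitone fun n : ℕ => ‖(B ^ n) x‖ ^ 2 :=
    antitone_nat_of_succ_le fun n => by gcongr; exact hsucc n
  obtain ⟨a, ha⟩ : ∃ a, Tendsto (fun n : ℕ => ‖(B ^ n) x‖ ^ 2) atTop (𝓝 a) :=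
    ⟨_, tendsto_atTop_ciInf hanti ⟨0, by rintro _ ⟨n, rfl⟩; positivity⟩⟩
  have hsym : ∀ (n : ℕ) (u v : H), ⟪(B ^ n) u, v⟫_ℂ = ⟪u, (B ^ n) v⟫_ℂ := by
    intro n
    induction n with
    | zero => intro u v; simp
    | succ n ih =>
      intro u v
      rw [pow_succ, mul_apply_eq_comp, ih, ← pow_succ, pow_succ', mul_apply_eq_comp]
      exact (hB u ((B ^ n) v))
  -- With even exponents the cross term `⟪B²ⁿx, B²ᵐx⟫` is exactly `‖Bⁿ⁺ᵐx‖²`, so the Cauchy property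
  -- follows from convergence of the decreasing sequence `‖Bⁿx‖²`.
  have hid : ∀ n m : ℕ, ‖(B ^ (2 * n)) x - (B ^ (2 * m)) x‖ ^ 2 =
      ‖(B ^ (2 * n)) x‖ ^ 2 - 2 * ‖(B ^ (n + m)) x‖ ^ 2 + ‖(B ^ (2 * m)) x‖ ^ 2 := by
    intro n m
    rw [norm_sub_sq (𝕜 := ℂ)]
    congr 3
    have : (B ^ (2 * n)) x = (B ^ n) ((B ^ n) x) := by
      rw [two_mul, pow_add, mul_apply_eq_comp]
    rw [this, hsym, ← mul_apply_eq_comp, ← pow_add,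
      show n + 2 * m = m + (n + m) by ring, pow_add B m, mul_apply_eq_comp, ← hsym,
      ← mul_apply_eq_comp, ← pow_add, add_comm m n]
    rw [inner_self_eq_norm_sq_to_K]
    norm_cast
  refine cauchySeq_tendsto_of_complete ?_
  rw [Metric.cauchySeq_iff']
  intro ε hε
  -- The three norms enter with weights 1, 2, 1, so errors `ε²/8` add up to `ε²/2`.
  obtain ⟨N, hN⟩ := Metric.tendsto_atTop.1 ha (ε ^ 2 / 8) (by positivity)
  refine ⟨N, fun n hn => ?_⟩
  rw [dist_eq_norm]
  have h4 := hN (2 * n) (by omega)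
  have h5 := hN (n + N) (by omega)
  have h6 := hN (2 * N) (by omega)
  rw [Real.dist_eq, abs_lt] at h4 h5 h6
  have := hid n N
  refine lt_of_pow_lt_pow_left₀ 2 hε.le ?_
  nlinarith

/-- A strongly measurable field of compact positive operators. -/
structure IsCompactPositiveField [MeasurableSpace H] (A : α → H →L[ℂ] H) : Prop where
  pos : ∀ l, (A l).IsPositive
  compact : ∀ l, IsCompactOperator (A l)
  measurable : ∀ x, Measurable fun l => A l x

lemma isCompactOperator_rankOne (φ ψ : H) :
    IsCompactOperator (InnerProductSpace.rankOne ℂ φ ψ : H →L[ℂ] H) := by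
  have : (InnerProductSpace.rankOne ℂ φ ψ : H →L[ℂ] H) =
      (ContinuousLinearMap.toSpanSingleton ℂ φ).comp (innerSL ℂ ψ) := by
    ext x; simp [InnerProductSpace.rankOne_apply]
  rw [this]
  have h1 : IsCompactOperator (ContinuousLinearMap.toSpanSingleton ℂ φ) :=
    isCompactOperator_of_locallyCompactSpace_rng _
  exact h1.comp_clm _

/-- Removing the spectral component of a unit vector from an operator. -/
def deflate (A : H →L[ℂ] H) (φ : H) : H →L[ℂ] H :=
  A - (‖A‖ : ℂ) • InnerProductSpace.rankOne ℂ φ φ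

lemma deflate_apply (A : H →L[ℂ] H) (φ x : H) :
    deflate A φ x = A x - ((‖A‖ : ℂ) * ⟪φ, x⟫_ℂ) • φ := by
  rw [deflate, sub_apply, smul_apply, InnerProductSpace.rankOne_apply,
    smul_smul]

/-- When `φ` is a top eigenvector, deflating is the same as projecting `φ` away before applying `A`;
positivity of the deflation and the decrease of its norm both come from this form. -/
lemma deflate_eq_comp {A : H →L[ℂ] H} {φ : H} (h : A φ = (‖A‖ : ℂ) • φ) (x : H) :
    deflate A φ x = A (x - ⟪φ, x⟫_ℂ • φ) := by
  rw [deflate_apply, map_sub, map_smul, h, smul_smul, mul_comm]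

lemma norm_sub_inner_smul_le {φ : H} (h : ‖φ‖ = 1) (x : H) : ‖x - ⟪φ, x⟫_ℂ • φ‖ ≤ ‖x‖ := by
  have h1 : ⟪⟪φ, x⟫_ℂ • φ, x - ⟪φ, x⟫_ℂ • φ⟫_ℂ = 0 := by
    rw [inner_smul_left, inner_sub_right, inner_smul_right, inner_self_eq_norm_sq_to_K, h]
    simp
  have h2 := norm_add_sq_eq_norm_sq_add_norm_sq_of_inner_eq_zero _ _ h1
  rw [add_sub_cancel] at h2
  nlinarith [norm_nonneg x, norm_nonneg (x - ⟪φ, x⟫_ℂ • φ),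
    mul_self_nonneg ‖⟪φ, x⟫_ℂ • φ‖]

/-- With `P` the orthogonal projection onto `φ`, the deflation is the compression `(1 - P)A(1 - P)`.
-/
lemma deflate_isPositive [CompleteSpace H] {A : H →L[ℂ] H} {φ : H} (hA : A.IsPositive)
    (h : ‖φ‖ = 1) (hφ : A φ = (‖A‖ : ℂ) • φ) : (deflate A φ).IsPositive := by
  have hx : ∀ x y, ⟪deflate A φ x, y⟫_ℂ = ⟪A (x - ⟪φ, x⟫_ℂ • φ), y - ⟪φ, y⟫_ℂ • φ⟫_ℂ := by
    intro x y
    rw [deflate_eq_comp hφ, inner_sub_right _ y, inner_smul_right,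
      hA.inner_left_eq_inner_right _ φ, hφ, inner_smul_right, inner_sub_left, inner_smul_left,
      inner_self_eq_norm_sq_to_K, h]
    simp only [RCLike.ofReal_one, one_pow, mul_one, inner_conj_symm, sub_self, mul_zero, sub_zero]
  rw [ContinuousLinearMap.isPositive_iff]
  refine ⟨fun x y => ?_, fun x => ?_⟩
  · change ⟪deflate A φ x, y⟫_ℂ = ⟪x, deflate A φ y⟫_ℂ
    rw [hx, ← inner_conj_symm x, hx, inner_conj_symm, hA.inner_left_eq_inner_right]
  · rw [hx]
    exact hA.inner_nonneg_left _

variable [MeasurableSpace H] [BorelSpace H] [SecondCountableTopology H]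

lemma measurable_clm_apply {A : α → H →L[ℂ] H} (hA : ∀ x, Measurable fun l => A l x)
    {y : α → H} (hy : Measurable y) : Measurable fun l => A l (y l) := by
  have : Measurable (Function.uncurry fun (x : H) (l : α) => A l x) :=
    measurable_uncurry_of_continuous_of_measurable (fun l => (A l).continuous) hA
  exact this.comp (hy.prodMk measurable_id)

/-- A bound on the operator norm need only be tested on a countable dense set of vectors. -/
lemma measurable_opNorm {A : α → H →L[ℂ] H} (hA : ∀ x, Measurable fun l => A l x) :
    Measurable fun l => ‖A l‖ := by
  refine measurable_of_Iic fun r => ?_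
  rcases lt_or_ge r 0 with hr | hr
  · convert MeasurableSet.empty
    ext l
    simp only [Set.mem_preimage, Set.mem_Iic, Set.mem_empty_iff_false, iff_false, not_le]
    exact hr.trans_le (norm_nonneg _)
  · have : (fun l => ‖A l‖) ⁻¹' Set.Iic r =
        ⋂ n : ℕ, {l | ‖A l (TopologicalSpace.denseSeq H n)‖ ≤
          r * ‖TopologicalSpace.denseSeq H n‖} := by
      ext l
      simp only [Set.mem_preimage, Set.mem_Iic, Set.mem_iInter, Set.mem_ofPred_eq]
      refine ⟨fun h n => (A l).le_of_opNorm_le h _, fun h => ?_⟩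
      refine (A l).opNorm_le_bound hr fun x => ?_
      have hcl : IsClosed {x | ‖A l x‖ ≤ r * ‖x‖} :=
        isClosed_le (by fun_prop) (by fun_prop)
      exact hcl.closure_subset_iff.2 (by rintro _ ⟨n, rfl⟩; exact h n)
        (TopologicalSpace.denseRange_denseSeq H x)
    rw [this]
    exact MeasurableSet.iInter fun n => measurableSet_le (hA _).norm measurable_const

/-- The projection onto the top eigenspace is the strong limit of even powers of `A/‖A‖`, hence
measurable in the parameter. Applying it to the first vector of a dense sequence that it does not
kill selects an eigenvector measurably. -/
lemma IsCompactPositiveField.exists_top_eigenvector [CompleteSpace H] {A : α → H →L[ℂ] H}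
    (hA : IsCompactPositiveField A) :
    ∃ φ : α → H, Measurable φ ∧ ∀ l, A l ≠ 0 → ‖φ l‖ = 1 ∧ A l (φ l) = (‖A l‖ : ℂ) • φ l := by
  set B : α → H →L[ℂ] H := fun l => ((‖A l‖⁻¹ : ℝ) : ℂ) • A l with hBdef
  have hBpos : ∀ l, (B l).IsPositive := fun l =>
    (hA.pos l).smul_of_nonneg (by exact_mod_cast inv_nonneg.2 (norm_nonneg _))
  have hBnorm : ∀ l, ‖B l‖ ≤ 1 := by
    intro l
    rw [hBdef, norm_smul, Complex.norm_real, norm_inv, norm_norm]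
    exact inv_mul_le_one
  have hBmeas : ∀ x, Measurable fun l => B l x := by
    intro x
    have h1 : Measurable fun l => ((‖A l‖⁻¹ : ℝ) : ℂ) :=
      Complex.measurable_ofReal.comp (measurable_opNorm hA.measurable).inv
    exact h1.smul (hA.measurable x)
  have hpow : ∀ (n : ℕ) (x : H), Measurable fun l => ((B l) ^ n) x := by
    intro n
    induction n with
    | zero => intro x; simp
    | succ n ih =>
      intro x
      simp only [pow_succ', mul_apply_eq_comp]
      exact measurable_clm_apply hBmeas (ih x)
  choose P hP using fun (l : α) (x : H) =>
    exists_tendsto_even_pow (hBpos l).isSymmetric (hBnorm l) x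
  have hPmeas : ∀ x, Measurable fun l => P l x := fun x =>
    measurable_of_tendsto_metrizable (fun n => hpow (2 * n) x)
      (tendsto_pi_nhds.2 fun l => hP l x)
  -- Shifting the index of the even powers by one leaves the limit unchanged.
  have hBB : ∀ l x, B l (B l (P l x)) = P l x := by
    intro l x
    have h1 : Tendsto (fun n : ℕ => ((B l) ^ (2 * (n + 1))) x) atTop (𝓝 (B l (B l (P l x)))) := by
      have := ((B l).continuous.tendsto _).comp (((B l).continuous.tendsto _).comp (hP l x))
      refine this.congr fun n => ?_
      simp only [Function.comp_apply, mul_add, mul_one, pow_add, add_comm _ 2, pow_two,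
        mul_apply_eq_comp]
    exact tendsto_nhds_unique h1 ((hP l x).comp (tendsto_add_atTop_nat 1))
  -- The defect `v = BPx - Px` satisfies `Bv = -v`; positivity of `B` then forces `v = 0`.
  have hBP : ∀ l x, B l (P l x) = P l x := by
    intro l x
    have h0 : B l (B l (P l x) - P l x) = -(B l (P l x) - P l x) := by
      rw [map_sub, hBB]; abel
    have h1 := (hBpos l).re_inner_nonneg_left (B l (P l x) - P l x)
    rw [h0, inner_neg_left, inner_self_eq_norm_sq_to_K] at h1
    have h2 : ‖B l (P l x) - P l x‖ ^ 2 ≤ 0 := by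
      have h3 : (RCLike.re (-((RCLike.ofReal ‖B l (P l x) - P l x‖ : ℂ)) ^ 2)) =
        -(‖B l (P l x) - P l x‖ ^ 2) := by norm_cast
      have h4 : (-((RCLike.ofReal ‖B l (P l x) - P l x‖ : ℂ)) ^ 2) =
        ((-(‖B l (P l x) - P l x‖ ^ 2) : ℝ) : ℂ) := by push_cast; rfl
      rw [h4] at h1
      simp only [Complex.ofReal_re, RCLike.re_to_complex] at h1
      linarith
    have h3 : ‖B l (P l x) - P l x‖ = 0 := by
      have := norm_nonneg (B l (P l x) - P l x)
      nlinarith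
    exact sub_eq_zero.1 (norm_eq_zero.1 h3)
  -- A top eigenvector `w` is fixed by `B`, so `⟪P y, w⟫ = ⟪y, w⟫`. If `P` killed the dense
  -- sequence, `w` would be orthogonal to everything.
  have hex : ∀ l, A l ≠ 0 → ∃ n : ℕ, P l (TopologicalSpace.denseSeq H n) ≠ 0 := by
    intro l hl
    obtain ⟨w, hw0, hw⟩ := exists_eigenvector_norm (hA.pos l) (hA.compact l) hl
    have hBw : B l w = w := by
      have : (‖A l‖ : ℂ) ≠ 0 := by exact_mod_cast (norm_pos_iff.2 hl).ne'
      simp only [hBdef, smul_apply, hw, smul_smul]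
      push_cast
      rw [inv_mul_cancel₀ this, one_smul]
    have hBnw : ∀ n : ℕ, ∀ y, ⟪((B l) ^ n) y, w⟫_ℂ = ⟪y, w⟫_ℂ := by
      intro n
      induction n with
      | zero => intro y; simp
      | succ n ih =>
        intro y
        rw [pow_succ, mul_apply_eq_comp, ih,
          (hBpos l).inner_left_eq_inner_right, hBw]
    have hPw : ∀ y, ⟪P l y, w⟫_ℂ = ⟪y, w⟫_ℂ := by
      intro y
      have h1 : Tendsto (fun n : ℕ => ⟪((B l) ^ (2 * n)) y, w⟫_ℂ) atTop (𝓝 ⟪P l y, w⟫_ℂ) :=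
        (hP l y).inner tendsto_const_nhds
      simp only [hBnw] at h1
      exact tendsto_nhds_unique tendsto_const_nhds h1 |>.symm
    by_contra! hcon
    have hz : ∀ y, ⟪y, w⟫_ℂ = 0 := by
      intro y
      have hcl : IsClosed {y : H | ⟪y, w⟫_ℂ = 0} :=
        isClosed_eq (by fun_prop) continuous_const
      refine hcl.closure_subset_iff.2 ?_ (TopologicalSpace.denseRange_denseSeq H y)
      rintro _ ⟨n, rfl⟩
      simp only [Set.mem_ofPred_eq]
      rw [← hPw, hcon, inner_zero_left]
    exact hw0 (inner_self_eq_zero.1 (hz w))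
  classical
  -- The disjunct `A l = 0` makes the search for an index always succeed; nothing is claimed about
  -- the vector chosen there.
  let p : ℕ → α → Prop := fun n l => A l = 0 ∨ P l (TopologicalSpace.denseSeq H n) ≠ 0
  have hp : ∀ l, ∃ n, p n l := by
    intro l
    by_cases h : A l = 0
    · exact ⟨0, Or.inl h⟩
    · obtain ⟨n, hn⟩ := hex l h
      exact ⟨n, Or.inr hn⟩
  have hpm : ∀ n, MeasurableSet {l | p n l} := by
    intro n
    have h1 : MeasurableSet {l | A l = 0} := by
      have := measurable_opNorm hA.measurable (measurableSet_singleton (0 : ℝ))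
      convert this using 1
      ext l
      simp
    exact h1.union ((hPmeas _) (measurableSet_singleton (0 : H))).compl
  let ψ : α → H := fun l => P l (TopologicalSpace.denseSeq H (Nat.find (hp l)))
  have hψ : Measurable ψ := Measurable.find (fun n => hPmeas (TopologicalSpace.denseSeq H n)) hpm hp
  refine ⟨fun l => ((‖ψ l‖⁻¹ : ℝ) : ℂ) • ψ l, ?_, ?_⟩
  · exact (Complex.measurable_ofReal.comp hψ.norm.inv).smul hψ
  · intro l hl
    have hne : ψ l ≠ 0 := (Nat.find_spec (hp l)).resolve_left hl
    refine ⟨?_, ?_⟩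
    · rw [norm_smul, Complex.norm_real, norm_inv, norm_norm,
        inv_mul_cancel₀ (norm_pos_iff.2 hne).ne']
    · rw [map_smul, smul_comm]
      congr 1
      have h1 : B l (ψ l) = ψ l := hBP l _
      have : (‖A l‖ : ℂ) ≠ 0 := by exact_mod_cast (norm_pos_iff.2 hl).ne'
      conv_rhs => rw [← h1]
      simp only [hBdef, smul_apply, smul_smul]
      push_cast
      rw [mul_inv_cancel₀ this, one_smul]



lemma IsCompactPositiveField.exists_deflation [CompleteSpace H] {A : α → H →L[ℂ] H}
    (hA : IsCompactPositiveField A) :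
    ∃ φ : α → H, Measurable φ ∧
      (∀ l, A l ≠ 0 → ‖φ l‖ = 1 ∧ A l (φ l) = (‖A l‖ : ℂ) • φ l) ∧
      IsCompactPositiveField fun l => deflate (A l) (φ l) := by
  obtain ⟨φ, hφ, h⟩ := hA.exists_top_eigenvector
  refine ⟨φ, hφ, h, ⟨fun l => ?_, fun l => ?_, fun x => ?_⟩⟩
  · by_cases h0 : A l = 0
    · simp [deflate, h0]
    · exact deflate_isPositive (hA.pos l) (h l h0).1 (h l h0).2
  · exact (hA.compact l).sub ((isCompactOperator_rankOne (φ l) (φ l)).smul (‖A l‖ : ℂ))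
  · simp only [deflate_apply]
    exact (hA.measurable x).sub (((Complex.measurable_ofReal.comp
      (measurable_opNorm hA.measurable)).mul (hφ.inner measurable_const)).smul hφ)

/-- A measurable field of compact, positive and injective operators on an infinite-dimensional
separable Hilbert space has a measurable orthonormal basis of eigenvectors, with eigenvalues in
nonincreasing order. -/
theorem IsCompactPositiveField.exists_measurable_eigenbasis [CompleteSpace H]
    {A : α → H →L[ℂ] H} (hA : IsCompactPositiveField A) (hinj : ∀ l x, A l x = 0 → x = 0)
    (hdim : ¬ FiniteDimensional ℂ H) :
    ∃ (μ : ℕ → α → ℝ) (φ : ℕ → α → H), (∀ n, Measurable (φ n)) ∧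
      (∀ l, Orthonormal ℂ fun n => φ n l) ∧ (∀ n l, A l (φ n l) = (μ n l : ℂ) • φ n l) ∧
      (∀ n l, 0 < μ n l) ∧ (∀ l, Antitone fun n => μ n l) ∧
      (∀ l, Tendsto (fun n => μ n l) atTop (𝓝 0)) ∧
      ∀ l x, (∀ n, ⟪φ n l, x⟫_ℂ = 0) → x = 0 := by
  classical
  -- The eigenvector field is chosen as a function of the operator field alone, with no dependence
  -- on the proof of compactness and positivity, so that deflation can be iterated by plain
  -- recursion.
  choose! g hgm hg hgd using fun (B : α → H →L[ℂ] H) (hB : IsCompactPositiveField B) =>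
    hB.exists_deflation
  let Q : ℕ → α → H →L[ℂ] H := fun n =>
    Nat.rec A (fun _ B => fun l => deflate (B l) (g B l)) n
  have hQ0 : Q 0 = A := rfl
  have hQs : ∀ n, Q (n + 1) = fun l => deflate (Q n l) (g (Q n) l) := fun n => rfl
  have hQ : ∀ n, IsCompactPositiveField (Q n) := by
    intro n
    induction n with
    | zero => exact hA
    | succ n ih => rw [hQs]; exact hgd _ ih
  set φ : ℕ → α → H := fun n => g (Q n) with hφ
  set μ : ℕ → α → ℝ := fun n l => ‖Q n l‖ with hμ
  have happ : ∀ n l x, Q (n + 1) l x = Q n l x - ((μ n l : ℂ) * ⟪φ n l, x⟫_ℂ) • φ n l := by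
    intro n l x
    rw [hQs, deflate_apply]
  -- The first `n` deflations alter `A` only along the eigenvectors removed so far.
  have hAQ : ∀ n l x, (∀ i < n, ⟪φ i l, x⟫_ℂ = 0) → Q n l x = A l x := by
    intro n l x
    induction n with
    | zero => intro _; rfl
    | succ n ih =>
      intro h
      rw [happ, h n n.lt_succ_self, ih fun i hi => h i (hi.trans n.lt_succ_self)]
      simp
  -- If the process stopped, `A` would vanish on the orthogonal complement of a finite-dimensional
  -- space; by injectivity that complement is zero, contradicting infinite dimension.
  have hne : ∀ n l, Q n l ≠ 0 := by
    intro n l h0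
    let S : Submodule ℂ H := Submodule.span ℂ (Set.range fun i : Fin n => φ i l)
    have hSfin : FiniteDimensional ℂ S := FiniteDimensional.span_of_finite ℂ (Set.finite_range _)
    have hS : Sᗮ = ⊥ := by
      rw [Submodule.eq_bot_iff]
      intro x hx
      refine hinj l x ?_
      rw [← hAQ n l x, h0]
      · rfl
      · intro i hi
        exact (Submodule.mem_orthogonal S x).1 hx _ (Submodule.subset_span ⟨⟨i, hi⟩, rfl⟩)
    rw [Submodule.orthogonal_eq_bot_iff] at hS
    rw [hS] at hSfin
    exact hdim (Submodule.topEquiv (R := ℂ) (M := H)).finiteDimensional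
  have hφ1 : ∀ n l, ‖φ n l‖ = 1 := fun n l => (hg _ (hQ n) l (hne n l)).1
  have hφe : ∀ n l, Q n l (φ n l) = (μ n l : ℂ) • φ n l := fun n l =>
    (hg _ (hQ n) l (hne n l)).2
  have hμpos : ∀ n l, 0 < μ n l := fun n l => norm_pos_iff.2 (hne n l)
  have hker : ∀ n l, ∀ i < n, Q n l (φ i l) = 0 := by
    intro n l
    induction n with
    | zero => intro i hi; omega
    | succ n ih =>
      intro i hi
      rcases Nat.lt_succ_iff_lt_or_eq.1 hi with h | rfl
      · have h1 : ⟪φ n l, φ i l⟫_ℂ = 0 := by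
          have h2 := (hQ n).pos l |>.inner_left_eq_inner_right (φ n l) (φ i l)
          rw [ih i h, inner_zero_right, hφe, inner_smul_left] at h2
          refine (mul_eq_zero.1 h2).resolve_left ?_
          simpa using (hμpos n l).ne'
        rw [happ, ih i h, h1]
        simp
      · rw [happ, hφe, inner_self_eq_norm_sq_to_K, hφ1]
        simp
  have horth' : ∀ l, ∀ i n, i < n → ⟪φ i l, φ n l⟫_ℂ = 0 := by
    intro l i n hin
    have h2 := (hQ n).pos l |>.inner_left_eq_inner_right (φ i l) (φ n l)
    rw [hker n l i hin, inner_zero_left, hφe, inner_smul_right] at h2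
    refine (mul_eq_zero.1 h2.symm).resolve_left ?_
    exact_mod_cast (hμpos n l).ne'
  have horth : ∀ l, Orthonormal ℂ fun n => φ n l := by
    intro l
    refine ⟨fun n => hφ1 n l, fun i j hij => ?_⟩
    rcases lt_or_gt_of_ne hij with h | h
    · exact horth' l i j h
    · rw [← inner_conj_symm, horth' l j i h, map_zero]
  have heig : ∀ n l, A l (φ n l) = (μ n l : ℂ) • φ n l := by
    intro n l
    rw [← hφe, hAQ n l]
    exact fun i hi => horth' l i n hi
  have hanti : ∀ l, Antitone fun n => μ n l := by
    intro l
    refine antitone_nat_of_succ_le fun n => ?_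
    refine ContinuousLinearMap.opNorm_le_bound _ (norm_nonneg _) fun x => ?_
    rw [hQs, deflate_eq_comp (hφe n l)]
    refine ((Q n l).le_opNorm _).trans ?_
    gcongr
    exact norm_sub_inner_smul_le (hφ1 n l) x
  -- If the eigenvalues stayed above `a > 0`, the images of the orthonormal eigenvectors under `A`
  -- would be at mutual distance at least `a`, against compactness.
  have hlim : ∀ l, Tendsto (fun n => μ n l) atTop (𝓝 0) := by
    intro l
    have hbdd : BddBelow (Set.range fun n => μ n l) := ⟨0, by
      rintro _ ⟨n, rfl⟩; exact (hμpos n l).le⟩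
    have h1 := tendsto_atTop_ciInf (hanti l) hbdd
    set a := ⨅ n, μ n l
    have ha0 : 0 ≤ a := le_ciInf fun n => (hμpos n l).le
    rcases ha0.eq_or_lt with ha | ha
    · rwa [ha]
    exfalso
    have hle : ∀ n, a ≤ μ n l := fun n => ciInf_le hbdd n
    have hcpt := (hA.compact l).isCompact_closure_image_closedBall 1
    have hmem : ∀ n, A l (φ n l) ∈ closure (A l '' Metric.closedBall 0 1) := fun n =>
      subset_closure ⟨φ n l, by simp [hφ1], rfl⟩
    obtain ⟨y, -, σ, hσ, hy⟩ := hcpt.tendsto_subseq hmem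
    obtain ⟨N, hN⟩ := Metric.tendsto_atTop.1 hy (a / 2) (by positivity)
    have hd : dist (A l (φ (σ N) l)) (A l (φ (σ (N + 1)) l)) < a := by
      have h2 := hN N le_rfl
      have h3 := hN (N + 1) (by omega)
      simp only [Function.comp_apply] at h2 h3
      linarith [dist_triangle_right (A l (φ (σ N) l)) (A l (φ (σ (N + 1)) l)) y]
    have hlt : σ N < σ (N + 1) := hσ (by omega)
    rw [heig, heig, dist_eq_norm] at hd
    have h4 : ⟪φ (σ N) l, (μ (σ N) l : ℂ) • φ (σ N) l -
        (μ (σ (N + 1)) l : ℂ) • φ (σ (N + 1)) l⟫_ℂ = μ (σ N) l := by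
      rw [inner_sub_right, inner_smul_right, inner_smul_right, horth' l _ _ hlt,
        inner_self_eq_norm_sq_to_K, hφ1]
      simp
    have h5 := norm_inner_le_norm (𝕜 := ℂ) (φ (σ N) l) ((μ (σ N) l : ℂ) • φ (σ N) l -
        (μ (σ (N + 1)) l : ℂ) • φ (σ (N + 1)) l)
    rw [h4, hφ1, one_mul, Complex.norm_real, Real.norm_of_nonneg (hμpos _ _).le] at h5
    linarith [hle (σ N)]
  refine ⟨μ, φ, fun n => hgm _ (hQ n), horth, heig, hμpos, hanti, hlim, fun l x hx => ?_⟩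
  refine hinj l x (norm_eq_zero.1 (le_antisymm ?_ (norm_nonneg _)))
  -- A vector orthogonal to all eigenvectors is untouched by deflation, so `A` maps it to norm at
  -- most `μₙ‖x‖` for every `n`.
  have h1 : ∀ n, ‖A l x‖ ≤ μ n l * ‖x‖ := by
    intro n
    rw [← hAQ n l x fun i _ => hx i]
    exact (Q n l).le_opNorm x
  have h2 : Tendsto (fun n => μ n l * ‖x‖) atTop (𝓝 (0 * ‖x‖)) := (hlim l).mul_const _
  rw [zero_mul] at h2
  exact ge_of_tendsto' h2 h1

end MeasurableSpectral

end FloquetBloch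

namespace FloquetBloch

/-! ### Diagonal operators and resolvents of their bounded perturbations. -/

section Resolvent

open scoped InnerProductSpace ComplexOrder

variable {α H ι : Type*} [MeasurableSpace α] [NormedAddCommGroup H] [InnerProductSpace ℂ H]

lemma hilbertBasis_ext (b : HilbertBasis ι ℂ H) {x y : H} (h : ∀ i, ⟪b i, x⟫_ℂ = ⟪b i, y⟫_ℂ) :
    x = y := by
  refine b.repr.injective (lp.ext (funext fun i => ?_))
  rw [b.repr_apply_apply, b.repr_apply_apply, h]

lemma hilbertBasis_hasSum_norm_sq (b : HilbertBasis ι ℂ H) (x : H) :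
    HasSum (fun i => ‖⟪b i, x⟫_ℂ‖ ^ 2) (‖x‖ ^ 2) := by
  have h := (b.hasSum_inner_mul_inner x x).mapL Complex.reCLM
  convert h using 1
  · funext i
    rw [← inner_conj_symm x (b i), ← Complex.normSq_eq_conj_mul_self, Complex.normSq_eq_norm_sq]
    simp only [Complex.reCLM_apply, Complex.ofReal_re]
  · rw [inner_self_eq_norm_sq_to_K]
    simp [← Complex.ofReal_pow]

lemma exists_diagonal (b : HilbertBasis ι ℂ H) {t : ι → ℝ} {M : ℝ} (hM : 0 ≤ M)
    (ht : ∀ i, |t i| ≤ M) :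
    ∃ T : H →L[ℂ] H, (∀ x i, ⟪b i, T x⟫_ℂ = t i * ⟪b i, x⟫_ℂ) ∧ ‖T‖ ≤ M := by
  let D : ∀ _ : ι, ℂ →L[ℂ] ℂ := fun i => (t i : ℂ) • ContinuousLinearMap.id ℂ ℂ
  have hD : ∀ i, ‖D i‖ ≤ M := fun i => by
    refine (norm_smul_le (t i : ℂ) (ContinuousLinearMap.id ℂ ℂ)).trans ?_
    rw [Complex.norm_real, Real.norm_eq_abs, ContinuousLinearMap.norm_id, mul_one]
    exact ht i
  let L := lp.mapCLM 2 D hM hD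
  have hT : ∀ x, b.repr (b.repr.symm (L (b.repr x))) = L (b.repr x) := fun x => by simp
  refine ⟨(b.repr.symm.toContinuousLinearEquiv : _ →L[ℂ] H).comp
    (L.comp (b.repr.toContinuousLinearEquiv : H →L[ℂ] _)), fun x i => ?_, ?_⟩
  · rw [← b.repr_apply_apply, ← b.repr_apply_apply]
    change b.repr (b.repr.symm (L (b.repr x))) i = _
    rw [hT]
    simp [L, D]
  · refine ContinuousLinearMap.opNorm_le_bound _ hM fun x => ?_
    change ‖b.repr.symm (L (b.repr x))‖ ≤ _
    rw [LinearIsometryEquiv.norm_map]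
    refine (L.le_of_opNorm_le (lp.norm_mapCLM_le 2 D hM hD) _).trans ?_
    rw [LinearIsometryEquiv.norm_map]

/-- Finite-rank truncations converge in norm, since the error is again diagonal with uniformly small
entries and `exists_diagonal` bounds its norm. -/
lemma isCompactOperator_of_diagonal [CompleteSpace H] (b : HilbertBasis ι ℂ H) {t : ι → ℝ}
    (ht : Tendsto t cofinite (𝓝 0)) {T : H →L[ℂ] H}
    (hT : ∀ x i, ⟪b i, T x⟫_ℂ = t i * ⟪b i, x⟫_ℂ) : IsCompactOperator T := by
  classical
  let F : Finset ι → H →L[ℂ] H := fun s =>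
    ∑ i ∈ s, (t i : ℂ) • InnerProductSpace.rankOne ℂ (b i) (b i)
  have hF : ∀ s x i, ⟪b i, F s x⟫_ℂ = (if i ∈ s then (t i : ℂ) else 0) * ⟪b i, x⟫_ℂ := by
    intro s x i
    have h : F s x = ∑ j ∈ s, ((t j : ℂ) * ⟪b j, x⟫_ℂ) • b j := by
      simp only [F, sum_apply, smul_apply, InnerProductSpace.rankOne_apply,
        smul_smul]
    rw [h, inner_sum]
    simp only [inner_smul_right, orthonormal_iff_ite.1 b.orthonormal, mul_ite, mul_one, mul_zero,
      Finset.sum_ite_eq, ite_mul, zero_mul]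
  refine isCompactOperator_of_tendsto (l := atTop) (F := F) ?_ (Eventually.of_forall fun s => ?_)
  · rw [Metric.tendsto_atTop]
    intro ε hε
    have hfin : {i | ¬ |t i| < ε / 2}.Finite := by
      have := (Metric.tendsto_nhds.1 ht) (ε / 2) (by positivity)
      simpa [Real.dist_eq] using this
    refine ⟨hfin.toFinset, fun s hs => ?_⟩
    rw [dist_eq_norm, ← norm_neg, neg_sub]
    refine lt_of_le_of_lt (b := ε / 2) ?_ (by linarith)
    let u : ι → ℝ := fun i => if i ∈ s then 0 else t i
    obtain ⟨U, hU, hUn⟩ := exists_diagonal b (t := u) (M := ε / 2) (by positivity) (by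
      intro i
      by_cases hi : i ∈ s
      · simp only [u, hi, if_true, abs_zero]; positivity
      · simp only [u, hi, if_false]
        by_contra h
        exact hi (hs (by simpa using (not_le.1 h).le)))
    have hTU : T - F s = U := by
      ext x
      refine hilbertBasis_ext b fun i => ?_
      rw [hU, sub_apply, inner_sub_right, hT, hF]
      by_cases hi : i ∈ s <;> simp [u, hi]
    rwa [hTU]
  · refine Submodule.sum_mem (compactOperator (RingHom.id ℂ) H H) fun i _ => ?_
    exact (isCompactOperator_rankOne (b i) (b i)).smul (t i : ℂ)

variable [MeasurableSpace H] [BorelSpace H] [SecondCountableTopology H] 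

/-- The field of resolvents `(D + C + W)⁻¹`, where `D + C` is diagonal with entries `t⁻¹`. -/
theorem exists_resolvent_field [CompleteSpace H] [Countable ι] (b : HilbertBasis ι ℂ H)
    {t : α → ι → ℝ} {C : ℝ} (hC : 0 < C) (ht0 : ∀ l i, 0 < t l i) (htC : ∀ l i, t l i ≤ C⁻¹)
    (htm : ∀ i, Measurable fun l => t l i) (htl : ∀ l, Tendsto (t l) cofinite (𝓝 0))
    {W : H →L[ℂ] H} (hW : W.IsSymmetric) (hWC : ‖W‖ ≤ C / 2) :
    ∃ R : α → H →L[ℂ] H, IsCompactPositiveField R ∧ (∀ l x, R l x = 0 → x = 0) ∧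
      ∀ (l : α) (p : H) (μ : ℝ), R l p = (μ : ℂ) • p ↔
        ∀ i, t l i * ⟪b i, p⟫_ℂ = μ * (⟪b i, p⟫_ℂ + t l i * ⟪b i, W p⟫_ℂ) := by
  choose T hT hTn using fun l => exists_diagonal b (t := t l) (M := C⁻¹) (by positivity)
    (fun i => by rw [abs_of_pos (ht0 l i)]; exact htC l i)
  have hTmeas : ∀ x, Measurable fun l => T l x := by
    intro x
    have h1 : ∀ l, HasSum (fun i => ((t l i : ℂ) * ⟪b i, x⟫_ℂ) • b i) (T l x) := by
      intro l
      have := b.hasSum_repr (T l x)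
      simpa only [b.repr_apply_apply, hT] using this
    refine measurable_of_tendsto_metrizable' (atTop : Filter (Finset ι)) (fun s => ?_)
      (tendsto_pi_nhds.2 fun l => (h1 l))
    refine Finset.measurable_sum _ fun i _ => ?_
    exact ((Complex.measurable_ofReal.comp (htm i)).mul_const _).smul_const _
  -- Write `T = (D + C)⁻¹`. The resolvent is `T(1 + WT)⁻¹`, and `‖WT‖ ≤ (C/2)·C⁻¹ = 1/2` lets the
  -- inverse be summed as a Neumann series, which also gives measurability.
  set X : α → H →L[ℂ] H := fun l => -(W * T l) with hX
  have hXn : ∀ l, ‖X l‖ ≤ 1 / 2 := by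
    intro l
    rw [hX, norm_neg]
    refine (norm_mul_le _ _).trans ?_
    calc ‖W‖ * ‖T l‖ ≤ C / 2 * C⁻¹ := by gcongr; exact hTn l
      _ = 1 / 2 := by field_simp
  have hX1 : ∀ l, ‖X l‖ < 1 := fun l => (hXn l).trans_lt (by norm_num)
  have hXmeas : ∀ x, Measurable fun l => X l x := fun x =>
    (W.continuous.measurable.comp (hTmeas x)).neg
  set N : α → H →L[ℂ] H := fun l => ∑' n : ℕ, X l ^ n with hN
  have hNs : ∀ l, HasSum (fun n : ℕ => X l ^ n) (N l) := fun l =>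
    (summable_geometric_of_norm_lt_one (hX1 l)).hasSum
  have hNmeas : ∀ x, Measurable fun l => N l x := by
    intro x
    have hpow : ∀ n : ℕ, Measurable fun l => (X l ^ n) x := by
      intro n
      induction n with
      | zero => simp
      | succ n ih =>
        simp only [pow_succ', mul_apply_eq_comp]
        exact measurable_clm_apply hXmeas ih
    refine measurable_of_tendsto_metrizable' (atTop : Filter (Finset ℕ))
      (f := fun s l => ∑ n ∈ s, (X l ^ n) x) (fun s => Finset.measurable_sum _ fun n _ => hpow n)
      (tendsto_pi_nhds.2 fun l => ?_)
    exact (hNs l).mapL (ContinuousLinearMap.apply ℂ H x)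
  have hNr : ∀ l, (1 + W * T l) * N l = 1 := by
    intro l
    have := mul_neg_geom_series (X l) (hX1 l)
    rwa [hX, sub_neg_eq_add] at this
  have hTs : ∀ l, star (T l) = T l := by
    intro l
    rw [← isSelfAdjoint_iff, ContinuousLinearMap.isSelfAdjoint_iff_isSymmetric]
    intro x y
    change ⟪T l x, y⟫_ℂ = ⟪x, T l y⟫_ℂ
    rw [← b.tsum_inner_mul_inner, ← b.tsum_inner_mul_inner]
    congr 1
    funext i
    rw [← inner_conj_symm, hT, hT, map_mul, inner_conj_symm, Complex.conj_ofReal]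
    ring
  have hWs : star W = W := by
    rw [← isSelfAdjoint_iff, ContinuousLinearMap.isSelfAdjoint_iff_isSymmetric]
    exact hW
  -- Taking adjoints turns the right inverse of `1 + WT` into a left inverse of `1 + TW`; the latter
  -- is used both for self-adjointness and to cancel `1 + TW` at the end.
  have hNst : ∀ l, star (N l) * (1 + T l * W) = 1 := by
    intro l
    have := congrArg star (hNr l)
    simpa [star_mul, star_add, hTs, hWs] using this
  have hR' : ∀ l, star (N l) * T l = T l * N l := by
    intro l
    calc star (N l) * T l = star (N l) * (T l * ((1 + W * T l) * N l)) := by rw [hNr, mul_one]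
      _ = (star (N l) * (1 + T l * W)) * (T l * N l) := by noncomm_ring
      _ = T l * N l := by rw [hNst, one_mul]
  set R : α → H →L[ℂ] H := fun l => T l * N l with hR
  have hRsa : ∀ l, IsSelfAdjoint (R l) := by
    intro l
    rw [isSelfAdjoint_iff, hR, star_mul, hTs, hR']
  have hReq : ∀ l, (1 + T l * W) * R l = T l := by
    intro l
    calc (1 + T l * W) * R l = T l * ((1 + W * T l) * N l) := by rw [hR]; noncomm_ring
      _ = T l := by rw [hNr, mul_one]
  have hcoef : ∀ l x i, ⟪b i, R l x⟫_ℂ + t l i * ⟪b i, W (R l x)⟫_ℂ = t l i * ⟪b i, x⟫_ℂ := by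
    intro l x i
    have h := congrArg (fun S : H →L[ℂ] H => ⟪b i, S x⟫_ℂ) (hReq l)
    simpa [mul_apply_eq_comp, inner_add_right, hT] using h
  -- With `y = Rx` one has `x - Wy = T⁻¹y` coefficientwise. Then `⟪y, T⁻¹y⟫ ≥ C‖y‖²` dominates `|⟪y,
  -- Wy⟫| ≤ (C/2)‖y‖²`.
  have hpos : ∀ l x, 0 ≤ (⟪R l x, x⟫_ℂ).re := by
    intro l x
    set y := R l x with hy
    have h1 := (b.hasSum_inner_mul_inner y (x - W y)).mapL Complex.reCLM
    have h2 : ∀ i, Complex.reCLM (⟪y, b i⟫_ℂ * ⟪b i, x - W y⟫_ℂ) =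
        (t l i)⁻¹ * ‖⟪b i, y⟫_ℂ‖ ^ 2 := by
      intro i
      have h3 : ⟪b i, x - W y⟫_ℂ = ((t l i)⁻¹ : ℝ) * ⟪b i, y⟫_ℂ := by
        have hne : (t l i : ℂ) ≠ 0 := by exact_mod_cast (ht0 l i).ne'
        rw [inner_sub_right]
        have := hcoef l x i
        rw [← hy] at this
        push_cast
        field_simp
        linear_combination -this
      rw [h3, ← inner_conj_symm y (b i)]
      rw [mul_left_comm, ← Complex.normSq_eq_conj_mul_self, Complex.normSq_eq_norm_sq]
      simp only [Complex.reCLM_apply, ← Complex.ofReal_mul, Complex.ofReal_re]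
    simp only [h2] at h1
    have h4 := (hilbertBasis_hasSum_norm_sq b y).mul_left C
    have h5 : C * ‖y‖ ^ 2 ≤ (⟪y, x - W y⟫_ℂ).re := by
      refine hasSum_le (fun i => ?_) h4 h1
      gcongr
      rw [← inv_inv C]
      exact inv_anti₀ (ht0 l i) (htC l i)
    rw [inner_sub_right, Complex.sub_re] at h5
    have h6 : |(⟪y, W y⟫_ℂ).re| ≤ C / 2 * ‖y‖ ^ 2 := by
      refine (Complex.abs_re_le_norm _).trans ((norm_inner_le_norm _ _).trans ?_)
      have := W.le_of_opNorm_le hWC y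
      nlinarith [norm_nonneg y]
    have h7 : 0 ≤ C / 2 * ‖y‖ ^ 2 := by positivity
    linarith [neg_abs_le (⟪y, W y⟫_ℂ).re]
  refine ⟨R, ⟨fun l => ?_, fun l => ?_, fun x => ?_⟩, fun l x hx => ?_, fun l p μ => ?_⟩
  · rw [ContinuousLinearMap.isPositive_def']
    exact ⟨hRsa l, fun x => hpos l x⟩
  · exact (isCompactOperator_of_diagonal b (htl l) (hT l)).comp_clm (N l)
  · exact measurable_clm_apply hTmeas (hNmeas x)
  · refine hilbertBasis_ext b fun i => ?_
    have h := hcoef l x i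
    rw [hx, map_zero, inner_zero_right, mul_zero, add_zero] at h
    rw [inner_zero_right]
    refine (mul_eq_zero.1 h.symm).resolve_left ?_
    exact_mod_cast (ht0 l i).ne'
  · constructor
    · intro h i
      have h1 := hcoef l p i
      rw [h, map_smul, inner_smul_right, inner_smul_right] at h1
      rw [← h1]
      ring
    · intro h
      -- The coefficient equations say `Tp = μ(1 + TW)p`, while `Tp = (1 + TW)Rp`; the left inverse
      -- removes `1 + TW`.
      have h1 : (1 + T l * W) (R l p) = (1 + T l * W) ((μ : ℂ) • p) := by
        refine hilbertBasis_ext b fun i => ?_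
        rw [← mul_apply_eq_comp, hReq, hT, h i]
        simp only [map_smul, inner_smul_right]
        simp [mul_apply_eq_comp, inner_add_right, hT]
      have h2 : (star (N l) * (1 + T l * W)) (R l p) = (star (N l) * (1 + T l * W)) ((μ : ℂ) • p) :=
        congrArg (fun z => (star (N l) : H →L[ℂ] H) z) h1
      rwa [hNst] at h2

end Resolvent

end FloquetBloch

namespace FloquetBloch

/-! ### Plane waves -/

lemma phase_add_right (k x y : Plane) : phase k (x + y) = phase k x * phase k y := by
  simp only [phase, inner_add_right, Complex.ofReal_add, mul_add, Complex.exp_add]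

lemma phase_add_left (k l x : Plane) : phase (k + l) x = phase k x * phase l x := by
  simp only [phase, inner_add_left, Complex.ofReal_add, mul_add, Complex.exp_add]

@[simp] lemma phase_zero_left (x : Plane) : phase 0 x = 1 := by simp [phase]

@[simp] lemma phase_zero_right (k : Plane) : phase k 0 = 1 := by simp [phase]

@[simp] lemma norm_phase (k x : Plane) : ‖phase k x‖ = 1 := by
  rw [phase, mul_comm, Complex.norm_exp_ofReal_mul_I]

@[simp] lemma enorm_phase (k x : Plane) : ‖phase k x‖ₑ = 1 := by
  rw [← ofReal_norm, norm_phase, ENNReal.ofReal_one]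

lemma phase_ne_zero (k x : Plane) : phase k x ≠ 0 := Complex.exp_ne_zero _

lemma conj_phase (k x : Plane) : starRingEnd ℂ (phase k x) = phase (-k) x := by
  simp only [phase, ← Complex.exp_conj, map_mul, Complex.conj_I, Complex.conj_ofReal,
    inner_neg_left, Complex.ofReal_neg]
  ring_nf

lemma phase_neg_mul_phase (k x : Plane) : phase (-k) x * phase k x = 1 := by
  rw [← phase_add_left, neg_add_cancel, phase_zero_left]

lemma phase_eq_one_of_inner {k x : Plane} {n : ℤ} (h : inner ℝ k x = 2 * Real.pi * n) :
    phase k x = 1 := by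
  rw [phase, h, Complex.exp_eq_one_iff]
  exact ⟨n, by push_cast; ring⟩

lemma contDiff_phase (k : Plane) {n : WithTop ℕ∞} : ContDiff ℝ n (phase k) := by
  unfold phase
  exact (contDiff_const.mul (Complex.ofRealCLM.contDiff.comp
    (contDiff_const.inner ℝ contDiff_id))).cexp

lemma continuous_phase (k : Plane) : Continuous (phase k) :=
  (contDiff_phase k (n := 0)).continuous

lemma continuous_phase_uncurry : Continuous fun q : Plane × Plane => phase q.1 q.2 := by
  unfold phase
  fun_prop

/-- The factors are unimodular, so the twists by phases in the definitions of the function spaces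
can be dropped or inserted freely. -/
lemma memLp_phase_mul_iff {μ : Measure Plane} {k : Plane} {p : ℝ≥0∞} {f : Plane → ℂ} :
    MemLp (fun x => phase k x * f x) p μ ↔ MemLp f p μ := by
  have key : ∀ (k : Plane) (f : Plane → ℂ), MemLp f p μ → MemLp (fun x => phase k x * f x) p μ := by
    intro k f hf
    refine hf.of_le ((continuous_phase k).aestronglyMeasurable.mul hf.1)
      (Eventually.of_forall fun x => ?_)
    rw [norm_mul, norm_phase, one_mul]
  refine ⟨fun h => ?_, key k f⟩
  have := key (-k) _ h
  simpa only [← mul_assoc, phase_neg_mul_phase, one_mul] using this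

/-! ### The lattice and its dual -/

lemma inner_plane (x y : Plane) : inner ℝ x y = x 0 * y 0 + x 1 * y 1 := by
  rw [PiLp.inner_apply, Fin.sum_univ_two]
  simp [mul_comm]

lemma inner_k₁_v₁ : inner ℝ k₁ v₁ = 2 * Real.pi := by
  rw [inner_plane]
  have h : Real.sqrt 3 ≠ 0 := by positivity
  simp [k₁, v₁]
  field_simp
  ring

lemma inner_k₁_v₂ : inner ℝ k₁ v₂ = 0 := by
  rw [inner_plane]
  have h : Real.sqrt 3 ≠ 0 := by positivity
  simp [k₁, v₂]
  field_simp
  ring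

lemma inner_k₂_v₁ : inner ℝ k₂ v₁ = 0 := by
  rw [inner_plane]
  have h : Real.sqrt 3 ≠ 0 := by positivity
  simp [k₂, v₁]
  field_simp
  ring

lemma inner_k₂_v₂ : inner ℝ k₂ v₂ = 2 * Real.pi := by
  rw [inner_plane]
  have h : Real.sqrt 3 ≠ 0 := by positivity
  simp [k₂, v₂]
  field_simp
  ring

namespace Edge

variable (e : Edge)

lemma det_real : (e.a₁ : ℝ) * e.b₂ - e.a₂ * e.b₁ = 1 := by exact_mod_cast e.det_eq_one

lemma inner_KK₁_vv₁ : inner ℝ e.KK₁ e.vv₁ = 2 * Real.pi := by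
  simp only [KK₁, vv₁, latticeVec, inner_add_right, inner_sub_left, inner_smul_left,
    inner_smul_right, inner_k₁_v₁, inner_k₁_v₂, inner_k₂_v₁, inner_k₂_v₂]
  simp only [conj_trivial]
  linear_combination (2 * Real.pi) * e.det_real

lemma inner_KK₁_vv₂ : inner ℝ e.KK₁ e.vv₂ = 0 := by
  simp only [KK₁, vv₂, latticeVec, inner_add_right, inner_sub_left, inner_smul_left,
    inner_smul_right, inner_k₁_v₁, inner_k₁_v₂, inner_k₂_v₁, inner_k₂_v₂]
  simp only [conj_trivial]
  ring

lemma inner_KK₂_vv₁ : inner ℝ e.KK₂ e.vv₁ = 0 := by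
  simp only [KK₂, vv₁, latticeVec, inner_add_right, inner_add_left, inner_neg_left,
    inner_smul_left, inner_smul_right, inner_k₁_v₁, inner_k₁_v₂, inner_k₂_v₁, inner_k₂_v₂]
  simp only [conj_trivial]
  ring

lemma inner_KK₂_vv₂ : inner ℝ e.KK₂ e.vv₂ = 2 * Real.pi := by
  simp only [KK₂, vv₂, latticeVec, inner_add_right, inner_add_left, inner_neg_left,
    inner_smul_left, inner_smul_right, inner_k₁_v₁, inner_k₁_v₂, inner_k₂_v₁, inner_k₂_v₂]
  simp only [conj_trivial]
  linear_combination (2 * Real.pi) * e.det_real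

/-- The determinant condition makes the change of basis unimodular, so its inverse has integer
entries too. -/
lemma latticeVec_eq (m n : ℤ) : latticeVec m n =
    ((m * e.b₂ - n * e.a₂ : ℤ) : ℝ) • e.vv₁ + ((n * e.a₁ - m * e.b₁ : ℤ) : ℝ) • e.vv₂ := by
  have h := e.det_real
  simp only [latticeVec, vv₁, vv₂]
  push_cast
  match_scalars
  · linear_combination -(m : ℝ) * h
  · linear_combination -(n : ℝ) * h

lemma smul_add_smul_eq (m n : ℤ) : (m : ℝ) • e.vv₁ + (n : ℝ) • e.vv₂ =
    latticeVec (m * e.a₁ + n * e.a₂) (m * e.b₁ + n * e.b₂) := by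
  simp only [latticeVec, vv₁, vv₂]
  push_cast
  module

lemma phase_dualVec_latticeVec (m : ℤ × ℤ) (a b : ℤ) :
    phase (e.dualVec m) (latticeVec a b) = 1 := by
  refine phase_eq_one_of_inner
    (n := m.1 * (a * e.b₂ - b * e.a₂) + m.2 * (b * e.a₁ - a * e.b₁)) ?_
  rw [e.latticeVec_eq, dualVec]
  simp only [inner_add_right, inner_add_left, inner_smul_left, inner_smul_right, inner_KK₁_vv₁,
    inner_KK₁_vv₂, inner_KK₂_vv₁, inner_KK₂_vv₂, conj_trivial]
  push_cast
  ring

/-! ### Lattice coordinates -/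

/-- The linear map `(s, t) ↦ s 𝔳₁ + t 𝔳₂`. -/
def coordLM : ℝ × ℝ →ₗ[ℝ] Plane where
  toFun y := y.1 • e.vv₁ + y.2 • e.vv₂
  map_add' y z := by simp only [Prod.fst_add, Prod.snd_add]; module
  map_smul' c y := by
    simp only [Prod.smul_fst, Prod.smul_snd, smul_eq_mul, RingHom.id_apply]; module

lemma inner_KK₁_coord (s t : ℝ) : inner ℝ e.KK₁ (s • e.vv₁ + t • e.vv₂) = 2 * Real.pi * s := by
  simp only [inner_add_right, inner_smul_right, inner_KK₁_vv₁, inner_KK₁_vv₂]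
  ring

lemma inner_KK₂_coord (s t : ℝ) : inner ℝ e.KK₂ (s • e.vv₁ + t • e.vv₂) = 2 * Real.pi * t := by
  simp only [inner_add_right, inner_smul_right, inner_KK₂_vv₁, inner_KK₂_vv₂]
  ring

lemma coordLM_injective : Function.Injective e.coordLM := by
  intro y z h
  have h1 := congrArg (fun x => (inner ℝ e.KK₁ x : ℝ)) h
  have h2 := congrArg (fun x => (inner ℝ e.KK₂ x : ℝ)) h
  change (inner ℝ e.KK₁ (y.1 • e.vv₁ + y.2 • e.vv₂) : ℝ) =
    inner ℝ e.KK₁ (z.1 • e.vv₁ + z.2 • e.vv₂) at h1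
  change (inner ℝ e.KK₂ (y.1 • e.vv₁ + y.2 • e.vv₂) : ℝ) =
    inner ℝ e.KK₂ (z.1 • e.vv₁ + z.2 • e.vv₂) at h2
  rw [inner_KK₁_coord, inner_KK₁_coord] at h1
  rw [inner_KK₂_coord, inner_KK₂_coord] at h2
  have hp : (2 * Real.pi) ≠ 0 := by positivity
  exact Prod.ext (mul_left_cancel₀ hp h1) (mul_left_cancel₀ hp h2)

/-- Lattice coordinates `(s, t) ↦ s 𝔳₁ + t 𝔳₂` on the plane. -/
def coord : (ℝ × ℝ) ≃L[ℝ] Plane :=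
  (LinearMap.linearEquivOfInjective e.coordLM e.coordLM_injective (by simp)).toContinuousLinearEquiv

lemma coord_apply (y : ℝ × ℝ) : e.coord y = y.1 • e.vv₁ + y.2 • e.vv₂ := rfl

lemma inner_KK₁ (x : Plane) : inner ℝ e.KK₁ x = 2 * Real.pi * (e.coord.symm x).1 := by
  rw [← inner_KK₁_coord e _ (e.coord.symm x).2, ← coord_apply, e.coord.apply_symm_apply]

lemma inner_KK₂ (x : Plane) : inner ℝ e.KK₂ x = 2 * Real.pi * (e.coord.symm x).2 := by
  rw [← inner_KK₂_coord e (e.coord.symm x).1, ← coord_apply, e.coord.apply_symm_apply]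

lemma coord_symm_smul_add (s t : ℝ) : e.coord.symm (s • e.vv₁ + t • e.vv₂) = (s, t) :=
  e.coord.symm_apply_apply (s, t)

lemma exists_coord_iff (P : ℝ → ℝ → Prop) (x : Plane) :
    (∃ s t, P s t ∧ x = s • e.vv₁ + t • e.vv₂) ↔ P (e.coord.symm x).1 (e.coord.symm x).2 := by
  constructor
  · rintro ⟨s, t, h, rfl⟩
    rwa [coord_symm_smul_add]
  · intro h
    exact ⟨_, _, h, by rw [← coord_apply, e.coord.apply_symm_apply]⟩

lemma mem_cell {x : Plane} :
    x ∈ e.cell ↔ e.coord.symm x ∈ Set.Icc (0 : ℝ) 1 ×ˢ Set.Icc (0 : ℝ) 1 := by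
  have := e.exists_coord_iff (fun s t => 0 ≤ s ∧ s ≤ 1 ∧ 0 ≤ t ∧ t ≤ 1) x
  simp only [and_assoc] at this
  simp only [Set.mem_prod, Set.mem_Icc, and_assoc]
  exact this

lemma mem_strip {x : Plane} : x ∈ e.strip ↔ (e.coord.symm x).1 ∈ Set.Icc (0 : ℝ) 1 := by
  have := e.exists_coord_iff (fun s _ => 0 ≤ s ∧ s ≤ 1) x
  simp only [and_assoc] at this
  exact this

lemma mem_stripUpTo {x : Plane} {R : ℝ} : x ∈ e.stripUpTo R ↔
    (e.coord.symm x).1 ∈ Set.Icc (0 : ℝ) 1 ∧ |(e.coord.symm x).2| ≤ R := by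
  have := e.exists_coord_iff (fun s t => 0 ≤ s ∧ s ≤ 1 ∧ |t| ≤ R) x
  simp only [and_assoc] at this
  simp only [Set.mem_Icc, and_assoc]
  exact this

lemma cell_eq_preimage : e.cell = e.coord.symm ⁻¹' (Set.Icc (0 : ℝ) 1 ×ˢ Set.Icc (0 : ℝ) 1) :=
  Set.ext fun _ => e.mem_cell

lemma preimage_cell : e.coord ⁻¹' e.cell = Set.Icc (0 : ℝ) 1 ×ˢ Set.Icc (0 : ℝ) 1 := by
  ext y
  rw [Set.mem_preimage, mem_cell, e.coord.symm_apply_apply]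

lemma isCompact_cell : IsCompact e.cell := by
  rw [cell_eq_preimage, ← e.coord.image_eq_preimage_symm]
  exact (isCompact_Icc.prod isCompact_Icc).image e.coord.continuous

lemma measurableSet_cell : MeasurableSet e.cell := e.isCompact_cell.isClosed.measurableSet

lemma measurableSet_strip : MeasurableSet e.strip := by
  have : e.strip = (fun x => (e.coord.symm x).1) ⁻¹' Set.Icc (0 : ℝ) 1 :=
    Set.ext fun _ => e.mem_strip
  rw [this]
  exact (isClosed_Icc.preimage (by fun_prop)).measurableSet

lemma measurableSet_stripUpTo (R : ℝ) : MeasurableSet (e.stripUpTo R) := by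
  have : e.stripUpTo R = (fun x => (e.coord.symm x).1) ⁻¹' Set.Icc (0 : ℝ) 1 ∩
      {x | |(e.coord.symm x).2| ≤ R} := Set.ext fun _ => e.mem_stripUpTo
  rw [this]
  exact ((isClosed_Icc.preimage (by fun_prop)).inter
    (isClosed_le (by fun_prop) continuous_const)).measurableSet

lemma stripUpTo_subset_strip (R : ℝ) : e.stripUpTo R ⊆ e.strip := fun _ hx =>
  e.mem_strip.2 (e.mem_stripUpTo.1 hx).1

/-- Lebesgue measure on the period cell. -/
abbrev cellMeasure : Measure Plane := volume.restrict e.cell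

instance : IsFiniteMeasure e.cellMeasure :=
  ⟨by rw [Measure.restrict_apply_univ]; exact e.isCompact_cell.measure_lt_top⟩

/-- Uniqueness of Haar measure up to a constant replaces a Jacobian computation; the constant is
then read off from the period cell. -/
lemma volume_eq_smul_map_coord :
    ∃ c : NNReal, (volume : Measure Plane) = (c : ℝ≥0∞) • Measure.map e.coord volume := by
  have : (Measure.map e.coord (volume : Measure (ℝ × ℝ))).IsAddHaarMeasure :=
    e.coord.isAddHaarMeasure_map volume
  exact ⟨_, Measure.isAddLeftInvariant_eq_smul _ _⟩

lemma volume_eq : (volume : Measure Plane) =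
    ENNReal.ofReal e.area • Measure.map e.coord volume := by
  obtain ⟨c, hc⟩ := e.volume_eq_smul_map_coord
  have h : volume e.cell = c := by
    rw [hc, Measure.smul_apply, Measure.map_apply e.coord.continuous.measurable
      e.measurableSet_cell, preimage_cell, Measure.volume_eq_prod, Measure.prod_prod]
    simp
  have h2 : ENNReal.ofReal e.area = c := by
    rw [area, Measure.real, h, ENNReal.coe_toReal, ENNReal.ofReal_coe_nnreal]
  rw [h2]
  exact hc

lemma area_pos : 0 < e.area := by
  by_contra h
  have h1 := e.volume_eq
  rw [ENNReal.ofReal_of_nonpos (not_lt.1 h), zero_smul] at h1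
  have h2 : (volume : Measure Plane) Set.univ ≠ 0 :=
    (isOpen_univ.measure_pos volume Set.univ_nonempty).ne'
  rw [h1] at h2
  exact h2 rfl

lemma cellMeasure_eq : e.cellMeasure = ENNReal.ofReal e.area • Measure.map e.coord
    ((volume.restrict (Set.Icc (0 : ℝ) 1)).prod (volume.restrict (Set.Icc (0 : ℝ) 1))) := by
  rw [cellMeasure, e.volume_eq, Measure.restrict_smul, Measure.prod_restrict, ← e.preimage_cell,
    Measure.restrict_map e.coord.continuous.measurable e.measurableSet_cell]
  rfl

lemma measurableEmbedding_coord : MeasurableEmbedding e.coord :=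
  e.coord.toHomeomorph.measurableEmbedding

lemma integral_cell (g : Plane → ℂ) : ∫ x in e.cell, g x = e.area * ∫ y, g (e.coord y)
    ∂((volume.restrict (Set.Icc (0 : ℝ) 1)).prod (volume.restrict (Set.Icc (0 : ℝ) 1))) := by
  rw [← cellMeasure, cellMeasure_eq, integral_smul_measure,
    e.measurableEmbedding_coord.integral_map, ENNReal.toReal_ofReal e.area_pos.le]
  simp

lemma lintegral_cell (g : Plane → ℝ≥0∞) : ∫⁻ x in e.cell, g x = ENNReal.ofReal e.area *
    ∫⁻ y, g (e.coord y)
      ∂((volume.restrict (Set.Icc (0 : ℝ) 1)).prod (volume.restrict (Set.Icc (0 : ℝ) 1))) := by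
  rw [← cellMeasure, cellMeasure_eq, lintegral_smul_measure,
    e.measurableEmbedding_coord.lintegral_map]
  rfl

lemma volume_transverse_eq (c : ℝ) : volume {x : Plane | (e.coord.symm x).2 = c} = 0 := by
  rw [e.volume_eq, Measure.smul_apply, Measure.map_apply e.coord.continuous.measurable
    (isClosed_eq (by fun_prop) continuous_const).measurableSet]
  have : e.coord ⁻¹' {x : Plane | (e.coord.symm x).2 = c} = Set.univ ×ˢ {c} := by
    ext y; simp
  rw [this, Measure.volume_eq_prod, Measure.prod_prod]
  simp

lemma coord_symm_add_smul_vv₂ (x : Plane) (n : ℝ) :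
    e.coord.symm (x + n • e.vv₂) = ((e.coord.symm x).1, (e.coord.symm x).2 + n) := by
  have := e.coord_symm_smul_add 0 n
  rw [zero_smul, zero_add] at this
  rw [map_add, this]
  ext <;> simp

/-- The cylinder is tiled by translates of the period cell. -/
lemma restrict_strip_eq_sum : volume.restrict e.strip =
    Measure.sum fun n : ℤ => Measure.map (fun x => x + (n : ℝ) • e.vv₂) e.cellMeasure := by
  -- Half-open slabs give an exact disjoint decomposition; the slab for `n = 0` differs from the
  -- closed cell only by a null segment.
  let S : ℤ → Set Plane := fun n => e.strip ∩ {x | (e.coord.symm x).2 ∈ Set.Ico (n : ℝ) (n + 1)}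
  have hSm : ∀ n, MeasurableSet (S n) := fun n => e.measurableSet_strip.inter
    ((measurable_snd.comp e.coord.symm.continuous.measurable) measurableSet_Ico)
  have hU : e.strip = ⋃ n, S n := by
    ext x
    simp only [S, Set.mem_iUnion, Set.mem_inter_iff, Set.mem_ofPred_eq]
    exact ⟨fun h => ⟨⌊(e.coord.symm x).2⌋, h, Int.floor_le _, Int.lt_floor_add_one _⟩,
      fun ⟨_, h, _⟩ => h⟩
  have hd : Pairwise (Function.onFun Disjoint S) := by
    intro m n hmn
    refine Set.disjoint_left.2 fun x hx hx' => hmn ?_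
    have h1 := Int.floor_eq_iff.2 hx.2
    have h2 := Int.floor_eq_iff.2 hx'.2
    rw [← h1, ← h2]
  rw [hU, Measure.restrict_iUnion hd hSm]
  congr 1
  funext n
  have hmp : MeasurePreserving (fun x : Plane => x + (n : ℝ) • e.vv₂) volume volume :=
    measurePreserving_add_right volume _
  have hpre : (fun x : Plane => x + (n : ℝ) • e.vv₂) ⁻¹' S n = S 0 := by
    ext x
    simp only [S, Set.mem_preimage, Set.mem_inter_iff, mem_strip, coord_symm_add_smul_vv₂,
      Set.mem_ofPred_eq, Set.mem_Ico, Int.cast_zero, zero_add]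
    constructor <;> rintro ⟨h1, h2, h3⟩ <;> exact ⟨h1, by linarith, by linarith⟩
  have hae : S 0 =ᵐ[volume] e.cell := by
    have h1 : ∀ᵐ x : Plane, (e.coord.symm x).2 ≠ 1 := by
      rw [ae_iff]
      simpa using e.volume_transverse_eq 1
    filter_upwards [h1] with x hx
    refine propext ?_
    change x ∈ S 0 ↔ x ∈ e.cell
    simp only [S, Set.mem_inter_iff, mem_strip, mem_cell, Set.mem_prod, Set.mem_ofPred_eq,
      Set.mem_Ico, Int.cast_zero, zero_add]
    refine and_congr_right fun _ => ?_
    rw [Set.mem_Icc]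
    exact and_congr_right fun _ => ⟨le_of_lt, fun h => lt_of_le_of_ne h hx⟩
  rw [cellMeasure, ← Measure.restrict_congr_set hae, ← hpre]
  exact (hmp.restrict_preimage (hSm n)).map_eq.symm

lemma lintegral_strip (g : Plane → ℝ≥0∞) :
    ∫⁻ x in e.strip, g x = ∑' n : ℤ, ∫⁻ x in e.cell, g (x + (n : ℝ) • e.vv₂) := by
  rw [restrict_strip_eq_sum, lintegral_sum_measure]
  congr 1
  funext n
  exact (MeasurableEquiv.addRight ((n : ℝ) • e.vv₂)).measurableEmbedding.lintegral_map g

lemma ae_of_ae_cell {P : Plane → Prop}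
    (h : ∀ m n : ℤ, ∀ᵐ x ∂e.cellMeasure, P (x + latticeVec m n)) : ∀ᵐ x : Plane, P x := by
  have h1 : ∀ q : ℤ × ℤ, ∀ᵐ x : Plane,
      x - latticeVec q.1 q.2 ∈ e.cell → P x := by
    intro q
    have h2 := (ae_restrict_iff' e.measurableSet_cell).1 (h q.1 q.2)
    have h3 := (measurePreserving_sub_right (volume : Measure Plane)
      (latticeVec q.1 q.2)).quasiMeasurePreserving.ae h2
    filter_upwards [h3] with x hx hmem
    simpa using hx hmem
  filter_upwards [ae_all_iff.2 h1] with x hx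
  set s := (e.coord.symm x).1
  set t := (e.coord.symm x).2
  -- Integer parts of the coordinates in the basis `𝔳₁, 𝔳₂`, rewritten in the basis `v₁, v₂`.
  refine hx (⌊s⌋ * e.a₁ + ⌊t⌋ * e.a₂, ⌊s⌋ * e.b₁ + ⌊t⌋ * e.b₂) ?_
  rw [← smul_add_smul_eq, mem_cell, map_sub, coord_symm_smul_add]
  refine ⟨⟨?_, ?_⟩, ⟨?_, ?_⟩⟩
  · exact sub_nonneg.2 (Int.floor_le s)
  · exact (sub_lt_iff_lt_add'.2 (Int.lt_floor_add_one s)).le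
  · exact sub_nonneg.2 (Int.floor_le t)
  · exact (sub_lt_iff_lt_add'.2 (Int.lt_floor_add_one t)).le

end Edge

end FloquetBloch

namespace FloquetBloch

/-! ### Parseval's identity on unit intervals -/

lemma lintegral_enorm_sq_lt_top {X : Type*} [MeasurableSpace X] {μ : Measure X} {g : X → ℂ}
    (hg : MemLp g 2 μ) : ∫⁻ x, ‖g x‖ₑ ^ 2 ∂μ < ⊤ := by
  have := hg.2
  rw [eLpNorm_lt_top_iff_lintegral_rpow_enorm_lt_top (by norm_num) (by norm_num)] at this
  simpa using this

lemma memLp_two_of_lintegral_lt_top {X : Type*} [MeasurableSpace X] {μ : Measure X} {g : X → ℂ}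
    (hg : AEStronglyMeasurable g μ) (h : ∫⁻ x, ‖g x‖ₑ ^ 2 ∂μ < ⊤) : MemLp g 2 μ := by
  refine ⟨hg, ?_⟩
  rw [eLpNorm_lt_top_iff_lintegral_rpow_enorm_lt_top (by norm_num) (by norm_num)]
  simpa using h

lemma eLpNorm_two_eq {X : Type*} [MeasurableSpace X] (μ : Measure X) (g : X → ℂ) :
    eLpNorm g 2 μ = (∫⁻ x, ‖g x‖ₑ ^ 2 ∂μ) ^ (1 / 2 : ℝ) := by
  rw [eLpNorm_eq_lintegral_rpow_enorm_toReal (by norm_num) (by norm_num)]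
  simp

lemma parseval_interval {a b : ℝ} (hab : b = a + 1) {g : ℝ → ℂ}
    (hg : MemLp g 2 (volume.restrict (Set.Icc a b))) :
    ∑' n : ℤ, ‖∫ t in Set.Icc a b, Complex.exp (2 * Real.pi * Complex.I * n * t) * g t‖ₑ ^ 2 =
      ∫⁻ t in Set.Icc a b, ‖g t‖ₑ ^ 2 := by
  subst hab
  have hlt : a < a + 1 := by linarith
  have hg' : MemLp g 2 (volume.restrict (Set.Ioc a (a + 1))) :=
    hg.mono_measure (Measure.restrict_mono Set.Ioc_subset_Icc_self le_rfl)
  have h1 := hasSum_sq_fourierCoeffOn hlt hg'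
  -- Fourier coefficients carry the opposite sign in the exponent, hence the reflection of the index
  -- when the two sums are compared.
  have hc : ∀ n : ℤ, fourierCoeffOn hlt g n =
      ∫ t in Set.Icc a (a + 1),
        Complex.exp (2 * Real.pi * Complex.I * ((-n : ℤ) : ℂ) * t) * g t := by
    intro n
    rw [fourierCoeffOn_eq_integral, intervalIntegral.integral_of_le hlt.le,
      integral_Icc_eq_integral_Ioc]
    simp only [fourier_coe_apply, add_sub_cancel_left, smul_eq_mul, Complex.ofReal_one, div_one,
      one_smul]
  have hint : Integrable (fun t => ‖g t‖ ^ 2) (volume.restrict (Set.Icc a (a + 1))) :=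
    (memLp_two_iff_integrable_sq_norm hg.1).1 hg
  have h2 : ∫⁻ t in Set.Icc a (a + 1), ‖g t‖ₑ ^ 2 =
      ENNReal.ofReal (∫ t in Set.Icc a (a + 1), ‖g t‖ ^ 2) := by
    rw [ofReal_integral_eq_lintegral_ofReal hint (Eventually.of_forall fun t => by positivity)]
    refine lintegral_congr fun t => ?_
    rw [← ofReal_norm, ENNReal.ofReal_pow (norm_nonneg _)]
  rw [add_sub_cancel_left, inv_one, one_smul, intervalIntegral.integral_of_le hlt.le,
    ← integral_Icc_eq_integral_Ioc] at h1
  rw [h2, ← h1.tsum_eq, ENNReal.ofReal_tsum_of_nonneg (fun n => by positivity) h1.summable,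
    ← (Equiv.neg ℤ).tsum_eq]
  refine tsum_congr fun n => ?_
  rw [hc, ENNReal.ofReal_pow (norm_nonneg _), ofReal_norm]
  rfl

lemma MemLp.ae_memLp_left {X Y : Type*} [MeasurableSpace X] [MeasurableSpace Y] {μ : Measure X}
    {ν : Measure Y} [SFinite μ] [SFinite ν] {g : Y → X → ℂ}
    (hg : MemLp (fun q : Y × X => g q.1 q.2) 2 (ν.prod μ)) :
    ∀ᵐ x ∂μ, MemLp (fun t => g t x) 2 ν := by
  have hsw := hg.1.prod_swap
  have h1 := hsw.prodMk_left
  have h2 := lintegral_enorm_sq_lt_top hg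
  rw [lintegral_prod_symm _ (by exact hg.1.enorm.pow_const 2)] at h2
  have h3 := ae_lt_top' (hg.1.enorm.pow_const 2).prod_swap.lintegral_prod_right' h2.ne
  filter_upwards [h1, h3] with x hx hx'
  exact memLp_two_of_lintegral_lt_top hx hx'

lemma MemLp.ae_memLp_right {X Y : Type*} [MeasurableSpace X] [MeasurableSpace Y] {μ : Measure X}
    {ν : Measure Y} [SFinite μ] [SFinite ν] {g : Y → X → ℂ}
    (hg : MemLp (fun q : Y × X => g q.1 q.2) 2 (ν.prod μ)) :
    ∀ᵐ t ∂ν, MemLp (g t) 2 μ := by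
  have h1 := hg.1.prodMk_left
  have h2 := lintegral_enorm_sq_lt_top hg
  rw [lintegral_prod _ (hg.1.enorm.pow_const 2)] at h2
  have h3 := ae_lt_top' (hg.1.enorm.pow_const 2).lintegral_prod_right' h2.ne
  filter_upwards [h1, h3] with x hx hx'
  exact memLp_two_of_lintegral_lt_top hx hx'

lemma aestronglyMeasurable_fourier_integral {X : Type*} [MeasurableSpace X] {μ : Measure X}
    [SFinite μ] {ν : Measure ℝ} [SFinite ν] {g : ℝ → X → ℂ}
    (hg : AEStronglyMeasurable (fun q : ℝ × X => g q.1 q.2) (ν.prod μ)) (n : ℤ) :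
    AEStronglyMeasurable
      (fun x => ∫ t, Complex.exp (2 * Real.pi * Complex.I * n * t) * g t x ∂ν) μ := by
  have h1 : AEStronglyMeasurable
      (fun q : ℝ × X => Complex.exp (2 * Real.pi * Complex.I * n * q.1) * g q.1 q.2)
      (ν.prod μ) := by
    refine AEStronglyMeasurable.mul (Measurable.aestronglyMeasurable ?_) hg
    fun_prop
  exact h1.prod_swap.integral_prod_right'

/-- Parseval's identity in the first of two variables. -/
lemma parseval_prod {X : Type*} [MeasurableSpace X] {μ : Measure X} [SFinite μ] {a b : ℝ}
    (hab : b = a + 1) {g : ℝ → X → ℂ}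
    (hg : MemLp (fun q : ℝ × X => g q.1 q.2) 2 ((volume.restrict (Set.Icc a b)).prod μ)) :
    ∑' n : ℤ, ∫⁻ x, ‖∫ t in Set.Icc a b,
        Complex.exp (2 * Real.pi * Complex.I * n * t) * g t x‖ₑ ^ 2 ∂μ =
      ∫⁻ q, ‖g q.1 q.2‖ₑ ^ 2 ∂((volume.restrict (Set.Icc a b)).prod μ) := by
  rw [lintegral_prod_symm _ (hg.1.enorm.pow_const 2), ← lintegral_tsum fun n =>
    (aestronglyMeasurable_fourier_integral hg.1 n).enorm.pow_const 2]
  refine lintegral_congr_ae ?_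
  filter_upwards [MemLp.ae_memLp_left hg] with x hx
  exact parseval_interval hab hx

lemma integral_exp_unit (k : ℤ) : ∫ t in Set.Icc (0 : ℝ) 1,
    Complex.exp (2 * Real.pi * Complex.I * k * t) = if k = 0 then 1 else 0 := by
  rw [integral_Icc_eq_integral_Ioc, ← intervalIntegral.integral_of_le zero_le_one]
  split_ifs with h
  · simp [h]
  · have hne : (2 * Real.pi * Complex.I * k : ℂ) ≠ 0 := by
      have := Complex.two_pi_I_ne_zero
      exact mul_ne_zero this (by exact_mod_cast h)
    rw [integral_exp_mul_complex hne]
    have : Complex.exp (2 * Real.pi * Complex.I * k * (1 : ℝ)) = 1 := by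
      rw [Complex.exp_eq_one_iff]
      exact ⟨k, by push_cast; ring⟩
    rw [this]
    simp

namespace Edge

variable (e : Edge)

/-! ### The Fourier basis on the period cell -/

lemma phase_dualVec_coord (m : ℤ × ℤ) (y : ℝ × ℝ) : phase (e.dualVec m) (e.coord y) =
    Complex.exp (2 * Real.pi * Complex.I * m.1 * y.1) *
      Complex.exp (2 * Real.pi * Complex.I * m.2 * y.2) := by
  rw [phase, dualVec, inner_add_left, inner_smul_left, inner_smul_left, inner_KK₁, inner_KK₂,
    e.coord.symm_apply_apply, ← Complex.exp_add]
  congr 1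
  simp only [conj_trivial]
  push_cast
  ring

lemma integral_phase_dualVec (m : ℤ × ℤ) :
    ∫ x in e.cell, phase (e.dualVec m) x = if m = 0 then (e.area : ℂ) else 0 := by
  rw [integral_cell]
  simp only [phase_dualVec_coord]
  rw [integral_prod_mul (fun s : ℝ => Complex.exp (2 * Real.pi * Complex.I * m.1 * s))
    (fun t : ℝ => Complex.exp (2 * Real.pi * Complex.I * m.2 * t)), integral_exp_unit,
    integral_exp_unit]
  by_cases h1 : m.1 = 0 <;> by_cases h2 : m.2 = 0 <;> simp [h1, h2, Prod.ext_iff]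

/-- The normalized periodic plane wave with frequency `m₁ 𝔎₁ + m₂ 𝔎₂`. -/
def mode (m : ℤ × ℤ) (x : Plane) : ℂ := ((Real.sqrt e.area)⁻¹ : ℂ) * phase (e.dualVec m) x

lemma continuous_mode (m : ℤ × ℤ) : Continuous (e.mode m) :=
  continuous_const.mul (continuous_phase _)

lemma norm_mode (m : ℤ × ℤ) (x : Plane) : ‖e.mode m x‖ = (Real.sqrt e.area)⁻¹ := by
  rw [mode, norm_mul, norm_phase, mul_one, norm_inv, Complex.norm_real,
    Real.norm_of_nonneg (Real.sqrt_nonneg _)]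

lemma memLp_of_continuous {g : Plane → ℂ} (hg : Continuous g) {p : ℝ≥0∞} :
    MemLp g p e.cellMeasure := by
  obtain ⟨C, hC⟩ := e.isCompact_cell.exists_bound_of_continuousOn hg.continuousOn
  exact MemLp.of_bound hg.aestronglyMeasurable C
    ((ae_restrict_iff' e.measurableSet_cell).2 (Eventually.of_forall hC))

lemma memLp_mode (m : ℤ × ℤ) : MemLp (e.mode m) 2 e.cellMeasure :=
  e.memLp_of_continuous (e.continuous_mode m)

lemma dualVec_sub (m n : ℤ × ℤ) : e.dualVec (m - n) = e.dualVec m - e.dualVec n := by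
  simp only [dualVec, Prod.fst_sub, Prod.snd_sub]
  push_cast
  module

lemma dualVec_neg (m : ℤ × ℤ) : e.dualVec (-m) = -e.dualVec m := by
  simp only [dualVec, Prod.fst_neg, Prod.snd_neg]
  push_cast
  module

lemma integral_conj_mode_mul_mode (m n : ℤ × ℤ) :
    ∫ x in e.cell, starRingEnd ℂ (e.mode m x) * e.mode n x = if m = n then 1 else 0 := by
  have h : ∀ x, starRingEnd ℂ (e.mode m x) * e.mode n x =
      (e.area : ℂ)⁻¹ * phase (e.dualVec (n - m)) x := by
    intro x
    have hs : ((Real.sqrt e.area : ℂ)) * (Real.sqrt e.area : ℂ) = e.area := by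
      exact_mod_cast Real.mul_self_sqrt e.area_pos.le
    simp only [mode, map_mul, conj_phase, dualVec_sub, map_inv₀, Complex.conj_ofReal]
    rw [sub_eq_add_neg, phase_add_left, ← hs, mul_inv]
    ring
  simp only [h]
  rw [integral_const_mul, integral_phase_dualVec]
  have ha : (e.area : ℂ) ≠ 0 := by exact_mod_cast e.area_pos.ne'
  by_cases hmn : m = n
  · simp [hmn, ha]
  · have : n - m ≠ 0 := fun h0 => hmn (sub_eq_zero.1 h0).symm
    simp [hmn, this]

lemma memLp_comp_coord {h : Plane → ℂ} (hh : MemLp h 2 e.cellMeasure) :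
    MemLp (fun y => h (e.coord y)) 2
      ((volume.restrict (Set.Icc (0 : ℝ) 1)).prod (volume.restrict (Set.Icc (0 : ℝ) 1))) := by
  have h0 : ENNReal.ofReal e.area ≠ 0 := by simpa using e.area_pos
  have h1 := hh.smul_measure (c := (ENNReal.ofReal e.area)⁻¹) (ENNReal.inv_ne_top.2 h0)
  rw [cellMeasure_eq, smul_smul, ENNReal.inv_mul_cancel h0 ENNReal.ofReal_ne_top, one_smul] at h1
  exact (e.measurableEmbedding_coord.memLp_map_measure_iff).1 h1

/-- Totality of the double Fourier system comes from applying one-dimensional Parseval in each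
lattice coordinate in turn. -/
lemma ae_eq_zero_of_integral_mode {h : Plane → ℂ} (hh : MemLp h 2 e.cellMeasure)
    (h0 : ∀ m, ∫ x in e.cell, starRingEnd ℂ (e.mode m x) * h x = 0) : h =ᵐ[e.cellMeasure] 0 := by
  set I := (volume : Measure ℝ).restrict (Set.Icc (0 : ℝ) 1) with hI
  have hG : MemLp (fun q : ℝ × ℝ => h (e.coord (q.1, q.2))) 2 (I.prod I) := e.memLp_comp_coord hh
  have hpar := parseval_prod (a := 0) (b := 1) (by norm_num) (g := fun s t => h (e.coord (s, t))) hG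
  have hGint : ∀ m : ℤ × ℤ, Integrable (fun q : ℝ × ℝ => phase (e.dualVec m) (e.coord q) *
      h (e.coord q)) (I.prod I) := by
    intro m
    refine (hG.integrable (by norm_num)).bdd_mul (c := 1)
      ((continuous_phase _).comp e.coord.continuous).aestronglyMeasurable
      (Eventually.of_forall fun q => ?_)
    simp
  have hcoef : ∀ m : ℤ × ℤ,
      ∫ q, phase (e.dualVec m) (e.coord q) * h (e.coord q) ∂(I.prod I) = 0 := by
    intro m
    have h1 := h0 (-m)
    rw [integral_cell] at h1
    have h2 : ∀ x, starRingEnd ℂ (e.mode (-m) x) =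
        ((Real.sqrt e.area)⁻¹ : ℂ) * phase (e.dualVec m) x := by
      intro x
      rw [mode, map_mul, conj_phase, dualVec_neg, neg_neg, map_inv₀, Complex.conj_ofReal]
    simp only [h2, mul_assoc] at h1
    rw [integral_const_mul] at h1
    have ha : (e.area : ℂ) ≠ 0 := by exact_mod_cast e.area_pos.ne'
    have hs : ((Real.sqrt e.area)⁻¹ : ℂ) ≠ 0 := by
      exact_mod_cast inv_ne_zero (Real.sqrt_pos.2 e.area_pos).ne'
    exact ((mul_eq_zero.1 ((mul_eq_zero.1 h1).resolve_left ha)).resolve_left hs)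
  -- For fixed `n`, the partial Fourier coefficient in `s` is a function of `t` all of whose own
  -- Fourier coefficients vanish.
  have hzero : ∀ n : ℤ, ∫⁻ t, ‖∫ s, Complex.exp (2 * Real.pi * Complex.I * n * s) *
      h (e.coord (s, t)) ∂I‖ₑ ^ 2 ∂I = 0 := by
    intro n
    have hmem : MemLp (fun t => ∫ s, Complex.exp (2 * Real.pi * Complex.I * n * s) *
        h (e.coord (s, t)) ∂I) 2 I := by
      refine memLp_two_of_lintegral_lt_top (aestronglyMeasurable_fourier_integral hG.1 n) ?_
      refine lt_of_le_of_lt ?_ (lintegral_enorm_sq_lt_top hG)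
      rw [← hpar]
      exact ENNReal.le_tsum n
    rw [hI, ← parseval_interval (a := 0) (b := 1) (by norm_num) hmem]
    refine ENNReal.tsum_eq_zero.2 fun k => ?_
    have h1 := hcoef (n, k)
    rw [integral_prod_symm _ (hGint (n, k))] at h1
    have h2 : ∀ t : ℝ, ∫ s, phase (e.dualVec (n, k)) (e.coord (s, t)) * h (e.coord (s, t)) ∂I =
        Complex.exp (2 * Real.pi * Complex.I * k * t) *
          ∫ s, Complex.exp (2 * Real.pi * Complex.I * n * s) * h (e.coord (s, t)) ∂I := by
      intro t
      rw [← integral_const_mul]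
      congr 1
      funext s
      rw [phase_dualVec_coord]
      ring
    simp only [h2] at h1
    rw [← hI, h1]
    simp
  have hfin : ∫⁻ x in e.cell, ‖h x‖ₑ ^ 2 = 0 := by
    rw [lintegral_cell, ← hI]
    simp only [Prod.mk.eta] at hpar
    rw [← hpar, ENNReal.tsum_eq_zero.2 hzero, mul_zero]
  rw [lintegral_eq_zero_iff' (hh.1.enorm.pow_const 2)] at hfin
  filter_upwards [hfin] with x hx
  simpa using hx

/-- Square integrable functions on the period cell. -/
abbrev CellL2 : Type := Lp ℂ 2 e.cellMeasure

lemma inner_toLp {f g : Plane → ℂ} (hf : MemLp f 2 e.cellMeasure) (hg : MemLp g 2 e.cellMeasure) :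
    inner ℂ hf.toLp hg.toLp = ∫ x in e.cell, starRingEnd ℂ (f x) * g x := by
  rw [L2.inner_def]
  refine integral_congr_ae ?_
  filter_upwards [hf.coeFn_toLp, hg.coeFn_toLp] with x hx hx'
  rw [hx, hx', RCLike.inner_apply, mul_comm]

lemma inner_toLp_left {f : Plane → ℂ} (hf : MemLp f 2 e.cellMeasure) (g : e.CellL2) :
    inner ℂ hf.toLp g = ∫ x in e.cell, starRingEnd ℂ (f x) * g x := by
  conv_lhs => rw [← Lp.toLp_coeFn g (Lp.memLp g)]
  exact e.inner_toLp hf (Lp.memLp g)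

lemma orthonormal_mode : Orthonormal ℂ fun m => (e.memLp_mode m).toLp := by
  classical
  rw [orthonormal_iff_ite]
  intro m n
  rw [inner_toLp, integral_conj_mode_mul_mode]

/-- The Fourier basis of `L²` of the period cell. -/
def fourierBasis : HilbertBasis (ℤ × ℤ) ℂ e.CellL2 :=
  HilbertBasis.mkOfOrthogonalEqBot e.orthonormal_mode <| by
    rw [Submodule.eq_bot_iff]
    intro g hg
    rw [Lp.eq_zero_iff_ae_eq_zero]
    refine e.ae_eq_zero_of_integral_mode (Lp.memLp g) fun m => ?_
    rw [← inner_toLp_left e (e.memLp_mode m)]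
    exact (Submodule.mem_orthogonal _ g).1 hg _ (Submodule.subset_span ⟨m, rfl⟩)

lemma fourierBasis_apply (m : ℤ × ℤ) : e.fourierBasis m = (e.memLp_mode m).toLp := by
  rw [fourierBasis, HilbertBasis.coe_mkOfOrthogonalEqBot]

lemma inner_fourierBasis_toLp (m : ℤ × ℤ) {g : Plane → ℂ} (hg : MemLp g 2 e.cellMeasure) :
    inner ℂ (e.fourierBasis m) hg.toLp = ∫ x in e.cell, starRingEnd ℂ (e.mode m x) * g x := by
  rw [fourierBasis_apply, inner_toLp]

end Edge

end FloquetBloch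

namespace FloquetBloch

/-! ### Directional derivatives and integration by parts -/

lemma contDiff_fderiv_apply {ψ : Plane → ℂ} (hψ : ContDiff ℝ ∞ ψ) (w : Plane) :
    ContDiff ℝ ∞ fun x => fderiv ℝ ψ x w :=
  (hψ.fderiv_right (m := ∞) (by norm_cast)).clm_apply contDiff_const

lemma laplacian_eq_sum {ψ : Plane → ℂ} (hψ : ContDiff ℝ ∞ ψ) (x : Plane) :
    Laplacian.laplacian ψ x = ∑ i : Fin 2, fderiv ℝ (fun y => fderiv ℝ ψ y
      (EuclideanSpace.basisFun (Fin 2) ℝ i)) x (EuclideanSpace.basisFun (Fin 2) ℝ i) := by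
  rw [InnerProductSpace.laplacian_eq_iteratedFDeriv_orthonormalBasis ψ
    (EuclideanSpace.basisFun (Fin 2) ℝ)]
  refine Finset.sum_congr rfl fun i _ => ?_
  rw [iteratedFDeriv_two_apply]
  have hd : DifferentiableAt ℝ (fderiv ℝ ψ) x :=
    (hψ.fderiv_right (m := ∞) (by norm_cast)).differentiable (by simp) x
  rw [fderiv_clm_apply hd (differentiableAt_const _)]
  simp

lemma continuous_laplacian {ψ : Plane → ℂ} (hψ : ContDiff ℝ ∞ ψ) :
    Continuous (Laplacian.laplacian ψ) := by
  have : Laplacian.laplacian ψ = fun x => ∑ i : Fin 2, fderiv ℝ (fun y => fderiv ℝ ψ y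
      (EuclideanSpace.basisFun (Fin 2) ℝ i)) x (EuclideanSpace.basisFun (Fin 2) ℝ i) :=
    funext fun x => laplacian_eq_sum hψ x
  rw [this]
  exact continuous_finsetSum _ fun i _ =>
    (contDiff_fderiv_apply (contDiff_fderiv_apply hψ _) _).continuous

lemma hasFDerivAt_phase (k x : Plane) :
    HasFDerivAt (phase k) ((phase k x * Complex.I) • (Complex.ofRealCLM.comp (innerSL ℝ k))) x := by
  have h1 : HasFDerivAt (fun y : Plane => ((inner ℝ k y : ℝ) : ℂ))
      (Complex.ofRealCLM.comp (innerSL ℝ k)) x :=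
    (Complex.ofRealCLM.comp (innerSL ℝ k)).hasFDerivAt
  have h2 := (h1.const_mul Complex.I).cexp
  rw [smul_smul] at h2
  exact h2

lemma fderiv_phase_apply (k x w : Plane) :
    fderiv ℝ (phase k) x w = Complex.I * (inner ℝ k w : ℝ) * phase k x := by
  rw [(hasFDerivAt_phase k x).fderiv]
  simp only [smul_apply, ContinuousLinearMap.comp_apply, innerSL_apply_apply,
    Complex.ofRealCLM_apply, smul_eq_mul]
  ring

lemma sum_inner_basisFun_sq (k : Plane) :
    ∑ i : Fin 2, (inner ℝ k (EuclideanSpace.basisFun (Fin 2) ℝ i) : ℝ) ^ 2 = ‖k‖ ^ 2 := by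
  rw [Fin.sum_univ_two, EuclideanSpace.norm_sq_eq, Fin.sum_univ_two, inner_plane, inner_plane]
  simp

lemma laplacian_phase (k x : Plane) :
    Laplacian.laplacian (phase k) x = -((‖k‖ ^ 2 : ℝ) : ℂ) * phase k x := by
  rw [laplacian_eq_sum (contDiff_phase k), ← sum_inner_basisFun_sq, Complex.ofReal_sum,
    ← Finset.sum_neg_distrib, Finset.sum_mul]
  refine Finset.sum_congr rfl fun i _ => ?_
  simp only [fderiv_phase_apply]
  rw [fderiv_const_mul (hasFDerivAt_phase k x).differentiableAt, smul_apply, fderiv_phase_apply]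
  push_cast
  simp only [smul_eq_mul]
  linear_combination ((inner ℝ k (EuclideanSpace.basisFun (Fin 2) ℝ i) : ℝ) : ℂ) ^ 2 *
    phase k x * Complex.I_sq

namespace Edge

variable (e : Edge)

lemma integral_deriv_periodic {G G' : ℝ → ℂ} (hG : ∀ s, HasDerivAt G (G' s) s)
    (hG' : Continuous G') (hper : G 1 = G 0) : ∫ s in Set.Icc (0 : ℝ) 1, G' s = 0 := by
  rw [integral_Icc_eq_integral_Ioc, ← intervalIntegral.integral_of_le zero_le_one,
    intervalIntegral.integral_eq_sub_of_hasDerivAt (fun s _ => hG s)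
      (hG'.intervalIntegrable 0 1), hper, sub_self]

/-- Along either lattice direction the integral over a period vanishes by the fundamental theorem of
calculus; a general direction is a combination of these two. -/
lemma integral_fderiv_periodic {g : Plane → ℂ} (hg : ContDiff ℝ ∞ g)
    (hper : ∀ (m n : ℤ) (x : Plane), g (x + latticeVec m n) = g x) (w : Plane) :
    ∫ x in e.cell, fderiv ℝ g x w = 0 := by
  have hcont : ∀ w, Continuous fun x => fderiv ℝ g x w := fun w =>
    (contDiff_fderiv_apply hg w).continuous
  have hint : ∀ w, Integrable (fun y : ℝ × ℝ => fderiv ℝ g (e.coord y) w)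
      ((volume.restrict (Set.Icc (0 : ℝ) 1)).prod (volume.restrict (Set.Icc (0 : ℝ) 1))) := by
    intro w
    exact (e.memLp_comp_coord (e.memLp_of_continuous (hcont w))).integrable (by norm_num)
  have hder : ∀ x, HasFDerivAt g (fderiv ℝ g x) x := fun x =>
    (hg.differentiable (by simp) x).hasFDerivAt
  have hp1 : ∀ x, g (x + e.vv₁) = g x := fun x => hper _ _ x
  have hp2 : ∀ x, g (x + e.vv₂) = g x := fun x => hper _ _ x
  have h1 : ∫ x in e.cell, fderiv ℝ g x e.vv₁ = 0 := by
    rw [integral_cell, integral_prod_symm _ (hint _)]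
    have : ∀ t : ℝ, ∫ s in Set.Icc (0 : ℝ) 1, fderiv ℝ g (e.coord (s, t)) e.vv₁ = 0 := by
      intro t
      refine integral_deriv_periodic (G := fun s => g (e.coord (s, t))) (fun s => ?_) ?_ ?_
      · refine (hder _).comp_hasDerivAt s ?_
        simp only [coord_apply]
        simpa using ((hasDerivAt_id s).smul_const e.vv₁).add_const (t • e.vv₂)
      · exact (hcont _).comp (e.coord.continuous.comp (by fun_prop))
      · simp only [coord_apply]
        rw [one_smul, zero_smul, zero_add, add_comm, hp1]
    simp [this]
  have h2 : ∫ x in e.cell, fderiv ℝ g x e.vv₂ = 0 := by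
    rw [integral_cell, integral_prod _ (hint _)]
    have : ∀ s : ℝ, ∫ t in Set.Icc (0 : ℝ) 1, fderiv ℝ g (e.coord (s, t)) e.vv₂ = 0 := by
      intro s
      refine integral_deriv_periodic (G := fun t => g (e.coord (s, t))) (fun t => ?_) ?_ ?_
      · refine (hder _).comp_hasDerivAt t ?_
        simp only [coord_apply]
        simpa using ((hasDerivAt_id t).smul_const e.vv₂).const_add (s • e.vv₁)
      · exact (hcont _).comp (e.coord.continuous.comp (by fun_prop))
      · simp only [coord_apply]
        rw [one_smul, zero_smul, add_zero, hp2]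
    simp [this]
  have hw : w = (e.coord.symm w).1 • e.vv₁ + (e.coord.symm w).2 • e.vv₂ := by
    rw [← coord_apply, e.coord.apply_symm_apply]
  have hI : ∀ w, Integrable (fun x => fderiv ℝ g x w) e.cellMeasure := fun w =>
    (e.memLp_of_continuous (p := 1) (hcont w)).integrable le_rfl
  rw [hw]
  simp only [map_add, map_smul]
  have hI' : ∀ (c : ℝ) w, Integrable (fun x => c • fderiv ℝ g x w) e.cellMeasure := fun c w =>
    (hI w).smul c
  rw [integral_add (hI' _ _) (hI' _ _), integral_smul, integral_smul, h1, h2]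
  simp

lemma fderiv_pseudoperiodic {ψ : Plane → ℂ} {v : Plane} {c : ℂ}
    (hψ : ContDiff ℝ ∞ ψ) (h : ∀ x, ψ (x + v) = c * ψ x) (w x : Plane) :
    fderiv ℝ ψ (x + v) w = c * fderiv ℝ ψ x w := by
  have h1 : fderiv ℝ (fun y => ψ (y + v)) x w = fderiv ℝ (fun y => c * ψ y) x w := by
    simp only [h]
  rw [fderiv_comp_add_right, fderiv_const_mul (hψ.differentiable (by simp) x)] at h1
  simpa using h1

/-- The quasi-momentum seen by the lattice is unchanged by dual lattice vectors. -/
lemma phase_add_dualVec_latticeVec (k : Plane) (m : ℤ × ℤ) (a b : ℤ) :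
    phase (k + e.dualVec m) (latticeVec a b) = phase k (latticeVec a b) := by
  rw [phase_add_left, phase_dualVec_latticeVec, mul_one]

lemma integral_phase_mul_fderiv {k : Plane} {ψ : Plane → ℂ} (hψ : ContDiff ℝ ∞ ψ)
    (hper : ∀ (m n : ℤ) (x : Plane), ψ (x + latticeVec m n) = phase k (latticeVec m n) * ψ x)
    (m : ℤ × ℤ) (w : Plane) :
    ∫ x in e.cell, phase (-(k + e.dualVec m)) x * fderiv ℝ ψ x w =
      Complex.I * (inner ℝ (k + e.dualVec m) w : ℝ) *
        ∫ x in e.cell, phase (-(k + e.dualVec m)) x * ψ x := by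
  set κ := k + e.dualVec m with hκ
  -- Multiplying `ψ` by the conjugate wave makes it periodic, so the boundary terms of the
  -- integration by parts cancel.
  have hg : ContDiff ℝ ∞ fun x => phase (-κ) x * ψ x := (contDiff_phase _).mul hψ
  have h0 := e.integral_fderiv_periodic hg (fun a b x => by
    rw [hper, phase_add_right, ← e.phase_add_dualVec_latticeVec k m, ← hκ]
    have := phase_neg_mul_phase κ (latticeVec a b)
    linear_combination (phase (-κ) x * ψ x) * this) w
  have h1 : ∀ x, fderiv ℝ (fun x => phase (-κ) x * ψ x) x w =
      phase (-κ) x * fderiv ℝ ψ x w - Complex.I * (inner ℝ κ w : ℝ) * (phase (-κ) x * ψ x) := by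
    intro x
    rw [fderiv_fun_mul (hasFDerivAt_phase _ x).differentiableAt (hψ.differentiable (by simp) x)]
    simp only [add_apply, smul_apply, smul_eq_mul, fderiv_phase_apply, inner_neg_left]
    push_cast
    ring
  simp only [h1] at h0
  have hI : ∀ {u : Plane → ℂ}, Continuous u →
      Integrable (fun x => phase (-κ) x * u x) e.cellMeasure := fun hu =>
    (e.memLp_of_continuous (p := 1) ((continuous_phase _).mul hu)).integrable le_rfl
  rw [integral_sub (hI (contDiff_fderiv_apply hψ w).continuous)
    ((hI hψ.continuous).const_mul _), integral_const_mul] at h0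
  exact sub_eq_zero.1 h0

lemma integral_phase_mul_laplacian {k : Plane} {ψ : Plane → ℂ} (hψ : ContDiff ℝ ∞ ψ)
    (hper : ∀ (m n : ℤ) (x : Plane), ψ (x + latticeVec m n) = phase k (latticeVec m n) * ψ x)
    (m : ℤ × ℤ) :
    ∫ x in e.cell, phase (-(k + e.dualVec m)) x * Laplacian.laplacian ψ x =
      -((‖k + e.dualVec m‖ ^ 2 : ℝ) : ℂ) *
        ∫ x in e.cell, phase (-(k + e.dualVec m)) x * ψ x := by
  simp only [laplacian_eq_sum hψ, Finset.mul_sum]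
  rw [integral_finsetSum]
  · rw [← sum_inner_basisFun_sq, Complex.ofReal_sum, ← Finset.sum_neg_distrib, Finset.sum_mul]
    refine Finset.sum_congr rfl fun i _ => ?_
    rw [e.integral_phase_mul_fderiv (contDiff_fderiv_apply hψ _)
      (fun a b x => fderiv_pseudoperiodic hψ (hper a b) _ x), e.integral_phase_mul_fderiv hψ hper]
    push_cast
    linear_combination
      ((inner ℝ (k + e.dualVec m) (EuclideanSpace.basisFun (Fin 2) ℝ i) : ℝ) : ℂ) ^ 2 *
      (∫ x in e.cell, phase (-(k + e.dualVec m)) x * ψ x) * Complex.I_sq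
  · intro i _
    exact (e.memLp_of_continuous (p := 1) ((continuous_phase _).mul
      (contDiff_fderiv_apply (contDiff_fderiv_apply hψ _) _).continuous)).integrable le_rfl

/-! ### The weak eigenvalue equation in Fourier coefficients -/

lemma exists_mul_operator {V : Plane → ℝ} (hV : Continuous V) :
    ∃ W : e.CellL2 →L[ℂ] e.CellL2, W.IsSymmetric ∧
      ∀ g : e.CellL2, W g =ᵐ[e.cellMeasure] fun x => (V x : ℂ) * g x := by
  obtain ⟨B, hB⟩ := e.isCompact_cell.exists_bound_of_continuousOn hV.continuousOn
  have hB' : ∀ᵐ x ∂e.cellMeasure, ‖(V x : ℂ)‖ ≤ B :=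
    (ae_restrict_iff' e.measurableSet_cell).2 (Eventually.of_forall fun x hx => by
      rw [Complex.norm_real]; exact hB x hx)
  have hm : AEStronglyMeasurable (fun x => (V x : ℂ)) e.cellMeasure :=
    (Complex.continuous_ofReal.comp hV).aestronglyMeasurable
  have hmem : ∀ g : e.CellL2, MemLp (fun x => (V x : ℂ) * g x) 2 e.cellMeasure := fun g =>
    (Lp.memLp g).of_le_mul (c := B) (hm.mul (Lp.memLp g).1) (by
      filter_upwards [hB'] with x hx
      rw [norm_mul]
      gcongr)
  let W₀ : e.CellL2 →ₗ[ℂ] e.CellL2 :=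
    { toFun := fun g => (hmem g).toLp
      map_add' := fun g h => by
        rw [← MemLp.toLp_add, MemLp.toLp_eq_toLp_iff]
        filter_upwards [Lp.coeFn_add g h] with x hx
        simp only [hx, Pi.add_apply, mul_add]
      map_smul' := fun c g => by
        rw [RingHom.id_apply, ← MemLp.toLp_const_smul, MemLp.toLp_eq_toLp_iff]
        filter_upwards [Lp.coeFn_smul c g] with x hx
        simp only [hx, Pi.smul_apply, smul_eq_mul]
        ring }
  have hW₀ : ∀ g, W₀ g =ᵐ[e.cellMeasure] fun x => (V x : ℂ) * g x := fun g =>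
    (hmem g).coeFn_toLp
  refine ⟨W₀.mkContinuous (max B 0) fun g => ?_, fun g h => ?_, hW₀⟩
  · refine Lp.norm_le_mul_norm_of_ae_le_mul ?_
    filter_upwards [hW₀ g, hB'] with x hx hx'
    rw [hx, norm_mul]
    gcongr
    exact hx'.trans (le_max_left _ _)
  · change inner ℂ (W₀ g) h = inner ℂ g (W₀ h)
    rw [L2.inner_def, L2.inner_def]
    refine integral_congr_ae ?_
    filter_upwards [hW₀ g, hW₀ h] with x hx hx'
    rw [hx, hx', RCLike.inner_apply, RCLike.inner_apply, map_mul, Complex.conj_ofReal]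
    ring

/-- The weak eigenvalue equation at quasi-momentum `k`, in terms of the Fourier coefficients of the
periodic part. -/
def IsCoefState (W : e.CellL2 →L[ℂ] e.CellL2) (k : Plane) (E : ℝ) (p : e.CellL2) : Prop :=
  ∀ m, ((‖k + e.dualVec m‖ ^ 2 : ℝ) : ℂ) * inner ℂ (e.fourierBasis m) p +
    inner ℂ (e.fourierBasis m) (W p) = E * inner ℂ (e.fourierBasis m) p

/-- The periodic part of an element of `L²_k`. -/
def periodicLp {k : Plane} {φ : Plane → ℂ} (h : e.MemL2k k φ) : e.CellL2 := h.memLp.toLp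

variable {e}

lemma inner_fourierBasis_periodic {k : Plane} {u : Plane → ℂ} (m : ℤ × ℤ)
    (hu : MemLp (fun x => phase (-k) x * u x) 2 e.cellMeasure) :
    inner ℂ (e.fourierBasis m) hu.toLp =
      ((Real.sqrt e.area)⁻¹ : ℂ) * ∫ x in e.cell, phase (-(k + e.dualVec m)) x * u x := by
  rw [inner_fourierBasis_toLp, ← integral_const_mul]
  refine integral_congr_ae (Eventually.of_forall fun x => ?_)
  simp only [mode, map_mul, conj_phase, map_inv₀, Complex.conj_ofReal, neg_add, phase_add_left]
  ring

/-- The plane waves `e^{i(k + m)·x}` are admissible test functions, and testing against them yields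
one equation per Fourier mode. -/
lemma coefState_of_isFloquetBlochState {V : Plane → ℝ}
    {W : e.CellL2 →L[ℂ] e.CellL2}
    (hW : ∀ g : e.CellL2, W g =ᵐ[e.cellMeasure] fun x => (V x : ℂ) * g x)
    {k : Plane} {E : ℝ} {φ : Plane → ℂ} (h : e.IsFloquetBlochState V k E φ) :
    e.IsCoefState W k E (e.periodicLp h.memL2k) := by
  intro m
  have h1 := h.weak_eq (phase (k + e.dualVec m)) (contDiff_phase _) (fun a b x => by
    rw [phase_add_right, phase_add_dualVec_latticeVec, mul_comm])
  have hφ : MemLp φ 2 e.cellMeasure := memLp_phase_mul_iff.1 h.memL2k.memLp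
  have hVφ : MemLp (fun x => phase (-k) x * ((V x : ℂ) * φ x)) 2 e.cellMeasure := by
    refine (Lp.memLp (W (e.periodicLp h.memL2k))).ae_eq ?_
    filter_upwards [hW (e.periodicLp h.memL2k), h.memL2k.memLp.coeFn_toLp] with x hx hx'
    rw [hx, periodicLp, hx']
    ring
  have hWp : W (e.periodicLp h.memL2k) = hVφ.toLp := by
    refine Lp.ext ?_
    filter_upwards [hW (e.periodicLp h.memL2k), h.memL2k.memLp.coeFn_toLp, hVφ.coeFn_toLp]
      with x hx hx' hx''
    rw [hx, periodicLp, hx', hx'']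
    ring
  rw [hWp, periodicLp, inner_fourierBasis_periodic, inner_fourierBasis_periodic]
  have hI : ∀ {u : Plane → ℂ}, MemLp u 2 e.cellMeasure →
      Integrable (fun x => phase (-(k + e.dualVec m)) x * u x) e.cellMeasure := fun hu =>
    (memLp_phase_mul_iff.2 hu).integrable (by norm_num)
  have h2 : ∀ x, starRingEnd ℂ (schrodinger V (phase (k + e.dualVec m)) x) * φ x =
      ((‖k + e.dualVec m‖ ^ 2 : ℝ) : ℂ) * (phase (-(k + e.dualVec m)) x * φ x) +
        phase (-(k + e.dualVec m)) x * ((V x : ℂ) * φ x) := by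
    intro x
    rw [schrodinger, laplacian_phase]
    simp only [map_add, map_neg, map_mul, Complex.conj_ofReal, conj_phase]
    ring
  simp only [h2, conj_phase] at h1
  rw [integral_add ((hI hφ).const_mul _) (hI (memLp_phase_mul_iff.1 hVφ)),
    integral_const_mul] at h1
  linear_combination ((Real.sqrt e.area)⁻¹ : ℂ) * h1

/-- Parseval expresses both sides of the weak equation through Fourier coefficients, and integration
by parts on the smooth test function supplies the factors `|k + m|²`; no regularity of `φ` is
needed. -/
lemma isFloquetBlochState_of_coefState {V : Plane → ℝ} (hV : Continuous V)
    {W : e.CellL2 →L[ℂ] e.CellL2} (hWs : W.IsSymmetric)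
    (hW : ∀ g : e.CellL2, W g =ᵐ[e.cellMeasure] fun x => (V x : ℂ) * g x)
    {k : Plane} {E : ℝ} {φ : Plane → ℂ} (hφ : e.MemL2k k φ)
    (h : e.IsCoefState W k E (e.periodicLp hφ)) : e.IsFloquetBlochState V k E φ := by
  refine ⟨hφ, fun ψ hψ hper => ?_⟩
  set p := e.periodicLp hφ with hp
  have hq : MemLp (fun x => phase (-k) x * ψ x) 2 e.cellMeasure :=
    e.memLp_of_continuous ((continuous_phase _).mul hψ.continuous)
  have hr : MemLp (fun x => phase (-k) x * Laplacian.laplacian ψ x) 2 e.cellMeasure :=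
    e.memLp_of_continuous ((continuous_phase _).mul (continuous_laplacian hψ))
  have hs : MemLp (fun x => phase (-k) x * schrodinger V ψ x) 2 e.cellMeasure :=
    e.memLp_of_continuous ((continuous_phase _).mul
      ((continuous_laplacian hψ).neg.add ((Complex.continuous_ofReal.comp hV).mul hψ.continuous)))
  have hpair : ∀ {u : Plane → ℂ} (hu : MemLp (fun x => phase (-k) x * u x) 2 e.cellMeasure),
      ∫ x in e.cell, starRingEnd ℂ (u x) * φ x = inner ℂ hu.toLp p := by
    intro u hu
    rw [hp, periodicLp, inner_toLp]
    refine integral_congr_ae (Eventually.of_forall fun x => ?_)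
    simp only [map_mul, conj_phase, neg_neg]
    linear_combination -(starRingEnd ℂ (u x) * φ x) * phase_neg_mul_phase k x
  rw [hpair hs, hpair hq]
  have hsplit : hs.toLp = -hr.toLp + W hq.toLp := by
    refine Lp.ext ?_
    filter_upwards [hs.coeFn_toLp, hr.coeFn_toLp, hq.coeFn_toLp, hW hq.toLp,
      Lp.coeFn_add (-hr.toLp) (W hq.toLp), Lp.coeFn_neg hr.toLp] with x h1 h2 h3 h4 h5 h6
    rw [h1, h5, Pi.add_apply, h6, Pi.neg_apply, h2, h4, h3, schrodinger]
    ring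
  have hWpq : inner ℂ (W hq.toLp) p = inner ℂ hq.toLp (W p) := hWs _ _
  rw [hsplit, inner_add_left, inner_neg_left, hWpq]
  have e1 := e.fourierBasis.hasSum_inner_mul_inner hr.toLp p
  have e2 := e.fourierBasis.hasSum_inner_mul_inner hq.toLp (W p)
  have e3 := e.fourierBasis.hasSum_inner_mul_inner hq.toLp p
  have key : ∀ m, -(inner ℂ hr.toLp (e.fourierBasis m) * inner ℂ (e.fourierBasis m) p) +
      inner ℂ hq.toLp (e.fourierBasis m) * inner ℂ (e.fourierBasis m) (W p) =
      E * (inner ℂ hq.toLp (e.fourierBasis m) * inner ℂ (e.fourierBasis m) p) := by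
    intro m
    have h1 : inner ℂ (e.fourierBasis m) hr.toLp = -((‖k + e.dualVec m‖ ^ 2 : ℝ) : ℂ) *
        inner ℂ (e.fourierBasis m) hq.toLp := by
      rw [inner_fourierBasis_periodic, inner_fourierBasis_periodic,
        e.integral_phase_mul_laplacian hψ hper]
      ring
    have h2 : inner ℂ hr.toLp (e.fourierBasis m) = -((‖k + e.dualVec m‖ ^ 2 : ℝ) : ℂ) *
        inner ℂ hq.toLp (e.fourierBasis m) := by
      rw [← inner_conj_symm, h1, map_mul, inner_conj_symm, map_neg, Complex.conj_ofReal]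
    rw [h2]
    linear_combination inner ℂ hq.toLp (e.fourierBasis m) * h m
  have e4 := e1.neg.add e2
  simp only [key] at e4
  exact e4.unique (e3.mul_left (E : ℂ))

end Edge

end FloquetBloch

namespace FloquetBloch

namespace Edge

variable (e : Edge)

/-! ### Growth of the free energies -/

lemma summable_one_div_one_add_sq : Summable fun n : ℤ => (1 + (n : ℝ) ^ 2)⁻¹ := by
  refine Summable.of_norm_bounded_eventually (g := fun n : ℤ => 1 / (n : ℝ) ^ 2)
    (Real.summable_one_div_int_pow.2 (by norm_num)) ?_
  filter_upwards [eventually_cofinite_ne (0 : ℤ)] with n hn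
  have hn' : (0 : ℝ) < (n : ℝ) ^ 2 := by positivity
  rw [Real.norm_of_nonneg (by positivity), one_div]
  exact inv_anti₀ hn' (by linarith)

lemma inner_dualVec_vv₁ (m : ℤ × ℤ) : inner ℝ (e.dualVec m) e.vv₁ = 2 * Real.pi * m.1 := by
  simp only [dualVec, inner_add_left, inner_smul_left, inner_KK₁_vv₁, inner_KK₂_vv₁, conj_trivial]
  ring

lemma inner_dualVec_vv₂ (m : ℤ × ℤ) : inner ℝ (e.dualVec m) e.vv₂ = 2 * Real.pi * m.2 := by
  simp only [dualVec, inner_add_left, inner_smul_left, inner_KK₁_vv₂, inner_KK₂_vv₂, conj_trivial]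
  ring

/-- Pairing a dual vector with a lattice vector recovers its integer coordinate, so the free
energies control each coordinate separately. -/
lemma one_add_sq_le (k v : Plane) : ∃ D : ℝ, 0 < D ∧ ∀ (g : Plane) (n : ℝ),
    inner ℝ g v = 2 * Real.pi * n → 1 + n ^ 2 ≤ D * (‖k + g‖ ^ 2 + 1) := by
  refine ⟨1 + 2 * ‖v‖ ^ 2 + 2 * ‖v‖ ^ 2 * ‖k‖ ^ 2, by positivity, fun g n h => ?_⟩
  have h1 : |n| ≤ ‖g‖ * ‖v‖ := by
    have h2 := abs_real_inner_le_norm g v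
    rw [h, abs_mul, abs_of_pos (by positivity : 0 < 2 * Real.pi)] at h2
    have : 1 ≤ 2 * Real.pi := by linarith [Real.pi_gt_three]
    nlinarith [abs_nonneg n]
  have h2 : ‖g‖ ≤ ‖k + g‖ + ‖k‖ := by
    have := norm_sub_le (k + g) k
    rwa [add_sub_cancel_left] at this
  have h3 : ‖g‖ ^ 2 ≤ 2 * ‖k + g‖ ^ 2 + 2 * ‖k‖ ^ 2 := by
    nlinarith [norm_nonneg g, norm_nonneg k, norm_nonneg (k + g), sq_nonneg (‖k + g‖ - ‖k‖)]
  have h4 : n ^ 2 ≤ ‖g‖ ^ 2 * ‖v‖ ^ 2 := by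
    rw [← sq_abs, ← mul_pow]
    gcongr
  have h5 : ‖g‖ ^ 2 * ‖v‖ ^ 2 ≤ (2 * ‖k + g‖ ^ 2 + 2 * ‖k‖ ^ 2) * ‖v‖ ^ 2 := by gcongr
  have h6 : 0 ≤ ‖v‖ ^ 2 * ‖k‖ ^ 2 * ‖k + g‖ ^ 2 := by positivity
  nlinarith [sq_nonneg ‖v‖, sq_nonneg ‖k + g‖]

/-- The square is essential: in two dimensions the inverse energies themselves are not summable. One
factor is spent on each integer coordinate. -/
lemma summable_energy_inv_sq (k : Plane) {C : ℝ} (hC : 1 ≤ C) :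
    Summable fun m : ℤ × ℤ => ((‖k + e.dualVec m‖ ^ 2 + C)⁻¹) ^ 2 := by
  obtain ⟨D₁, hD₁, h₁⟩ := one_add_sq_le k e.vv₁
  obtain ⟨D₂, hD₂, h₂⟩ := one_add_sq_le k e.vv₂
  have hs : Summable fun m : ℤ × ℤ => (1 + (m.1 : ℝ) ^ 2)⁻¹ * (1 + (m.2 : ℝ) ^ 2)⁻¹ :=
    summable_one_div_one_add_sq.mul_of_nonneg summable_one_div_one_add_sq
      (fun n => by positivity) (fun n => by positivity)
  refine Summable.of_nonneg_of_le (fun m => by positivity) (fun m => ?_) (hs.mul_left (D₁ * D₂))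
  have e1 := h₁ _ _ (e.inner_dualVec_vv₁ m)
  have e2 := h₂ _ _ (e.inner_dualVec_vv₂ m)
  have hx : 0 < ‖k + e.dualVec m‖ ^ 2 + 1 := by positivity
  calc ((‖k + e.dualVec m‖ ^ 2 + C)⁻¹) ^ 2 ≤ ((‖k + e.dualVec m‖ ^ 2 + 1)⁻¹) ^ 2 := by gcongr
    _ = D₁ * D₂ * ((D₁ * (‖k + e.dualVec m‖ ^ 2 + 1))⁻¹ *
        (D₂ * (‖k + e.dualVec m‖ ^ 2 + 1))⁻¹) := by field_simp
    _ ≤ _ := by gcongr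

lemma tendsto_energy_inv (k : Plane) {C : ℝ} (hC : 1 ≤ C) :
    Tendsto (fun m : ℤ × ℤ => (‖k + e.dualVec m‖ ^ 2 + C)⁻¹) cofinite (𝓝 0) := by
  have h := (Real.continuous_sqrt.tendsto 0).comp
    (e.summable_energy_inv_sq k hC).tendsto_cofinite_zero
  rw [Real.sqrt_zero] at h
  refine h.congr fun m => ?_
  exact Real.sqrt_sq (by positivity)

lemma finite_energy_eq (k : Plane) (E' : ℝ) :
    {m : ℤ × ℤ | ‖k + e.dualVec m‖ ^ 2 = E'}.Finite := by
  by_cases hE : 0 ≤ E'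
  · have h := (e.tendsto_energy_inv k le_rfl).eventually_lt_const
      (show (0 : ℝ) < (E' + 1)⁻¹ by positivity)
    refine Set.Finite.subset h fun m hm => ?_
    simp only [Set.mem_ofPred_eq] at hm
    simp [hm]
  · convert Set.finite_empty
    ext m
    simp only [Set.mem_ofPred_eq, Set.mem_empty_iff_false, iff_false]
    intro h
    exact hE (h ▸ by positivity)

/-! ### Pseudo-periodic functions and their periodic parts -/

variable {e}

lemma integral_conj_mul_eq_inner {k : Plane} {φ χ : Plane → ℂ} (hφ : e.MemL2k k φ)
    (hχ : e.MemL2k k χ) : ∫ x in e.cell, starRingEnd ℂ (φ x) * χ x =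
      inner ℂ (e.periodicLp hφ) (e.periodicLp hχ) := by
  rw [periodicLp, periodicLp, inner_toLp]
  refine integral_congr_ae (Eventually.of_forall fun x => ?_)
  simp only [map_mul, conj_phase, neg_neg]
  linear_combination -(starRingEnd ℂ (φ x) * χ x) * phase_neg_mul_phase k x

lemma MemL2k.sum {k : Plane} {ι : Type*} {φ : ι → Plane → ℂ} (h : ∀ b, e.MemL2k k (φ b))
    (s : Finset ι) (α : ι → ℂ) : e.MemL2k k fun x => ∑ b ∈ s, α b * φ b x where
  aestronglyMeasurable := by
    have := Finset.aestronglyMeasurable_sum (μ := volume) (f := fun b x => α b * φ b x) s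
      fun b _ => (h b).aestronglyMeasurable.const_mul (α b)
    refine this.congr (Eventually.of_forall fun x => ?_)
    simp
  pseudoperiodic m n := by
    have := (eventually_all_finset s).2 fun b (_ : b ∈ s) => (h b).pseudoperiodic m n
    filter_upwards [this] with x hx
    rw [Finset.mul_sum]
    refine Finset.sum_congr rfl fun b hb => ?_
    rw [hx b hb]
    ring
  memLp := by
    have := memLp_finsetSum (μ := e.cellMeasure) (p := 2) s
      (f := fun b x => α b * (phase (-k) x * φ b x)) fun b _ => (h b).memLp.const_mul (α b)
    refine this.ae_eq (Eventually.of_forall fun x => ?_)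
    simp only [Finset.mul_sum]
    exact Finset.sum_congr rfl fun b _ => by ring

lemma ae_coeFn_sum_smul {ι : Type*} (s : Finset ι) (α : ι → ℂ) (g : ι → e.CellL2) :
    ((∑ b ∈ s, α b • g b : e.CellL2) : Plane → ℂ) =ᵐ[e.cellMeasure]
      fun x => ∑ b ∈ s, α b * g b x := by
  have h1 : ∀ b ∈ s, ((α b • g b : e.CellL2) : Plane → ℂ) =ᵐ[e.cellMeasure]
      fun x => α b * g b x := fun b _ => by
    filter_upwards [Lp.coeFn_smul (α b) (g b)] with x hx
    rw [hx]; rfl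
  filter_upwards [Lp.coeFn_finsetSum s fun b => α b • g b, (eventually_all_finset s).2 h1]
    with x hx hx'
  rw [hx]
  simp only [Finset.sum_apply]
  exact Finset.sum_congr rfl hx'

lemma periodicLp_sum {k : Plane} {ι : Type*} {φ : ι → Plane → ℂ} (h : ∀ b, e.MemL2k k (φ b))
    (s : Finset ι) (α : ι → ℂ) :
    e.periodicLp (MemL2k.sum h s α) = ∑ b ∈ s, α b • e.periodicLp (h b) := by
  refine Lp.ext ?_
  have h1 := (eventually_all_finset s).2 fun b (_ : b ∈ s) => (h b).memLp.coeFn_toLp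
  filter_upwards [(MemL2k.sum h s α).memLp.coeFn_toLp, ae_coeFn_sum_smul s α
    fun b => e.periodicLp (h b), h1] with x hx hx' hx''
  rw [hx', periodicLp, hx, Finset.mul_sum]
  refine Finset.sum_congr rfl fun b hb => ?_
  rw [periodicLp, hx'' b hb]
  ring

lemma ae_eq_of_periodicLp_eq {k : Plane} {φ χ : Plane → ℂ} (hφ : e.MemL2k k φ)
    (hχ : e.MemL2k k χ) (h : e.periodicLp hφ = e.periodicLp hχ) : ∀ᵐ x : Plane, φ x = χ x := by
  refine e.ae_of_ae_cell fun m n => ?_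
  have h1 := (MemLp.toLp_eq_toLp_iff hφ.memLp hχ.memLp).1 h
  filter_upwards [h1, ae_restrict_of_ae (hφ.pseudoperiodic m n),
    ae_restrict_of_ae (hχ.pseudoperiodic m n)] with x hx h2 h3
  rw [h2, h3, mul_left_cancel₀ (phase_ne_zero _ _) hx]

/-! ### Families of modes from orthonormal eigenbases -/

/-- The real diagonal energies cancel between the two coefficient equations, and symmetry of `W`
leaves `(E - E')⟪p, q⟫ = 0`. -/
lemma IsCoefState.inner_eq_zero {W : e.CellL2 →L[ℂ] e.CellL2} (hW : W.IsSymmetric) {k : Plane}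
    {E E' : ℝ} {p q : e.CellL2} (hp : e.IsCoefState W k E p) (hq : e.IsCoefState W k E' q)
    (hne : E ≠ E') : inner ℂ p q = 0 := by
  have a1 := e.fourierBasis.hasSum_inner_mul_inner p q
  have a2 := e.fourierBasis.hasSum_inner_mul_inner (W p) q
  have a3 := e.fourierBasis.hasSum_inner_mul_inner p (W q)
  have h1 : ∀ m, inner ℂ (W p) (e.fourierBasis m) = (E : ℂ) * inner ℂ p (e.fourierBasis m) -
      ((‖k + e.dualVec m‖ ^ 2 : ℝ) : ℂ) * inner ℂ p (e.fourierBasis m) := by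
    intro m
    have := congrArg (starRingEnd ℂ) (hp m)
    simp only [map_add, map_mul, Complex.conj_ofReal, inner_conj_symm] at this
    linear_combination this
  have key : ∀ m, inner ℂ (W p) (e.fourierBasis m) * inner ℂ (e.fourierBasis m) q -
      inner ℂ p (e.fourierBasis m) * inner ℂ (e.fourierBasis m) (W q) =
      ((E : ℂ) - E') * (inner ℂ p (e.fourierBasis m) * inner ℂ (e.fourierBasis m) q) := by
    intro m
    rw [h1]
    linear_combination -inner ℂ p (e.fourierBasis m) * hq m
  have a4 := a2.sub a3
  simp only [key] at a4
  have a5 := a4.unique (a1.mul_left _)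
  have hsym : inner ℂ (W p) q = inner ℂ p (W q) := hW p q
  rw [hsym, sub_self] at a5
  refine (mul_eq_zero.1 a5.symm).resolve_left (sub_ne_zero.2 ?_)
  exact_mod_cast hne

/-- Exhaustiveness holds because a state of energy `E'` is orthogonal to all basis vectors of other
energies, and only finitely many basis vectors have energy `E'`. -/
lemma isFloquetBlochFamily_of_eigenbasis {ι : Type} [DecidableEq ι] {V : Plane → ℝ}
    (hV : Continuous V) {W : e.CellL2 →L[ℂ] e.CellL2} (hWs : W.IsSymmetric)
    (hW : ∀ g : e.CellL2, W g =ᵐ[e.cellMeasure] fun x => (V x : ℂ) * g x) {k : Plane}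
    {E : ι → ℝ} {φ : ι → Plane → ℂ} (hφ : ∀ b, e.MemL2k k (φ b))
    (hcoef : ∀ b, e.IsCoefState W k (E b) (e.periodicLp (hφ b)))
    (horth : Orthonormal ℂ fun b => e.periodicLp (hφ b))
    (hcompl : ∀ q, (∀ b, inner ℂ (e.periodicLp (hφ b)) q = 0) → q = 0)
    (hfin : ∀ E', {b | E b = E'}.Finite) : e.IsFloquetBlochFamily V k E φ where
  state b := isFloquetBlochState_of_coefState hV hWs hW (hφ b) (hcoef b)
  orthonormal b c := by
    rw [integral_conj_mul_eq_inner (hφ b) (hφ c), orthonormal_iff_ite.1 horth]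
  exhaustive E' χ hχ := by
    have hq := coefState_of_isFloquetBlochState hW hχ
    set q := e.periodicLp hχ.memL2k
    let s := (hfin E').toFinset
    let α : ι → ℂ := fun b => inner ℂ (e.periodicLp (hφ b)) q
    refine ⟨s, α, fun b hb => by simpa [s] using hb, ?_⟩
    refine ae_eq_of_periodicLp_eq hχ.memL2k (MemL2k.sum hφ s α) ?_
    rw [periodicLp_sum hφ s α]
    refine sub_eq_zero.1 (hcompl _ fun b => ?_)
    rw [inner_sub_right, inner_sum]
    simp only [inner_smul_right, orthonormal_iff_ite.1 horth, mul_ite, mul_one, mul_zero,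
      Finset.sum_ite_eq]
    by_cases hb : b ∈ s
    · rw [if_pos hb]
      exact sub_self _
    · rw [if_neg hb, sub_zero]
      exact (hcoef b).inner_eq_zero hWs hq (by simpa [s] using hb)

variable (e)

lemma mode_add_latticeVec (m : ℤ × ℤ) (a b : ℤ) (x : Plane) :
    e.mode m (x + latticeVec a b) = e.mode m x := by
  rw [mode, mode, phase_add_right, phase_dualVec_latticeVec, mul_one]

lemma normalized_planeWave_eq (m : ℤ × ℤ) (l : ℝ) (x : Plane) :
    ((Real.sqrt e.area)⁻¹ : ℂ) * e.planeWave m l x = phase (e.slice l) x * e.mode m x := by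
  rw [planeWave, phase_add_left, mode]
  ring

lemma memL2k_normalized_planeWave (m : ℤ × ℤ) (l : ℝ) :
    e.MemL2k (e.slice l) fun x => ((Real.sqrt e.area)⁻¹ : ℂ) * e.planeWave m l x where
  aestronglyMeasurable := by
    simp only [normalized_planeWave_eq]
    exact ((continuous_phase _).mul (e.continuous_mode m)).aestronglyMeasurable
  pseudoperiodic a b := Eventually.of_forall fun x => by
    rw [normalized_planeWave_eq, normalized_planeWave_eq, mode_add_latticeVec, phase_add_right]
    ring
  memLp := by
    simp only [normalized_planeWave_eq, ← mul_assoc, phase_neg_mul_phase, one_mul]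
    exact e.memLp_mode m

lemma periodicLp_planeWave (m : ℤ × ℤ) (l : ℝ) :
    e.periodicLp (e.memL2k_normalized_planeWave m l) = e.fourierBasis m := by
  rw [fourierBasis_apply, periodicLp, MemLp.toLp_eq_toLp_iff]
  refine Eventually.of_forall fun x => ?_
  simp only [normalized_planeWave_eq, ← mul_assoc, phase_neg_mul_phase, one_mul]

theorem isFloquetBlochFamily_planeWave (l : ℝ) : e.IsFloquetBlochFamily (fun _ => 0) (e.slice l)
    (fun m : ℤ × ℤ => ‖e.slice l + e.dualVec m‖ ^ 2)
    (fun m x => ((Real.sqrt e.area)⁻¹ : ℂ) * e.planeWave m l x) := by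
  refine isFloquetBlochFamily_of_eigenbasis (W := 0) continuous_const (fun g h => by simp)
    (fun g => ?_) (fun m => e.memL2k_normalized_planeWave m l) (fun m n => ?_) ?_ (fun q hq => ?_)
    (fun E' => e.finite_energy_eq (e.slice l) E')
  · rw [zero_apply]
    filter_upwards [Lp.coeFn_zero ℂ 2 e.cellMeasure] with x hx
    rw [hx]
    simp
  · rw [periodicLp_planeWave, zero_apply, inner_zero_right, add_zero,
      orthonormal_iff_ite.1 e.fourierBasis.orthonormal]
    by_cases h : n = m
    · rw [h]
    · simp [h]
  · simp only [periodicLp_planeWave]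
    exact e.fourierBasis.orthonormal
  · simp only [periodicLp_planeWave] at hq
    exact hilbertBasis_ext e.fourierBasis fun m => by rw [hq, inner_zero_right]

/-! ### Absolutely convergent Fourier series -/

lemma norm_mode_le (m : ℤ × ℤ) (x : Plane) (c : ℂ) :
    ‖c * e.mode m x‖ = ‖c‖ * (Real.sqrt e.area)⁻¹ := by
  rw [norm_mul, norm_mode]

lemma summable_fourier_series {a : ℤ × ℤ → ℂ} (ha : Summable fun m => ‖a m‖) (x : Plane) :
    Summable fun m => a m * e.mode m x := by
  refine Summable.of_norm ?_
  simp only [norm_mode_le]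
  exact ha.mul_right _

lemma memLp_fourier_series {a : ℤ × ℤ → ℂ} (ha : Summable fun m => ‖a m‖) :
    MemLp (fun x => ∑' m, a m * e.mode m x) 2 e.cellMeasure := by
  have hm : Measurable fun x => ∑' m, a m * e.mode m x :=
    measurable_of_tendsto_metrizable' (atTop : Filter (Finset (ℤ × ℤ)))
      (f := fun s x => ∑ m ∈ s, a m * e.mode m x)
      (fun s => Finset.measurable_sum _ fun m _ => ((e.continuous_mode m).measurable.const_mul _))
      (tendsto_pi_nhds.2 fun x => (e.summable_fourier_series ha x).hasSum)
  refine MemLp.of_bound hm.aestronglyMeasurable (∑' m, ‖a m‖ * (Real.sqrt e.area)⁻¹)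
    (Eventually.of_forall fun x => ?_)
  refine (norm_tsum_le_tsum_norm ?_).trans ?_
  · simp only [norm_mode_le]
    exact ha.mul_right _
  · simp only [norm_mode_le]
    exact le_rfl

/-- Gives an `L²` class a representative defined at every point, as needed for joint measurability
in position and parameter. -/
lemma toLp_fourier_series {p : e.CellL2} (ha : Summable fun m => ‖inner ℂ (e.fourierBasis m) p‖) :
    (e.memLp_fourier_series ha).toLp = p := by
  refine hilbertBasis_ext e.fourierBasis fun n => ?_
  rw [inner_fourierBasis_toLp]
  have hi : ∀ m, Integrable (fun x => starRingEnd ℂ (e.mode n x) *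
      (inner ℂ (e.fourierBasis m) p * e.mode m x)) e.cellMeasure := fun m =>
    (e.memLp_of_continuous (p := 1) ((continuous_star.comp (e.continuous_mode n)).mul
      (continuous_const.mul (e.continuous_mode m)))).integrable le_rfl
  have h1 := hasSum_integral_of_summable_integral_norm hi (by
    simp only [norm_mul, norm_mode, RCLike.norm_conj]
    simp only [integral_const]
    exact ((ha.mul_right _).mul_left _).const_smul _)
  have h2 : ∀ x, ∑' m, starRingEnd ℂ (e.mode n x) * (inner ℂ (e.fourierBasis m) p * e.mode m x) =
      starRingEnd ℂ (e.mode n x) * ∑' m, inner ℂ (e.fourierBasis m) p * e.mode m x := fun x =>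
    tsum_mul_left
  simp only [h2] at h1
  rw [← h1.tsum_eq]
  have h3 : ∀ m, ∫ x in e.cell, starRingEnd ℂ (e.mode n x) *
      (inner ℂ (e.fourierBasis m) p * e.mode m x) =
      if n = m then inner ℂ (e.fourierBasis m) p else 0 := by
    intro m
    have h4 : ∀ x, starRingEnd ℂ (e.mode n x) * (inner ℂ (e.fourierBasis m) p * e.mode m x) =
        inner ℂ (e.fourierBasis m) p * (starRingEnd ℂ (e.mode n x) * e.mode m x) :=
      fun x => by ring
    simp only [h4]
    rw [integral_const_mul, integral_conj_mode_mul_mode]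
    simp
  simp only [h3]
  rw [tsum_ite_eq' n]

end Edge

end FloquetBloch

namespace FloquetBloch

namespace Edge

variable (e : Edge)

/-! ### Measurable modes along the dual slice -/

lemma not_finiteDimensional_cellL2 : ¬ FiniteDimensional ℂ e.CellL2 := by
  intro h
  have := e.fourierBasis.orthonormal.linearIndependent.finite
  exact not_finite (ℤ × ℤ)

lemma continuous_slice : Continuous e.slice := by
  unfold slice
  fun_prop

lemma continuous_phase_slice : Continuous fun q : ℝ × Plane => phase (e.slice q.1) q.2 :=
  continuous_phase_uncurry.comp ((e.continuous_slice.comp continuous_fst).prodMk continuous_snd)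

/-- The function with quasi-momentum `k` and Fourier coefficients `a`. -/
def synth (k : Plane) (a : ℤ × ℤ → ℂ) (x : Plane) : ℂ := phase k x * ∑' m, a m * e.mode m x

lemma phase_neg_mul_synth (k : Plane) (a : ℤ × ℤ → ℂ) (x : Plane) :
    phase (-k) x * e.synth k a x = ∑' m, a m * e.mode m x := by
  rw [synth, ← mul_assoc, phase_neg_mul_phase, one_mul]

lemma measurable_synth {a : ℝ → ℤ × ℤ → ℂ} (hm : ∀ m, Measurable fun l => a l m)
    (ha : ∀ l, Summable fun m => ‖a l m‖) :
    Measurable fun q : ℝ × Plane => e.synth (e.slice q.1) (a q.1) q.2 := by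
  refine e.continuous_phase_slice.measurable.mul ?_
  refine measurable_of_tendsto_metrizable' (atTop : Filter (Finset (ℤ × ℤ)))
    (f := fun s (q : ℝ × Plane) => ∑ m ∈ s, a q.1 m * e.mode m q.2)
    (fun s => Finset.measurable_sum _ fun m _ => ?_)
    (tendsto_pi_nhds.2 fun q => (e.summable_fourier_series (ha q.1) q.2).hasSum)
  exact ((hm m).comp measurable_fst).mul ((e.continuous_mode m).measurable.comp measurable_snd)

lemma memL2k_synth {l : ℝ} {a : ℤ × ℤ → ℂ} (ha : Summable fun m => ‖a m‖) :
    e.MemL2k (e.slice l) (e.synth (e.slice l) a) where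
  aestronglyMeasurable := by
    have h := e.measurable_synth (a := fun _ => a) (fun _ => measurable_const) (fun _ => ha)
    have h2 := h.comp (measurable_prodMk_left (x := l))
    exact h2.aestronglyMeasurable
  pseudoperiodic m n := Eventually.of_forall fun x => by
    simp only [synth, mode_add_latticeVec, phase_add_right]
    ring
  memLp := by
    simp only [phase_neg_mul_synth]
    exact e.memLp_fourier_series ha

lemma periodicLp_synth {l : ℝ} {p : e.CellL2}
    (ha : Summable fun m => ‖inner ℂ (e.fourierBasis m) p‖) :
    e.periodicLp (e.memL2k_synth (l := l) ha) = p := by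
  conv_rhs => rw [← e.toLp_fourier_series ha]
  rw [periodicLp, MemLp.toLp_eq_toLp_iff]
  exact Eventually.of_forall fun x => e.phase_neg_mul_synth _ _ x

/-- By the eigenvalue equation each coefficient is `(|k + m|² + 1)⁻¹` times a coefficient of `(E +
1)p - Wp`. Both factors are square summable, so the product is summable. -/
lemma IsCoefState.summable_norm {W : e.CellL2 →L[ℂ] e.CellL2} {k : Plane} {E : ℝ} {p : e.CellL2}
    (hp : e.IsCoefState W k E p) : Summable fun m => ‖inner ℂ (e.fourierBasis m) p‖ := by
  have h1 := e.summable_energy_inv_sq k le_rfl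
  have h2 := (hilbertBasis_hasSum_norm_sq e.fourierBasis (((E : ℂ) + 1) • p - W p)).summable
  refine Summable.of_nonneg_of_le (fun m => norm_nonneg _) (fun m => ?_) (h1.add h2)
  set c := inner ℂ (e.fourierBasis m) (((E : ℂ) + 1) • p - W p) with hc
  have h3 : inner ℂ (e.fourierBasis m) p =
      (((‖k + e.dualVec m‖ ^ 2 + 1)⁻¹ : ℝ) : ℂ) * c := by
    have hne : ((‖k + e.dualVec m‖ ^ 2 + 1 : ℝ) : ℂ) ≠ 0 := by
      exact_mod_cast (by positivity : ‖k + e.dualVec m‖ ^ 2 + 1 ≠ 0)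
    rw [hc, inner_sub_right, inner_smul_right, Complex.ofReal_inv, eq_inv_mul_iff_mul_eq₀ hne,
      Complex.ofReal_add, Complex.ofReal_one]
    linear_combination hp m
  rw [h3, norm_mul, Complex.norm_real, Real.norm_of_nonneg (by positivity)]
  nlinarith [sq_nonneg ((‖k + e.dualVec m‖ ^ 2 + 1)⁻¹ - ‖c‖),
    sq_nonneg ((‖k + e.dualVec m‖ ^ 2 + 1)⁻¹ + ‖c‖)]

lemma exists_norm_le_half (W : e.CellL2 →L[ℂ] e.CellL2) :
    ∃ C : ℝ, 1 ≤ C ∧ ‖W‖ ≤ C / 2 :=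
  ⟨max 1 (2 * ‖W‖), le_max_left _ _, by linarith [le_max_right 1 (2 * ‖W‖)]⟩

/-- The eigenvalues `μₙ` of the resolvent decrease to zero, so the energies `1/μₙ - C` increase to
infinity. Completeness is recorded separately, to be transferred to arbitrary choices of modes. -/
theorem exists_complete_sliceModes {V : Plane → ℝ} (hV : Continuous V) :
    ∃ (E : ℕ → ℝ → ℝ) (Φ : ℕ → ℝ → Plane → ℂ), e.IsSliceModes V E Φ ∧
      ∀ (l : ℝ) (h : Plane → ℂ), MemLp h 2 e.cellMeasure →
        (∀ b, ∫ x in e.cell, starRingEnd ℂ (Φ b l x) * h x = 0) → h =ᵐ[e.cellMeasure] 0 := by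
  obtain ⟨W, hWs, hW⟩ := e.exists_mul_operator hV
  obtain ⟨C, hC1, hWC⟩ := e.exists_norm_le_half W
  have hC0 : 0 < C := by linarith
  borelize e.CellL2
  have : Fact ((2 : ℝ≥0∞) ≠ ⊤) := ⟨by norm_num⟩
  have hsc : SecondCountableTopology e.CellL2 := inferInstance
  obtain ⟨R, hRf, hRinj, hReig⟩ := exists_resolvent_field (α := ℝ) e.fourierBasis
    (t := fun l m => (‖e.slice l + e.dualVec m‖ ^ 2 + C)⁻¹) hC0 (fun l m => by positivity)
    (fun l m => inv_anti₀ hC0 (by linarith [sq_nonneg ‖e.slice l + e.dualVec m‖]))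
    (fun m => by
      have : Measurable fun l => ‖e.slice l + e.dualVec m‖ ^ 2 + C :=
        ((((e.continuous_slice.add continuous_const).norm).pow 2).add
          continuous_const).measurable
      exact this.inv)
    (fun l => e.tendsto_energy_inv (e.slice l) hC1) hWs hWC
  obtain ⟨μ, p, hpm, horth, heig, hμ, hanti, hlim, hcompl⟩ :=
    hRf.exists_measurable_eigenbasis hRinj e.not_finiteDimensional_cellL2
  have hcoef : ∀ n l, e.IsCoefState W (e.slice l) ((μ n l)⁻¹ - C) (p n l) := by
    intro n l m
    have h1 := (hReig l (p n l) (μ n l)).1 (heig n l) m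
    have hd : ((‖e.slice l + e.dualVec m‖ ^ 2 + C : ℝ) : ℂ) ≠ 0 := by
      exact_mod_cast (by positivity : ‖e.slice l + e.dualVec m‖ ^ 2 + C ≠ 0)
    have hμ0 : (μ n l : ℂ) ≠ 0 := by exact_mod_cast (hμ n l).ne'
    set A := inner ℂ (e.fourierBasis m) (p n l)
    set B := inner ℂ (e.fourierBasis m) (W (p n l))
    have h2 : A = μ n l * (((‖e.slice l + e.dualVec m‖ ^ 2 + C : ℝ) : ℂ) * A + B) := by
      have := congrArg (fun z => ((‖e.slice l + e.dualVec m‖ ^ 2 + C : ℝ) : ℂ) * z) h1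
      simp only [Complex.ofReal_inv] at this
      rw [mul_inv_cancel_left₀ hd] at this
      -- The equation is multiplied by the diagonal entry `|k + m|² + C`, which undoes the inverse
      -- entry of the resolvent.
      linear_combination this + (μ n l : ℂ) * B * mul_inv_cancel₀ hd
    have h3 : (μ n l : ℂ)⁻¹ * A = ((‖e.slice l + e.dualVec m‖ ^ 2 + C : ℝ) : ℂ) * A + B := by
      conv_lhs => rw [h2, inv_mul_cancel_left₀ hμ0]
    rw [Complex.ofReal_sub, Complex.ofReal_inv, sub_mul, h3, Complex.ofReal_add]
    ring
  have hsum : ∀ n l, Summable fun m => ‖inner ℂ (e.fourierBasis m) (p n l)‖ := fun n l =>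
    (hcoef n l).summable_norm
  let a : ℕ → ℝ → ℤ × ℤ → ℂ := fun n l m => inner ℂ (e.fourierBasis m) (p n l)
  let Φ : ℕ → ℝ → Plane → ℂ := fun n l => e.synth (e.slice l) (a n l)
  have hΦ : ∀ l n, e.MemL2k (e.slice l) (Φ n l) := fun l n => e.memL2k_synth (hsum n l)
  have hΦp : ∀ l n, e.periodicLp (hΦ l n) = p n l := fun l n => e.periodicLp_synth (hsum n l)
  refine ⟨fun n l => (μ n l)⁻¹ - C, Φ, ⟨fun l _ => ?_, fun l _ => ?_, fun n => ?_⟩,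
    fun l h hh h0 => ?_⟩
  · refine isFloquetBlochFamily_of_eigenbasis hV hWs hW (hΦ l) (fun n => ?_) ?_ ?_ fun E' => ?_
    · rw [hΦp]
      exact hcoef n l
    · simp only [hΦp]
      exact horth l
    · simp only [hΦp]
      exact hcompl l
    · have h1 : Tendsto (fun n => (μ n l)⁻¹) atTop atTop :=
        (tendsto_nhdsWithin_iff.2 ⟨hlim l, Eventually.of_forall fun n => hμ n l⟩
          ).inv_tendsto_nhdsGT_zero
      obtain ⟨N, hN⟩ := (h1.eventually_gt_atTop (E' + C)).exists_forall_of_atTop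
      refine (Set.finite_lt_nat N).subset fun n hn => ?_
      by_contra hlt
      have h2 := hN n (not_lt.1 hlt)
      simp only [Set.mem_ofPred_eq] at hn
      linarith
  · intro i j hij
    have := inv_anti₀ (hμ j l) (hanti l hij)
    simp only
    linarith
  · refine (e.measurable_synth (a := a n) (fun m => ?_) (hsum n)).aestronglyMeasurable
    exact (measurable_const.inner (hpm n))
  · have hq : MemLp (fun x => phase (-(e.slice l)) x * h x) 2 e.cellMeasure :=
      memLp_phase_mul_iff.2 hh
    have h1 : hq.toLp = 0 := by
      refine hcompl l _ fun n => ?_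
      rw [← hΦp l n, periodicLp, inner_toLp, ← h0 n]
      refine integral_congr_ae (Eventually.of_forall fun x => ?_)
      simp only [map_mul, conj_phase, neg_neg]
      linear_combination (starRingEnd ℂ (Φ n l x) * h x) * phase_neg_mul_phase (e.slice l) x
    have h2 := (Lp.eq_zero_iff_ae_eq_zero.1 h1)
    filter_upwards [hq.coeFn_toLp, h2] with x hx hx'
    rw [hx'] at hx
    exact (mul_eq_zero.1 hx.symm).resolve_left (phase_ne_zero _ _)

/-- Every family of Floquet-Bloch modes along the slice is complete over the period cell. -/
lemma IsSliceModes.complete {e : Edge} {V : Plane → ℝ} (hV : Continuous V) {E : ℕ → ℝ → ℝ}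
    {Φ : ℕ → ℝ → Plane → ℂ} (hΦ : e.IsSliceModes V E Φ) {l : ℝ}
    (hl : l ∈ Set.Icc (-(1 / 2) : ℝ) (1 / 2)) {h : Plane → ℂ} (hh : MemLp h 2 e.cellMeasure)
    (h0 : ∀ b, ∫ x in e.cell, starRingEnd ℂ (Φ b l x) * h x = 0) : h =ᵐ[e.cellMeasure] 0 := by
  obtain ⟨E', Ψ, hΨ, hcompl⟩ := e.exists_complete_sliceModes hV
  refine hcompl l h hh fun n => ?_
  -- Each reference mode is a finite combination of the given modes, so orthogonality to the latter
  -- implies orthogonality to the former.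
  obtain ⟨s, α, -, hs⟩ := (hΦ.family l hl).exhaustive _ _ ((hΨ.family l hl).state n)
  have h1 : ∀ᵐ x ∂e.cellMeasure, starRingEnd ℂ (Ψ n l x) * h x =
      ∑ b ∈ s, starRingEnd ℂ (α b) * (starRingEnd ℂ (Φ b l x) * h x) := by
    filter_upwards [ae_restrict_of_ae hs] with x hx
    rw [hx, map_sum, Finset.sum_mul]
    exact Finset.sum_congr rfl fun b _ => by rw [map_mul, mul_assoc]
  rw [integral_congr_ae h1, integral_finsetSum]
  · refine Finset.sum_eq_zero fun b _ => ?_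
    rw [integral_const_mul, h0, mul_zero]
  · intro b _
    have hb : MemLp (Φ b l) 2 e.cellMeasure :=
      memLp_phase_mul_iff.1 ((hΦ.family l hl).state b).memL2k.memLp
    exact (hb.star.integrable_mul hh).const_mul _

end Edge

end FloquetBloch

/-! ### Exchanging almost-everywhere quantifiers, and the Cauchy–Schwarz inequality. -/

namespace FloquetBloch

/-- Almost everywhere equality of measurable functions on a product may be checked in either order
of the variables. -/
lemma ae_ae_eq_swap {X Y : Type*} [MeasurableSpace X] [MeasurableSpace Y] {ν : Measure Y}
    {μ : Measure X} [SFinite ν] [SFinite μ] {F G : Y → X → ℂ}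
    (hF : AEStronglyMeasurable (fun q : Y × X => F q.1 q.2) (ν.prod μ))
    (hG : AEStronglyMeasurable (fun q : Y × X => G q.1 q.2) (ν.prod μ))
    (h : ∀ᵐ l ∂ν, ∀ᵐ x ∂μ, F l x = G l x) : ∀ᵐ x ∂μ, ∀ᵐ l ∂ν, F l x = G l x := by
  have h1 := Measure.ae_ae_of_ae_prod hF.ae_eq_mk
  have h2 := Measure.ae_ae_of_ae_prod hG.ae_eq_mk
  have hS : MeasurableSet {q : Y × X | hF.mk _ q = hG.mk _ q} :=
    hF.stronglyMeasurable_mk.measurableSet_eq_fun hG.stronglyMeasurable_mk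
  have h3 : ∀ᵐ q ∂(ν.prod μ), q ∈ {q : Y × X | hF.mk _ q = hG.mk _ q} := by
    rw [Measure.ae_prod_mem_iff_ae_ae_mem hS]
    filter_upwards [h, h1, h2] with l hl hl1 hl2
    filter_upwards [hl, hl1, hl2] with x hx hx1 hx2
    exact hx1.symm.trans (hx.trans hx2)
  have h4 : ∀ᵐ q ∂(ν.prod μ), F q.1 q.2 = G q.1 q.2 := by
    filter_upwards [h3, hF.ae_eq_mk, hG.ae_eq_mk] with q hq hq1 hq2
    exact hq1.trans (Eq.trans hq hq2.symm)
  have h5 := (Measure.measurePreserving_swap (μ := μ) (ν := ν)).quasiMeasurePreserving.ae h4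
  exact Measure.ae_ae_of_ae_prod h5

/-- The Cauchy-Schwarz inequality for integrals. -/
lemma enorm_integral_conj_mul_sq_le {X : Type*} [MeasurableSpace X] {μ : Measure X} {f g : X → ℂ}
    (hf : AEStronglyMeasurable f μ) (hg : AEStronglyMeasurable g μ) :
    ‖∫ x, starRingEnd ℂ (f x) * g x ∂μ‖ₑ ^ 2 ≤ (∫⁻ x, ‖f x‖ₑ ^ 2 ∂μ) * ∫⁻ x, ‖g x‖ₑ ^ 2 ∂μ := by
  have h1 : ‖∫ x, starRingEnd ℂ (f x) * g x ∂μ‖ₑ ≤ ∫⁻ x, ‖f x‖ₑ * ‖g x‖ₑ ∂μ := by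
    refine (enorm_integral_le_lintegral_enorm _).trans (le_of_eq (lintegral_congr fun x => ?_))
    rw [enorm_mul, RCLike.enorm_conj]
  have h2 := ENNReal.lintegral_mul_le_Lp_mul_Lq μ Real.HolderConjugate.two_two hf.enorm hg.enorm
  simp only [Pi.mul_apply, ENNReal.rpow_two] at h2
  calc _ ≤ ((∫⁻ x, ‖f x‖ₑ ^ 2 ∂μ) ^ (1 / 2 : ℝ) * (∫⁻ x, ‖g x‖ₑ ^ 2 ∂μ) ^ (1 / 2 : ℝ)) ^ 2 := by
        gcongr
        exact h1.trans h2
    _ = _ := by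
        rw [mul_pow, ← ENNReal.rpow_natCast, ← ENNReal.rpow_natCast, ← ENNReal.rpow_mul,
          ← ENNReal.rpow_mul]
        norm_num

namespace Edge

variable (e : Edge)

/-! ### The Bloch transform on the cylinder -/

instance : IsFiniteMeasure sliceMeasure := by
  unfold sliceMeasure
  infer_instance

lemma ae_mem_slice : ∀ᵐ l ∂sliceMeasure, l ∈ Set.Icc (-(1 / 2) : ℝ) (1 / 2) :=
  ae_restrict_mem measurableSet_Icc

lemma phase_slice_smul_vv₂ (l : ℝ) (n : ℤ) : phase (e.slice l) ((n : ℝ) • e.vv₂) =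
    phase K ((n : ℝ) • e.vv₂) * Complex.exp (2 * Real.pi * Complex.I * n * l) := by
  rw [slice, phase_add_left]
  congr 1
  rw [phase, inner_smul_left, inner_smul_right, inner_KK₂_vv₂]
  congr 1
  simp only [conj_trivial]
  push_cast
  ring

lemma phase_slice_vv₁ (l : ℝ) :
    phase (e.slice l) e.vv₁ = Complex.exp (Complex.I * (e.kpar : ℂ)) := by
  rw [phase, slice, inner_add_left, inner_smul_left, inner_KK₂_vv₁, mul_zero, add_zero, kpar]

lemma smul_vv₂_eq (n : ℤ) : (n : ℝ) • e.vv₂ = latticeVec (n * e.a₂) (n * e.b₂) := by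
  have := e.smul_add_smul_eq 0 n
  simpa using this

/-- The value on the `n`-th translate of the period cell of the superposition over the slice of
pseudo-periodic functions which agree with `g l` on the period cell. -/
def blochCoef (n : ℤ) (g : ℝ → Plane → ℂ) (x : Plane) : ℂ :=
  ∫ l, phase (e.slice l) ((n : ℝ) • e.vv₂) * g l x ∂sliceMeasure

lemma blochCoef_eq (n : ℤ) (g : ℝ → Plane → ℂ) (x : Plane) :
    e.blochCoef n g x = phase K ((n : ℝ) • e.vv₂) *
      ∫ l, Complex.exp (2 * Real.pi * Complex.I * n * l) * g l x ∂sliceMeasure := by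
  rw [blochCoef, ← integral_const_mul]
  simp only [phase_slice_smul_vv₂, mul_assoc]

lemma aestronglyMeasurable_blochCoef {g : ℝ → Plane → ℂ}
    (hg : AEStronglyMeasurable (fun q : ℝ × Plane => g q.1 q.2)
      (sliceMeasure.prod e.cellMeasure)) (n : ℤ) :
    AEStronglyMeasurable (e.blochCoef n g) e.cellMeasure := by
  have h := (aestronglyMeasurable_fourier_integral hg n).const_mul (phase K ((n : ℝ) • e.vv₂))
  exact h.congr (Eventually.of_forall fun x => (e.blochCoef_eq n g x).symm)

/-- The tile index is the Fourier variable dual to `l`: up to a phase, `blochCoef` is a Fourier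
coefficient over an interval of length one. -/
lemma tsum_lintegral_blochCoef {g : ℝ → Plane → ℂ}
    (hg : MemLp (fun q : ℝ × Plane => g q.1 q.2) 2 (sliceMeasure.prod e.cellMeasure)) :
    ∑' n : ℤ, ∫⁻ x in e.cell, ‖e.blochCoef n g x‖ₑ ^ 2 =
      ∫⁻ q, ‖g q.1 q.2‖ₑ ^ 2 ∂(sliceMeasure.prod e.cellMeasure) := by
  rw [sliceMeasure, ← parseval_prod (by norm_num) hg]
  refine tsum_congr fun n => lintegral_congr fun x => ?_
  rw [blochCoef_eq, enorm_mul, enorm_phase, one_mul, sliceMeasure]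

lemma lintegral_strip_eq_of_blochCoef {u : Plane → ℂ} {g : ℝ → Plane → ℂ}
    (hg : MemLp (fun q : ℝ × Plane => g q.1 q.2) 2 (sliceMeasure.prod e.cellMeasure))
    (h : ∀ n : ℤ, ∀ᵐ x ∂e.cellMeasure, u (x + (n : ℝ) • e.vv₂) = e.blochCoef n g x) :
    ∫⁻ x in e.strip, ‖u x‖ₑ ^ 2 = ∫⁻ q, ‖g q.1 q.2‖ₑ ^ 2 ∂(sliceMeasure.prod e.cellMeasure) := by
  rw [lintegral_strip, ← tsum_lintegral_blochCoef e hg]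
  refine tsum_congr fun n => lintegral_congr_ae ?_
  filter_upwards [h n] with x hx
  rw [hx]

lemma ae_blochCoef_sub {g h : ℝ → Plane → ℂ}
    (hg : MemLp (fun q : ℝ × Plane => g q.1 q.2) 2 (sliceMeasure.prod e.cellMeasure))
    (hh : MemLp (fun q : ℝ × Plane => h q.1 q.2) 2 (sliceMeasure.prod e.cellMeasure)) (n : ℤ) :
    ∀ᵐ x ∂e.cellMeasure, e.blochCoef n (fun l x => g l x - h l x) x =
      e.blochCoef n g x - e.blochCoef n h x := by
  have hb : ∀ {u : ℝ → ℂ}, MemLp u 2 sliceMeasure →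
      Integrable (fun l => phase (e.slice l) ((n : ℝ) • e.vv₂) * u l) sliceMeasure := fun hu =>
    (hu.integrable (by norm_num)).bdd_mul (c := 1)
      (e.continuous_phase_slice.comp (by fun_prop : Continuous fun l : ℝ =>
        (l, (n : ℝ) • e.vv₂))).aestronglyMeasurable (Eventually.of_forall fun l => by simp)
  filter_upwards [MemLp.ae_memLp_left hg, MemLp.ae_memLp_left hh] with x hx hx'
  rw [blochCoef, blochCoef, blochCoef, ← integral_sub (hb hx) (hb hx')]
  simp only [mul_sub]

/-- The finite Bloch sum over the translates in `s`. -/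
def blochSum (f : Plane → ℂ) (s : Finset ℤ) (l : ℝ) (x : Plane) : ℂ :=
  ∑ n ∈ s, phase (-(e.slice l)) ((n : ℝ) • e.vv₂) * f (x + (n : ℝ) • e.vv₂)

lemma integral_slice_phase (k n : ℤ) : ∫ l, phase (e.slice l) ((k : ℝ) • e.vv₂) *
    phase (-(e.slice l)) ((n : ℝ) • e.vv₂) ∂sliceMeasure = if k = n then 1 else 0 := by
  have h1 : ∀ l, phase (e.slice l) ((k : ℝ) • e.vv₂) * phase (-(e.slice l)) ((n : ℝ) • e.vv₂) =
      phase K (((k - n : ℤ) : ℝ) • e.vv₂) *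
        Complex.exp (2 * Real.pi * Complex.I * ((k - n : ℤ) : ℂ) * l) := by
    intro l
    have h2 : phase (-(e.slice l)) ((n : ℝ) • e.vv₂) =
        phase (e.slice l) (((-n : ℤ) : ℝ) • e.vv₂) := by
      simp [phase]
    rw [h2, ← phase_add_right, ← add_smul, ← phase_slice_smul_vv₂]
    push_cast
    rw [← sub_eq_add_neg]
  simp only [h1]
  rw [integral_const_mul, sliceMeasure, integral_Icc_eq_integral_Ioc,
    ← intervalIntegral.integral_of_le (by norm_num)]
  by_cases h : k = n
  · simp [h]
    norm_num
  · have hne : (2 * Real.pi * Complex.I * ((k - n : ℤ) : ℂ) : ℂ) ≠ 0 :=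
      mul_ne_zero Complex.two_pi_I_ne_zero (by exact_mod_cast sub_ne_zero.2 h)
    rw [if_neg h, integral_exp_mul_complex hne]
    have h3 : Complex.exp (2 * Real.pi * Complex.I * ((k - n : ℤ) : ℂ) * ((1 / 2 : ℝ) : ℂ)) =
        Complex.exp (2 * Real.pi * Complex.I * ((k - n : ℤ) : ℂ) * ((-(1 / 2) : ℝ) : ℂ)) := by
      rw [Complex.exp_eq_exp_iff_exists_int]
      exact ⟨k - n, by push_cast; ring⟩
    rw [h3, sub_self, zero_div, mul_zero]

/-- Orthogonality of the characters in `l` isolates a single tile; the identity is pointwise because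
the sum is finite. -/
lemma blochCoef_blochSum (f : Plane → ℂ) (s : Finset ℤ) (k : ℤ) (x : Plane) :
    e.blochCoef k (e.blochSum f s) x = if k ∈ s then f (x + (k : ℝ) • e.vv₂) else 0 := by
  simp only [blochCoef, blochSum, Finset.mul_sum]
  have hc : ∀ n : ℤ, Continuous fun l => phase (e.slice l) ((k : ℝ) • e.vv₂) *
      phase (-(e.slice l)) ((n : ℝ) • e.vv₂) := fun n =>
    (e.continuous_phase_slice.comp (by fun_prop : Continuous fun l : ℝ =>
        (l, (k : ℝ) • e.vv₂))).mul (continuous_phase_uncurry.comp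
          (e.continuous_slice.neg.prodMk continuous_const))
  rw [integral_finsetSum]
  · have h1 : ∀ n : ℤ, ∫ l, phase (e.slice l) ((k : ℝ) • e.vv₂) *
        (phase (-(e.slice l)) ((n : ℝ) • e.vv₂) * f (x + (n : ℝ) • e.vv₂)) ∂sliceMeasure =
        if k = n then f (x + (n : ℝ) • e.vv₂) else 0 := by
      intro n
      simp only [← mul_assoc]
      rw [integral_mul_const, integral_slice_phase]
      split_ifs <;> simp
    simp only [h1, Finset.sum_ite_eq]
  · intro n _
    simp only [← mul_assoc]
    refine Integrable.mul_const ?_ _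
    exact (integrable_const (1 : ℝ)).mono' (hc n).aestronglyMeasurable
      (Eventually.of_forall fun l => by simp)

lemma aestronglyMeasurable_shift {f : Plane → ℂ} (hf : AEStronglyMeasurable f volume) (v : Plane) :
    AEStronglyMeasurable (fun x => f (x + v)) volume :=
  hf.comp_quasiMeasurePreserving (measurePreserving_add_right volume v).quasiMeasurePreserving

lemma memLp_shift {f : Plane → ℂ} (hf : AEStronglyMeasurable f volume)
    (hf2 : MemLp f 2 (volume.restrict e.strip)) (n : ℤ) :
    MemLp (fun x => f (x + (n : ℝ) • e.vv₂)) 2 e.cellMeasure := by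
  refine memLp_two_of_lintegral_lt_top (aestronglyMeasurable_shift hf _).restrict ?_
  refine lt_of_le_of_lt ?_ (lintegral_enorm_sq_lt_top hf2)
  rw [lintegral_strip]
  exact ENNReal.le_tsum n

lemma memLp_comp_snd {h : Plane → ℂ} (hh : MemLp h 2 e.cellMeasure) :
    MemLp (fun q : ℝ × Plane => h q.2) 2 (sliceMeasure.prod e.cellMeasure) := by
  refine memLp_two_of_lintegral_lt_top hh.1.comp_snd ?_
  rw [lintegral_prod _ (hh.1.comp_snd.enorm.pow_const 2)]
  simp only [lintegral_const]
  exact ENNReal.mul_lt_top (lintegral_enorm_sq_lt_top hh) (measure_lt_top _ _)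

lemma memLp_blochTerm {f : Plane → ℂ} (hf : AEStronglyMeasurable f volume)
    (hf2 : MemLp f 2 (volume.restrict e.strip)) (n : ℤ) :
    MemLp (fun q : ℝ × Plane => phase (-(e.slice q.1)) ((n : ℝ) • e.vv₂) *
      f (q.2 + (n : ℝ) • e.vv₂)) 2 (sliceMeasure.prod e.cellMeasure) := by
  have h1 := e.memLp_comp_snd (e.memLp_shift hf hf2 n)
  have h2 : Continuous fun q : ℝ × Plane => phase (-(e.slice q.1)) ((n : ℝ) • e.vv₂) :=
    continuous_phase_uncurry.comp
      ((e.continuous_slice.comp continuous_fst).neg.prodMk continuous_const)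
  refine h1.of_le (h2.aestronglyMeasurable.mul h1.1) (Eventually.of_forall fun q => ?_)
  rw [norm_mul, norm_phase, one_mul]

lemma memLp_blochSum {f : Plane → ℂ} (hf : AEStronglyMeasurable f volume)
    (hf2 : MemLp f 2 (volume.restrict e.strip)) (s : Finset ℤ) :
    MemLp (fun q : ℝ × Plane => e.blochSum f s q.1 q.2) 2 (sliceMeasure.prod e.cellMeasure) :=
  memLp_finsetSum s fun n _ => e.memLp_blochTerm hf hf2 n

lemma lintegral_blochSum {f : Plane → ℂ} (hf : AEStronglyMeasurable f volume)
    (hf2 : MemLp f 2 (volume.restrict e.strip)) (s : Finset ℤ) :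
    ∫⁻ q, ‖e.blochSum f s q.1 q.2‖ₑ ^ 2 ∂(sliceMeasure.prod e.cellMeasure) =
      ∑ n ∈ s, ∫⁻ x in e.cell, ‖f (x + (n : ℝ) • e.vv₂)‖ₑ ^ 2 := by
  rw [← tsum_lintegral_blochCoef e (e.memLp_blochSum hf hf2 s), tsum_eq_sum (s := s)]
  · refine Finset.sum_congr rfl fun n hn => ?_
    simp only [blochCoef_blochSum, if_pos hn]
  · intro n hn
    simp only [blochCoef_blochSum, if_neg hn]
    simp

lemma norm_toLp_sq {X : Type*} [MeasurableSpace X] {μ : Measure X} {g : X → ℂ}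
    (hg : MemLp g 2 μ) : ‖hg.toLp‖ ^ 2 = (∫⁻ x, ‖g x‖ₑ ^ 2 ∂μ).toReal := by
  rw [Lp.norm_toLp, eLpNorm_two_eq, ← ENNReal.toReal_pow, ← ENNReal.rpow_natCast,
    ← ENNReal.rpow_mul]
  norm_num

/-- The Bloch transform of a square integrable function on the cylinder. -/
theorem exists_blochTransform {f : Plane → ℂ} (hf : AEStronglyMeasurable f volume)
    (hf2 : MemLp f 2 (volume.restrict e.strip)) :
    ∃ F : ℝ → Plane → ℂ,
      MemLp (fun q : ℝ × Plane => F q.1 q.2) 2 (sliceMeasure.prod e.cellMeasure) ∧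
      ∀ n : ℤ, ∀ᵐ x ∂e.cellMeasure, f (x + (n : ℝ) • e.vv₂) = e.blochCoef n F x := by
  classical
  let a : ℤ → ℝ≥0∞ := fun n => ∫⁻ x in e.cell, ‖f (x + (n : ℝ) • e.vv₂)‖ₑ ^ 2
  have ha : ∑' n, a n ≠ ⊤ := by
    have := lintegral_enorm_sq_lt_top hf2
    rw [lintegral_strip] at this
    exact this.ne
  have ha' : Summable fun n => (a n).toReal := ENNReal.summable_toReal ha
  have han : ∀ n, a n ≠ ⊤ := fun n => ENNReal.ne_top_of_tsum_ne_top ha n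
  let U : ℤ → Lp ℂ 2 (sliceMeasure.prod e.cellMeasure) := fun n => (e.memLp_blochTerm hf hf2 n).toLp
  have hU : ∀ s, ∑ n ∈ s, U n = (e.memLp_blochSum hf hf2 s).toLp := by
    intro s
    refine Lp.ext ?_
    have h1 := (eventually_all_finset s).2 fun n (_ : n ∈ s) =>
      (e.memLp_blochTerm hf hf2 n).coeFn_toLp
    filter_upwards [Lp.coeFn_finsetSum s U, (e.memLp_blochSum hf hf2 s).coeFn_toLp, h1]
      with q hq hq' hq''
    rw [hq, hq', Finset.sum_apply, blochSum]
    exact Finset.sum_congr rfl hq''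
  have hUn : ∀ s, ‖∑ n ∈ s, U n‖ ^ 2 = ∑ n ∈ s, (a n).toReal := by
    intro s
    rw [hU, norm_toLp_sq, lintegral_blochSum e hf hf2, ENNReal.toReal_sum fun n _ => han n]
  -- Finite Bloch sums have squared norm equal to the mass of `f` on the tiles involved, and these
  -- masses are summable.
  have hsum : Summable U := by
    rw [summable_iff_vanishing_norm]
    intro ε hε
    obtain ⟨s, hs⟩ := summable_iff_vanishing_norm.1 ha' (ε ^ 2) (by positivity)
    refine ⟨s, fun t ht => ?_⟩
    have h1 := hs t ht
    rw [Real.norm_of_nonneg (Finset.sum_nonneg fun n _ => ENNReal.toReal_nonneg), ← hUn] at h1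
    exact lt_of_pow_lt_pow_left₀ 2 hε.le h1
  let F : ℝ → Plane → ℂ := fun l x => (∑' n, U n : Lp ℂ 2 (sliceMeasure.prod e.cellMeasure)) (l, x)
  have hF : MemLp (fun q : ℝ × Plane => F q.1 q.2) 2 (sliceMeasure.prod e.cellMeasure) :=
    Lp.memLp _
  have hFL : hF.toLp = ∑' n, U n := Lp.toLp_coeFn _ _
  refine ⟨F, hF, fun n => ?_⟩
  have hlim : Tendsto (fun s => ‖(∑' n, U n) - ∑ n ∈ s, U n‖ ^ 2) atTop (𝓝 0) := by
    have := (tendsto_const_nhds (x := ∑' n, U n)).sub hsum.hasSum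
    rw [sub_self] at this
    simpa using this.norm.pow 2
  -- Once `s` contains `n`, the finite Bloch sum already reproduces `f` on tile `n`, so Parseval
  -- bounds the discrepancy there by the tail of the series.
  have hb : ∀ s, n ∈ s → (∫⁻ x in e.cell, ‖e.blochCoef n F x -
      f (x + (n : ℝ) • e.vv₂)‖ₑ ^ 2) ≤ ENNReal.ofReal (‖(∑' n, U n) - ∑ n ∈ s, U n‖ ^ 2) := by
    intro s hs
    have hG := e.memLp_blochSum hf hf2 s
    have hd : MemLp (fun q : ℝ × Plane => F q.1 q.2 - e.blochSum f s q.1 q.2) 2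
        (sliceMeasure.prod e.cellMeasure) := hF.sub hG
    have h1 : ‖(∑' n, U n) - ∑ n ∈ s, U n‖ ^ 2 = (∫⁻ q, ‖F q.1 q.2 - e.blochSum f s q.1 q.2‖ₑ ^ 2
        ∂(sliceMeasure.prod e.cellMeasure)).toReal := by
      rw [← hFL, hU, ← MemLp.toLp_sub, norm_toLp_sq]
      rfl
    rw [h1, ENNReal.ofReal_toReal (lintegral_enorm_sq_lt_top hd).ne,
      ← tsum_lintegral_blochCoef e (g := fun l x => F l x - e.blochSum f s l x) hd]
    refine le_trans (le_of_eq (lintegral_congr_ae ?_)) (ENNReal.le_tsum n)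
    filter_upwards [e.ae_blochCoef_sub hF hG n] with x hx
    rw [hx, blochCoef_blochSum, if_pos hs]
  have hzero : (∫⁻ x in e.cell, ‖e.blochCoef n F x - f (x + (n : ℝ) • e.vv₂)‖ₑ ^ 2) = 0 := by
    refine le_antisymm ?_ bot_le
    have h2 := ENNReal.tendsto_ofReal hlim
    rw [ENNReal.ofReal_zero] at h2
    refine ge_of_tendsto h2 ?_
    filter_upwards [eventually_ge_atTop {n}] with s hs
    exact hb s (hs (Finset.mem_singleton_self n))
  have hm : AEMeasurable (fun x => ‖e.blochCoef n F x - f (x + (n : ℝ) • e.vv₂)‖ₑ ^ 2)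
      e.cellMeasure := ((e.aestronglyMeasurable_blochCoef hF.1 n).sub
    (e.memLp_shift hf hf2 n).1).enorm.pow_const 2
  rw [lintegral_eq_zero_iff' hm] at hzero
  filter_upwards [hzero] with x hx
  simp only [Pi.zero_apply, ne_eq, OfNat.ofNat_ne_zero, not_false_eq_true, pow_eq_zero_iff,
    enorm_eq_zero] at hx
  exact (sub_eq_zero.1 hx).symm

end Edge

end FloquetBloch

/-! ### Coefficients over the cylinder as inner products over the period cell. -/

namespace FloquetBloch

lemma tendsto_eLpNorm_two_of_le {X ι : Type*} [MeasurableSpace X] {μ : Measure X} {l : Filter ι}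
    {g : ι → X → ℂ} {a : ι → ℝ≥0∞} (h : ∀ i, ∫⁻ x, ‖g i x‖ₑ ^ 2 ∂μ ≤ a i)
    (ha : Tendsto a l (𝓝 0)) : Tendsto (fun i => eLpNorm (g i) 2 μ) l (𝓝 0) := by
  simp only [eLpNorm_two_eq]
  have h1 := tendsto_of_tendsto_of_tendsto_of_le_of_le tendsto_const_nhds ha
    (fun _ => zero_le) h
  have h2 := ((ENNReal.continuous_rpow_const (y := 1 / 2)).tendsto 0).comp h1
  rwa [ENNReal.zero_rpow_of_pos (by norm_num)] at h2

lemma integrable_conj_mul {X : Type*} [MeasurableSpace X] {μ : Measure X} {f g : X → ℂ}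
    (hf : MemLp f 2 μ) (hg : MemLp g 2 μ) :
    Integrable (fun x => starRingEnd ℂ (f x) * g x) μ :=
  MemLp.integrable_mul (p := 2) (q := 2) hf.star hg

namespace Edge

variable (e : Edge)

lemma integral_strip_eq_sum {g : Plane → ℂ} (s : Finset ℤ)
    (hg : AEStronglyMeasurable g (volume.restrict e.strip))
    (hs : ∀ n ∈ s, Integrable (fun x => g (x + (n : ℝ) • e.vv₂)) e.cellMeasure)
    (h0 : ∀ n ∉ s, ∀ x ∈ e.cell, g (x + (n : ℝ) • e.vv₂) = 0) :
    ∫ x in e.strip, g x = ∑ n ∈ s, ∫ x in e.cell, g (x + (n : ℝ) • e.vv₂) := by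
  have hint : Integrable g (volume.restrict e.strip) := by
    refine ⟨hg, ?_⟩
    rw [hasFiniteIntegral_iff_enorm, lintegral_strip, tsum_eq_sum (s := s)]
    · exact ENNReal.sum_lt_top.2 fun n hn => hasFiniteIntegral_iff_enorm.1 (hs n hn).2
    · intro n hn
      rw [setLIntegral_congr_fun e.measurableSet_cell fun x hx => by rw [h0 n hn x hx],
        enorm_zero, lintegral_zero]
  rw [restrict_strip_eq_sum] at hint ⊢
  rw [integral_sum_measure hint]
  have h1 : ∀ n : ℤ, ∫ x, g x ∂(Measure.map (fun x => x + (n : ℝ) • e.vv₂) e.cellMeasure) =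
      ∫ x in e.cell, g (x + (n : ℝ) • e.vv₂) := fun n =>
    (MeasurableEquiv.addRight ((n : ℝ) • e.vv₂)).measurableEmbedding.integral_map g
  simp only [h1]
  refine tsum_eq_sum fun n hn => ?_
  rw [setIntegral_congr_fun e.measurableSet_cell fun x hx => h0 n hn x hx, integral_zero]

/-- A measurable field of elements of `L²_k` along the dual slice, bounded by `B`. -/
structure IsSliceField (B : ℝ≥0∞) (φ : ℝ → Plane → ℂ) : Prop where
  aestronglyMeasurable :
    AEStronglyMeasurable (fun q : ℝ × Plane => φ q.1 q.2) (sliceMeasure.prod volume)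
  memL2k : ∀ l ∈ Set.Icc (-(1 / 2) : ℝ) (1 / 2), e.MemL2k (e.slice l) (φ l)
  ne_top : B ≠ ⊤
  bound : ∀ l ∈ Set.Icc (-(1 / 2) : ℝ) (1 / 2), ∫⁻ x in e.cell, ‖φ l x‖ₑ ^ 2 ≤ B

/-- The inner products of `φ l` and `F l` over the period cell. -/
def cellInner (φ F : ℝ → Plane → ℂ) (l : ℝ) : ℂ := ∫ x in e.cell, starRingEnd ℂ (φ l x) * F l x

variable {e} {B : ℝ≥0∞} {φ : ℝ → Plane → ℂ}

namespace IsSliceField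

variable (hφ : e.IsSliceField B φ)
include hφ

lemma memLp {l : ℝ} (hl : l ∈ Set.Icc (-(1 / 2) : ℝ) (1 / 2)) : MemLp (φ l) 2 e.cellMeasure :=
  memLp_phase_mul_iff.1 (hφ.memL2k l hl).memLp

lemma aestronglyMeasurable_cell : AEStronglyMeasurable (fun q : ℝ × Plane => φ q.1 q.2)
    (sliceMeasure.prod e.cellMeasure) :=
  hφ.aestronglyMeasurable.mono_ac
    (Measure.AbsolutelyContinuous.rfl.prod Measure.restrict_le_self.absolutelyContinuous)

lemma aestronglyMeasurable_cellInner {F : ℝ → Plane → ℂ}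
    (hF : MemLp (fun q : ℝ × Plane => F q.1 q.2) 2 (sliceMeasure.prod e.cellMeasure)) :
    AEStronglyMeasurable (e.cellInner φ F) sliceMeasure :=
  AEStronglyMeasurable.integral_prod_right'
    (f := fun q : ℝ × Plane => starRingEnd ℂ (φ q.1 q.2) * F q.1 q.2)
    ((RCLike.continuous_conj.comp_aestronglyMeasurable hφ.aestronglyMeasurable_cell).mul hF.1)

lemma lintegral_cellInner_le {F : ℝ → Plane → ℂ}
    (hF : MemLp (fun q : ℝ × Plane => F q.1 q.2) 2 (sliceMeasure.prod e.cellMeasure)) :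
    ∫⁻ l, ‖e.cellInner φ F l‖ₑ ^ 2 ∂sliceMeasure ≤
      B * ∫⁻ q, ‖F q.1 q.2‖ₑ ^ 2 ∂(sliceMeasure.prod e.cellMeasure) := by
  rw [lintegral_prod _ (hF.1.enorm.pow_const 2), ← lintegral_const_mul' _ _ hφ.ne_top]
  refine lintegral_mono_ae ?_
  filter_upwards [ae_mem_slice, MemLp.ae_memLp_right hF] with l hl hFl
  refine (enorm_integral_conj_mul_sq_le (hφ.memLp hl).1 hFl.1).trans ?_
  gcongr
  exact hφ.bound l hl

lemma memLp_cellInner {F : ℝ → Plane → ℂ}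
    (hF : MemLp (fun q : ℝ × Plane => F q.1 q.2) 2 (sliceMeasure.prod e.cellMeasure)) :
    MemLp (e.cellInner φ F) 2 sliceMeasure :=
  memLp_two_of_lintegral_lt_top (hφ.aestronglyMeasurable_cellInner hF)
    ((hφ.lintegral_cellInner_le hF).trans_lt
      (ENNReal.mul_lt_top hφ.ne_top.lt_top (lintegral_enorm_sq_lt_top hF)))

/-- Pseudo-periodicity moves the mode back to the cell on each tile and produces exactly the phases
of the Bloch sum; finite support in `𝔳₂` makes everything absolutely convergent. -/
lemma integral_strip_conj_mul {l : ℝ} (hl : l ∈ Set.Icc (-(1 / 2) : ℝ) (1 / 2)) {u : Plane → ℂ}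
    (hu : AEStronglyMeasurable u volume) (hu2 : MemLp u 2 (volume.restrict e.strip)) (s : Finset ℤ)
    (h0 : ∀ n ∉ s, ∀ x ∈ e.cell, u (x + (n : ℝ) • e.vv₂) = 0) :
    ∫ x in e.strip, starRingEnd ℂ (φ l x) * u x = e.cellInner φ (e.blochSum u s) l := by
  have hper : ∀ n : ℤ, ∀ᵐ x ∂e.cellMeasure,
      starRingEnd ℂ (φ l (x + (n : ℝ) • e.vv₂)) * u (x + (n : ℝ) • e.vv₂) =
        starRingEnd ℂ (φ l x) *
          (phase (-(e.slice l)) ((n : ℝ) • e.vv₂) * u (x + (n : ℝ) • e.vv₂)) := by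
    intro n
    filter_upwards [ae_restrict_of_ae ((hφ.memL2k l hl).pseudoperiodic (n * e.a₂) (n * e.b₂))]
      with x hx
    rw [← smul_vv₂_eq] at hx
    rw [hx, map_mul, conj_phase]
    ring
  have hint : ∀ n : ℤ, Integrable (fun x => starRingEnd ℂ (φ l x) *
      (phase (-(e.slice l)) ((n : ℝ) • e.vv₂) * u (x + (n : ℝ) • e.vv₂))) e.cellMeasure := fun n =>
    integrable_conj_mul (hφ.memLp hl) ((e.memLp_shift hu hu2 n).const_mul _)
  rw [e.integral_strip_eq_sum s]
  · simp only [cellInner, blochSum, Finset.mul_sum]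
    rw [integral_finsetSum _ fun n _ => hint n]
    exact Finset.sum_congr rfl fun n _ => integral_congr_ae (hper n)
  · exact (RCLike.continuous_conj.comp_aestronglyMeasurable
      (hφ.memL2k l hl).aestronglyMeasurable.restrict).mul hu.restrict
  · exact fun n _ => (hint n).congr ((hper n).mono fun x hx => hx.symm)
  · intro n hn x hx
    rw [h0 n hn x hx, mul_zero]

/-- The difference of the Bloch transforms is the transform of `u - f`, so Cauchy–Schwarz in the
cell followed by the isometry gives the bound. -/
lemma lintegral_cellInner_blochSum_sub_le {f u : Plane → ℂ} {F : ℝ → Plane → ℂ}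
    (hu : AEStronglyMeasurable u volume) (hu2 : MemLp u 2 (volume.restrict e.strip)) (s : Finset ℤ)
    (h0 : ∀ n ∉ s, ∀ x ∈ e.cell, u (x + (n : ℝ) • e.vv₂) = 0)
    (hF : MemLp (fun q : ℝ × Plane => F q.1 q.2) 2 (sliceMeasure.prod e.cellMeasure))
    (hfF : ∀ n : ℤ, ∀ᵐ x ∂e.cellMeasure, f (x + (n : ℝ) • e.vv₂) = e.blochCoef n F x) :
    ∫⁻ l, ‖e.cellInner φ (e.blochSum u s) l - e.cellInner φ F l‖ₑ ^ 2 ∂sliceMeasure ≤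
      B * ∫⁻ x in e.strip, ‖u x - f x‖ₑ ^ 2 := by
  have hG := e.memLp_blochSum hu hu2 s
  have hd : MemLp (fun q : ℝ × Plane => e.blochSum u s q.1 q.2 - F q.1 q.2) 2
    (sliceMeasure.prod e.cellMeasure) := hG.sub hF
  rw [e.lintegral_strip_eq_of_blochCoef (u := fun x => u x - f x)
    (g := fun l x => e.blochSum u s l x - F l x) hd]
  · refine le_trans (le_of_eq (lintegral_congr_ae ?_))
      (hφ.lintegral_cellInner_le (F := fun l x => e.blochSum u s l x - F l x) hd)
    filter_upwards [ae_mem_slice, MemLp.ae_memLp_right hG, MemLp.ae_memLp_right hF] with l hl h1 h2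
    rw [cellInner, cellInner, cellInner, ← integral_sub (integrable_conj_mul (hφ.memLp hl) h1)
      (integrable_conj_mul (hφ.memLp hl) h2)]
    simp only [mul_sub]
  · intro n
    filter_upwards [hfF n, e.ae_blochCoef_sub hG hF n, ae_restrict_mem e.measurableSet_cell]
      with x hx hx' hxc
    rw [hx', ← hx, blochCoef_blochSum]
    split_ifs with hn
    · rfl
    · rw [h0 n hn x hxc]

end IsSliceField

/-- The extra one allows for the unit height of a tile. -/
lemma add_smul_notMem_stripUpTo {R : ℝ} {n : ℤ} (hn : n ∉ Finset.Icc (-(⌈R⌉ + 1)) (⌈R⌉ + 1))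
    {x : Plane} (hx : x ∈ e.cell) : x + (n : ℝ) • e.vv₂ ∉ e.stripUpTo R := by
  intro h
  rw [mem_stripUpTo, coord_symm_add_smul_vv₂] at h
  have h1 := (e.mem_cell.1 hx).2
  have h2 := abs_le.1 h.2
  have h3 := Int.le_ceil R
  refine hn (Finset.mem_Icc.2 ⟨?_, ?_⟩)
  · have : ((-(⌈R⌉ + 1) : ℤ) : ℝ) ≤ n := by
      push_cast
      linarith [h1.1, h1.2, h2.1, h2.2]
    exact_mod_cast this
  · have : (n : ℝ) ≤ ((⌈R⌉ + 1 : ℤ) : ℝ) := by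
      push_cast
      linarith [h1.1, h1.2, h2.1, h2.2]
    exact_mod_cast this

lemma tendsto_lintegral_truncation {f : Plane → ℂ} (hf : AEStronglyMeasurable f volume)
    (hf2 : MemLp f 2 (volume.restrict e.strip)) :
    Tendsto (fun R => ∫⁻ x in e.strip, ‖(e.stripUpTo R).indicator f x - f x‖ₑ ^ 2) atTop (𝓝 0) := by
  have h := tendsto_lintegral_filter_of_dominated_convergence' (μ := volume.restrict e.strip)
    (l := (atTop : Filter ℝ))
    (F := fun R x => ‖(e.stripUpTo R).indicator f x - f x‖ₑ ^ 2) (f := fun _ => 0)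
    (fun x => ‖f x‖ₑ ^ 2) (Eventually.of_forall fun R =>
      ((hf.restrict.indicator (e.measurableSet_stripUpTo R)).sub hf.restrict).enorm.pow_const 2)
    (Eventually.of_forall fun R => Eventually.of_forall fun x => ?_)
    (lintegral_enorm_sq_lt_top hf2).ne ?_
  · simpa using h
  · by_cases hx : x ∈ e.stripUpTo R
    · simp [Set.indicator_of_mem hx]
    · simp [Set.indicator_of_notMem hx]
  · filter_upwards [ae_restrict_mem e.measurableSet_strip] with x hx
    refine tendsto_const_nhds.congr' ?_
    filter_upwards [eventually_ge_atTop |(e.coord.symm x).2|] with R hR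
    rw [Set.indicator_of_mem (e.mem_stripUpTo.2 ⟨e.mem_strip.1 hx, hR⟩)]
    simp

/-- The inner products over the period cell with the Bloch transform of `f` are the coefficients
of `f` over the cylinder. -/
theorem IsSliceField.isSliceCoeff (hφ : e.IsSliceField B φ) {f : Plane → ℂ} {F : ℝ → Plane → ℂ}
    (hf : AEStronglyMeasurable f volume) (hf2 : MemLp f 2 (volume.restrict e.strip))
    (hF : MemLp (fun q : ℝ × Plane => F q.1 q.2) 2 (sliceMeasure.prod e.cellMeasure))
    (hfF : ∀ n : ℤ, ∀ᵐ x ∂e.cellMeasure, f (x + (n : ℝ) • e.vv₂) = e.blochCoef n F x) :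
    e.IsSliceCoeff φ f (e.cellInner φ F) := by
  let s : ℝ → Finset ℤ := fun R => Finset.Icc (-(⌈R⌉ + 1)) (⌈R⌉ + 1)
  let u : ℝ → Plane → ℂ := fun R => (e.stripUpTo R).indicator f
  have hu : ∀ R, AEStronglyMeasurable (u R) volume := fun R =>
    hf.indicator (e.measurableSet_stripUpTo R)
  have hu2 : ∀ R, MemLp (u R) 2 (volume.restrict e.strip) := fun R =>
    hf2.indicator (e.measurableSet_stripUpTo R)
  have hu0 : ∀ R, ∀ n ∉ s R, ∀ x ∈ e.cell, u R (x + (n : ℝ) • e.vv₂) = 0 := fun R n hn x hx =>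
    Set.indicator_of_notMem (add_smul_notMem_stripUpTo hn hx) _
  have hval : ∀ R, ∀ l ∈ Set.Icc (-(1 / 2) : ℝ) (1 / 2),
      ∫ x in e.stripUpTo R, starRingEnd ℂ (φ l x) * f x =
        e.cellInner φ (e.blochSum (u R) (s R)) l := by
    intro R l hl
    rw [← hφ.integral_strip_conj_mul hl (hu R) (hu2 R) (s R) (hu0 R)]
    have h1 : ∀ x, starRingEnd ℂ (φ l x) * u R x =
        (e.stripUpTo R).indicator (fun x => starRingEnd ℂ (φ l x) * f x) x := fun x => by
      by_cases hx : x ∈ e.stripUpTo R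
      · simp only [u, Set.indicator_of_mem hx]
      · simp only [u, Set.indicator_of_notMem hx, mul_zero]
    simp only [h1]
    rw [setIntegral_indicator (e.measurableSet_stripUpTo R),
      Set.inter_eq_self_of_subset_right (e.stripUpTo_subset_strip R)]
  have hG : ∀ R, MemLp (fun q : ℝ × Plane => e.blochSum (u R) (s R) q.1 q.2) 2
      (sliceMeasure.prod e.cellMeasure) := fun R => e.memLp_blochSum (hu R) (hu2 R) (s R)
  have hlim : Tendsto (fun R : ℝ => eLpNorm (fun l =>
      (∫ x in e.stripUpTo R, starRingEnd ℂ (φ l x) * f x) - e.cellInner φ F l) 2 sliceMeasure)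
      atTop (𝓝 0) := by
    refine tendsto_eLpNorm_two_of_le (a := fun R => B *
      ∫⁻ x in e.strip, ‖(e.stripUpTo R).indicator f x - f x‖ₑ ^ 2) (fun R => ?_) ?_
    · refine le_trans (le_of_eq (lintegral_congr_ae ?_))
        (hφ.lintegral_cellInner_blochSum_sub_le (hu R) (hu2 R) (s R) (hu0 R) hF hfF)
      filter_upwards [ae_mem_slice] with l hl
      rw [hval R l hl]
    · have := ENNReal.Tendsto.const_mul (tendsto_lintegral_truncation (e := e) hf hf2)
        (Or.inr hφ.ne_top)
      rwa [mul_zero] at this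
  refine ⟨hφ.memLp_cellInner hF, hlim, ?_⟩
  have hmeas : ∀ R, AEStronglyMeasurable
      (fun l => ∫ x in e.stripUpTo R, starRingEnd ℂ (φ l x) * f x) sliceMeasure := fun R =>
    (hφ.aestronglyMeasurable_cellInner (hG R)).congr
      (ae_mem_slice.mono fun l hl => (hval R l hl).symm)
  -- Convergence in `L²` yields almost everywhere convergence along a subsequence of radii. Where
  -- the full integral converges absolutely, the truncated integrals tend to it, so the limits
  -- agree.
  have hlim' := tendstoInMeasure_of_tendsto_eLpNorm (p := 2) (l := (atTop : Filter ℕ))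
    (f := fun (N : ℕ) l => ∫ x in e.stripUpTo N, starRingEnd ℂ (φ l x) * f x) (by norm_num)
    (fun N => hmeas N) (hφ.aestronglyMeasurable_cellInner hF)
    (hlim.comp tendsto_natCast_atTop_atTop)
  obtain ⟨ns, hns, hae⟩ := hlim'.exists_seq_tendsto_ae
  filter_upwards [hae] with l hl hint
  have hU : ⋃ N : ℕ, e.stripUpTo N = e.strip := by
    refine Set.Subset.antisymm (Set.iUnion_subset fun N => e.stripUpTo_subset_strip N)
      fun x hx => ?_
    obtain ⟨N, hN⟩ := exists_nat_ge |(e.coord.symm x).2|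
    exact Set.mem_iUnion.2 ⟨N, e.mem_stripUpTo.2 ⟨e.mem_strip.1 hx, hN⟩⟩
  have hmono : Monotone fun N : ℕ => e.stripUpTo N := fun M N hMN x hx => by
    rw [mem_stripUpTo] at hx ⊢
    exact ⟨hx.1, hx.2.trans (by exact_mod_cast hMN)⟩
  rw [← hU] at hint ⊢
  exact tendsto_nhds_unique hl ((tendsto_setIntegral_of_monotone
    (s := fun N : ℕ => e.stripUpTo N) (fun N => e.measurableSet_stripUpTo N) hmono
    hint).comp hns.tendsto_atTop)

end Edge

end FloquetBloch

namespace FloquetBloch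

/-! ### Orthonormal expansions with a uniform bound on the remainder. -/

section Hilbert

variable {ι H : Type*} [NormedAddCommGroup H] [InnerProductSpace ℂ H]

/-- Bessel and the triangle inequality; the crude constant suffices, since the bound only serves as
a dominating function independent of `s`. -/
lemma norm_sub_sum_inner_smul_sq_le {v : ι → H} (hv : Orthonormal ℂ v) (x : H) (s : Finset ι) :
    ‖(∑ i ∈ s, inner ℂ (v i) x • v i) - x‖ ^ 2 ≤ 4 * ‖x‖ ^ 2 := by
  have h1 : ‖∑ i ∈ s, inner ℂ (v i) x • v i‖ ^ 2 ≤ ‖x‖ ^ 2 := by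
    refine le_trans (le_of_eq ?_) (hv.sum_inner_products_le (s := s) x)
    have h := inner_self_eq_norm_sq_to_K (𝕜 := ℂ) (∑ i ∈ s, inner ℂ (v i) x • v i)
    rw [hv.inner_sum] at h
    rw [← Complex.ofReal_inj, Complex.ofReal_pow, Complex.ofReal_sum]
    refine h.symm.trans (Finset.sum_congr rfl fun i _ => ?_)
    rw [RCLike.conj_mul]
    simp
  have h2 := abs_le_of_sq_le_sq' h1 (norm_nonneg x)
  have h3 := norm_sub_le (∑ i ∈ s, inner ℂ (v i) x • v i) x
  nlinarith [norm_nonneg ((∑ i ∈ s, inner ℂ (v i) x • v i) - x), norm_nonneg x]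

lemma tendsto_norm_sub_sum_inner_smul [CompleteSpace H] {v : ι → H} (hv : Orthonormal ℂ v)
    (hc : ∀ x, (∀ i, inner ℂ (v i) x = 0) → x = 0) (x : H) :
    Tendsto (fun s : Finset ι => ‖(∑ i ∈ s, inner ℂ (v i) x • v i) - x‖ ^ 2) atTop (𝓝 0) := by
  let b := HilbertBasis.mkOfOrthogonalEqBot hv <| by
    rw [Submodule.eq_bot_iff]
    intro y hy
    exact hc y fun i => (Submodule.mem_orthogonal _ y).1 hy _ (Submodule.subset_span ⟨i, rfl⟩)
  have hb : ∀ i, b i = v i := fun i => by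
    rw [HilbertBasis.coe_mkOfOrthogonalEqBot]
  have h2 : Tendsto (fun s : Finset ι => (∑ i ∈ s, inner ℂ (v i) x • v i) - x) atTop (𝓝 0) := by
    have h3 : Tendsto (fun s : Finset ι => ∑ i ∈ s, inner ℂ (v i) x • v i) atTop (𝓝 x) := by
      have := b.hasSum_repr x
      simp only [b.repr_apply_apply, hb] at this
      exact this
    have := h3.sub_const x
    rwa [sub_self] at this
  simpa using h2.norm.pow 2

end Hilbert

namespace Edge

variable {e : Edge} {B : ℝ≥0∞} {φ : ℝ → Plane → ℂ}

/-! ### Superpositions of modes -/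

lemma memLp_mul_field {c : ℝ → ℂ} (hφ : e.IsSliceField B φ) (hc : MemLp c 2 sliceMeasure) :
    MemLp (fun q : ℝ × Plane => c q.1 * φ q.1 q.2) 2 (sliceMeasure.prod e.cellMeasure) := by
  have hm : AEStronglyMeasurable (fun q : ℝ × Plane => c q.1 * φ q.1 q.2)
    (sliceMeasure.prod e.cellMeasure) := hc.1.comp_fst.mul hφ.aestronglyMeasurable_cell
  refine memLp_two_of_lintegral_lt_top hm ?_
  rw [lintegral_prod _ (hm.enorm.pow_const 2)]
  calc _ ≤ ∫⁻ l, ‖c l‖ₑ ^ 2 * B ∂sliceMeasure := by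
        refine lintegral_mono_ae ?_
        filter_upwards [ae_mem_slice] with l hl
        simp only [enorm_mul, mul_pow]
        rw [lintegral_const_mul' _ _ (by simp)]
        gcongr
        exact hφ.bound l hl
    _ < ⊤ := by
        rw [lintegral_mul_const' _ _ hφ.ne_top]
        exact ENNReal.mul_lt_top (lintegral_enorm_sq_lt_top hc) hφ.ne_top.lt_top

namespace IsSliceField

variable (hφ : e.IsSliceField B φ)
include hφ

/-- The exceptional set of positions may depend on `l`; exchanging the quantifiers gives, for almost
every position, an identity usable under the integral over `l`. -/
lemma ae_ae_pseudoperiodic (m n : ℤ) : ∀ᵐ x : Plane, ∀ᵐ l ∂sliceMeasure,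
    φ l (x + latticeVec m n) = phase (e.slice l) (latticeVec m n) * φ l x := by
  refine ae_ae_eq_swap (F := fun l x => φ l (x + latticeVec m n))
    (G := fun l x => phase (e.slice l) (latticeVec m n) * φ l x) ?_ ?_ ?_
  · exact hφ.aestronglyMeasurable.comp_quasiMeasurePreserving
      (QuasiMeasurePreserving.prodMap (Measure.QuasiMeasurePreserving.id sliceMeasure)
        (measurePreserving_add_right volume (latticeVec m n)).quasiMeasurePreserving)
  · exact (e.continuous_phase_slice.comp (by fun_prop : Continuous fun q : ℝ × Plane =>
      (q.1, latticeVec m n))).aestronglyMeasurable.mul hφ.aestronglyMeasurable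
  · filter_upwards [ae_mem_slice] with l hl
    exact (hφ.memL2k l hl).pseudoperiodic m n

variable {c : ℝ → ℂ} (hc : MemLp c 2 sliceMeasure)

lemma ae_superpose_add (n : ℤ) : ∀ᵐ x ∂e.cellMeasure,
    superpose c φ (x + (n : ℝ) • e.vv₂) = e.blochCoef n (fun l x => c l * φ l x) x := by
  filter_upwards [ae_restrict_of_ae (hφ.ae_ae_pseudoperiodic (n * e.a₂) (n * e.b₂))] with x hx
  refine integral_congr_ae ?_
  filter_upwards [hx] with l hl
  rw [← smul_vv₂_eq] at hl
  rw [hl]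
  ring

include hc

lemma ae_integrable : ∀ᵐ x : Plane, Integrable (fun l => c l * φ l x) sliceMeasure := by
  refine e.ae_of_ae_cell fun m n => ?_
  filter_upwards [ae_restrict_of_ae (hφ.ae_ae_pseudoperiodic m n),
    MemLp.ae_memLp_left (g := fun l x => c l * φ l x) (memLp_mul_field hφ hc)] with x hx hx'
  have h1 : Integrable (fun l => phase (e.slice l) (latticeVec m n) * (c l * φ l x))
      sliceMeasure :=
    (hx'.integrable (by norm_num)).bdd_mul (c := 1)
      (e.continuous_phase_slice.comp (by fun_prop : Continuous fun l : ℝ =>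
        (l, latticeVec m n))).aestronglyMeasurable (Eventually.of_forall fun l => by simp)
  refine h1.congr ?_
  filter_upwards [hx] with l hl
  rw [hl]
  ring

lemma aestronglyMeasurable_superpose : AEStronglyMeasurable (superpose c φ) volume := by
  have h : AEStronglyMeasurable (fun q : ℝ × Plane => c q.1 * φ q.1 q.2)
    (sliceMeasure.prod volume) := hc.1.comp_fst.mul hφ.aestronglyMeasurable
  exact h.prod_swap.integral_prod_right'

/-- Superpositions of modes are square integrable over the cylinder. -/
theorem memL2kpar_superpose : e.MemL2kpar e.kpar (superpose c φ) where
  aestronglyMeasurable := hφ.aestronglyMeasurable_superpose hc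
  pseudoperiodic := by
    filter_upwards [hφ.ae_ae_pseudoperiodic e.a₁ e.b₁] with x hx
    rw [superpose, superpose, ← integral_const_mul]
    refine integral_congr_ae ?_
    filter_upwards [hx] with l hl
    change φ l (x + e.vv₁) = phase (e.slice l) e.vv₁ * φ l x at hl
    rw [hl, phase_slice_vv₁]
    ring
  memLp := by
    refine memLp_phase_mul_iff.2 (memLp_two_of_lintegral_lt_top
      (hφ.aestronglyMeasurable_superpose hc).restrict ?_)
    rw [e.lintegral_strip_eq_of_blochCoef (memLp_mul_field hφ hc) fun n => hφ.ae_superpose_add n]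
    exact lintegral_enorm_sq_lt_top (memLp_mul_field hφ hc)

end IsSliceField

/-! ### Expansion in measurable families of orthonormal bases. -/

variable (e) in
/-- Along the dual slice, `φ` is a measurable family of orthonormal bases of the spaces `L²_k`. -/
structure IsSliceBasis {ι : Type} [DecidableEq ι] (φ : ι → ℝ → Plane → ℂ) : Prop where
  aestronglyMeasurable : ∀ b,
    AEStronglyMeasurable (fun q : ℝ × Plane => φ b q.1 q.2) (sliceMeasure.prod volume)
  memL2k : ∀ l ∈ Set.Icc (-(1 / 2) : ℝ) (1 / 2), ∀ b, e.MemL2k (e.slice l) (φ b l)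
  orthonormal : ∀ l ∈ Set.Icc (-(1 / 2) : ℝ) (1 / 2), ∀ b c,
    ∫ x in e.cell, starRingEnd ℂ (φ b l x) * φ c l x = if b = c then 1 else 0
  complete : ∀ l ∈ Set.Icc (-(1 / 2) : ℝ) (1 / 2), ∀ h : Plane → ℂ, MemLp h 2 e.cellMeasure →
    (∀ b, ∫ x in e.cell, starRingEnd ℂ (φ b l x) * h x = 0) → h =ᵐ[e.cellMeasure] 0

namespace IsSliceBasis

variable {ι : Type} [DecidableEq ι] {φ : ι → ℝ → Plane → ℂ} (hφ : e.IsSliceBasis φ)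
include hφ

lemma memLp {l : ℝ} (hl : l ∈ Set.Icc (-(1 / 2) : ℝ) (1 / 2)) (b : ι) :
    MemLp (φ b l) 2 e.cellMeasure := memLp_phase_mul_iff.1 (hφ.memL2k l hl b).memLp

lemma orthonormal_toLp {l : ℝ} (hl : l ∈ Set.Icc (-(1 / 2) : ℝ) (1 / 2)) :
    Orthonormal ℂ fun b => (hφ.memLp hl b).toLp := by
  rw [orthonormal_iff_ite]
  intro b c
  rw [inner_toLp, hφ.orthonormal l hl]

lemma isSliceField (b : ι) : e.IsSliceField 1 (φ b) where
  aestronglyMeasurable := hφ.aestronglyMeasurable b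
  memL2k l hl := hφ.memL2k l hl b
  ne_top := ENNReal.one_ne_top
  bound l hl := by
    have h1 := norm_toLp_sq (hφ.memLp hl b)
    rw [(hφ.orthonormal_toLp hl).1 b, one_pow] at h1
    rw [← ENNReal.ofReal_toReal (lintegral_enorm_sq_lt_top (hφ.memLp hl b)).ne, ← h1,
      ENNReal.ofReal_one]

lemma lintegral_sub_eq {F : ℝ → Plane → ℂ} {l : ℝ} (hl : l ∈ Set.Icc (-(1 / 2) : ℝ) (1 / 2))
    (hF : MemLp (F l) 2 e.cellMeasure) (s : Finset ι) :
    ∫⁻ x in e.cell, ‖(∑ b ∈ s, e.cellInner (φ b) F l * φ b l x) - F l x‖ₑ ^ 2 =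
      ENNReal.ofReal (‖(∑ b ∈ s, inner ℂ (hφ.memLp hl b).toLp hF.toLp • (hφ.memLp hl b).toLp) -
        hF.toLp‖ ^ 2) := by
  have hm : MemLp (fun x => (∑ b ∈ s, e.cellInner (φ b) F l * φ b l x) - F l x) 2 e.cellMeasure :=
    (memLp_finsetSum s fun b _ => (hφ.memLp hl b).const_mul _).sub hF
  rw [← ENNReal.ofReal_toReal (lintegral_enorm_sq_lt_top hm).ne, ← norm_toLp_sq hm]
  congr 3
  refine Lp.ext ?_
  have h1 := (eventually_all_finset s).2 fun b (_ : b ∈ s) => (hφ.memLp hl b).coeFn_toLp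
  filter_upwards [hm.coeFn_toLp, hF.coeFn_toLp, h1, Lp.coeFn_sub
    (∑ b ∈ s, inner ℂ (hφ.memLp hl b).toLp hF.toLp • (hφ.memLp hl b).toLp) hF.toLp,
    ae_coeFn_sum_smul s (fun b => inner ℂ (hφ.memLp hl b).toLp hF.toLp)
      fun b => (hφ.memLp hl b).toLp] with x h2 h3 h4 h5 h6
  rw [h2, h5, Pi.sub_apply, h6, h3]
  congr 1
  refine Finset.sum_congr rfl fun b hb => ?_
  rw [h4 b hb, inner_toLp]
  rfl

/-- On almost every fibre the orthonormal expansion converges; dominated convergence applies along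
finite subsets since the index set is countable. -/
lemma tendsto_lintegral_expansion [Countable ι] {F : ℝ → Plane → ℂ}
    (hF : MemLp (fun q : ℝ × Plane => F q.1 q.2) 2 (sliceMeasure.prod e.cellMeasure)) :
    Tendsto (fun s : Finset ι => ∫⁻ q, ‖(∑ b ∈ s, e.cellInner (φ b) F q.1 * φ b q.1 q.2) -
      F q.1 q.2‖ₑ ^ 2 ∂(sliceMeasure.prod e.cellMeasure)) atTop (𝓝 0) := by
  have hm : ∀ s : Finset ι, MemLp (fun q : ℝ × Plane =>
      (∑ b ∈ s, e.cellInner (φ b) F q.1 * φ b q.1 q.2) - F q.1 q.2) 2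
      (sliceMeasure.prod e.cellMeasure) := fun s =>
    (memLp_finsetSum s fun b _ => memLp_mul_field (hφ.isSliceField b)
      ((hφ.isSliceField b).memLp_cellInner hF)).sub hF
  have hm' : ∀ s : Finset ι, AEMeasurable (fun q : ℝ × Plane =>
      ‖(∑ b ∈ s, e.cellInner (φ b) F q.1 * φ b q.1 q.2) - F q.1 q.2‖ₑ ^ 2)
      (sliceMeasure.prod e.cellMeasure) := fun s => (hm s).1.enorm.pow_const 2
  have heq : ∀ s : Finset ι, ∫⁻ q, ‖(∑ b ∈ s, e.cellInner (φ b) F q.1 * φ b q.1 q.2) -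
      F q.1 q.2‖ₑ ^ 2 ∂(sliceMeasure.prod e.cellMeasure) = ∫⁻ l, (∫⁻ x in e.cell,
        ‖(∑ b ∈ s, e.cellInner (φ b) F l * φ b l x) - F l x‖ₑ ^ 2) ∂sliceMeasure := fun s =>
    lintegral_prod _ (hm' s)
  simp only [heq]
  have h := tendsto_lintegral_filter_of_dominated_convergence' (μ := sliceMeasure)
    (l := (atTop : Filter (Finset ι)))
    (F := fun s l => ∫⁻ x in e.cell,
      ‖(∑ b ∈ s, e.cellInner (φ b) F l * φ b l x) - F l x‖ₑ ^ 2) (f := fun _ => 0)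
    (fun l => 4 * ∫⁻ x in e.cell, ‖F l x‖ₑ ^ 2) (Eventually.of_forall fun s =>
      (hm' s).lintegral_prod_right') (Eventually.of_forall fun s => ?_) ?_ ?_
  · simpa using h
  · filter_upwards [ae_mem_slice, MemLp.ae_memLp_right hF] with l hl hFl
    rw [hφ.lintegral_sub_eq hl hFl]
    refine (ENNReal.ofReal_le_ofReal
      (norm_sub_sum_inner_smul_sq_le (hφ.orthonormal_toLp hl) hFl.toLp s)).trans ?_
    rw [norm_toLp_sq, ENNReal.ofReal_mul (by norm_num),
      ENNReal.ofReal_toReal (lintegral_enorm_sq_lt_top hFl).ne]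
    simp
  · rw [lintegral_const_mul' _ _ (by norm_num), ← lintegral_prod (fun q : ℝ × Plane =>
      ‖F q.1 q.2‖ₑ ^ 2) (hF.1.enorm.pow_const 2)]
    exact ENNReal.mul_ne_top (by norm_num) (lintegral_enorm_sq_lt_top hF).ne
  · filter_upwards [ae_mem_slice, MemLp.ae_memLp_right hF] with l hl hFl
    simp only [hφ.lintegral_sub_eq hl hFl]
    have h1 := ENNReal.tendsto_ofReal
      (tendsto_norm_sub_sum_inner_smul (hφ.orthonormal_toLp hl) (fun g hg => ?_) hFl.toLp)
    · rwa [ENNReal.ofReal_zero] at h1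
    · rw [Lp.eq_zero_iff_ae_eq_zero]
      refine hφ.complete l hl g (Lp.memLp g) fun b => ?_
      rw [← inner_toLp_left e (hφ.memLp hl b)]
      exact hg b

/-- The expansion of a function on the cylinder in a family of orthonormal bases. -/
theorem hasSumL2 [Countable ι] {f : Plane → ℂ} {F : ℝ → Plane → ℂ}
    (hF : MemLp (fun q : ℝ × Plane => F q.1 q.2) 2 (sliceMeasure.prod e.cellMeasure))
    (hfF : ∀ n : ℤ, ∀ᵐ x ∂e.cellMeasure, f (x + (n : ℝ) • e.vv₂) = e.blochCoef n F x) :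
    e.HasSumL2 (fun b => superpose (e.cellInner (φ b) F) (φ b)) f := by
  -- By the isometry, the error on the strip equals the error of the fibrewise expansion of the
  -- Bloch transform.
  refine tendsto_eLpNorm_two_of_le (fun s => le_of_eq ?_) (hφ.tendsto_lintegral_expansion hF)
  have hg : ∀ b, MemLp (fun q : ℝ × Plane => e.cellInner (φ b) F q.1 * φ b q.1 q.2) 2
      (sliceMeasure.prod e.cellMeasure) := fun b => memLp_mul_field (hφ.isSliceField b)
    ((hφ.isSliceField b).memLp_cellInner hF)
  have hS : MemLp (fun q : ℝ × Plane => ∑ b ∈ s, e.cellInner (φ b) F q.1 * φ b q.1 q.2) 2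
      (sliceMeasure.prod e.cellMeasure) := memLp_finsetSum s fun b _ => hg b
  refine e.lintegral_strip_eq_of_blochCoef
    (g := fun l x => (∑ b ∈ s, e.cellInner (φ b) F l * φ b l x) - F l x) (hS.sub hF) fun n => ?_
  have h1 := (eventually_all_finset s).2 fun b (_ : b ∈ s) =>
    (hφ.isSliceField b).ae_superpose_add (c := e.cellInner (φ b) F) n
  have h2 := (eventually_all_finset s).2 fun b (_ : b ∈ s) => MemLp.ae_memLp_left
    (g := fun l x => e.cellInner (φ b) F l * φ b l x) (hg b)
  filter_upwards [h1, h2, hfF n, e.ae_blochCoef_sub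
    (g := fun l x => ∑ b ∈ s, e.cellInner (φ b) F l * φ b l x) hS hF n] with x hx1 hx2 hx3 hx4
  rw [hx4, hx3]
  congr 1
  rw [Finset.sum_congr rfl hx1]
  simp only [blochCoef, Finset.mul_sum]
  rw [integral_finsetSum s fun b hb => ?_]
  exact ((hx2 b hb).integrable (by norm_num)).bdd_mul (c := 1)
    (e.continuous_phase_slice.comp (by fun_prop : Continuous fun l : ℝ =>
      (l, (n : ℝ) • e.vv₂))).aestronglyMeasurable (Eventually.of_forall fun l => by simp)

end IsSliceBasis

end Edge

end FloquetBloch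

/-! ### Specialization to Floquet–Bloch modes and to plane waves. -/

namespace FloquetBloch

namespace Edge

variable {e : Edge}

lemma IsSliceModes.isSliceBasis {V : Plane → ℝ} (hV : Continuous V) {E : ℕ → ℝ → ℝ}
    {Φ : ℕ → ℝ → Plane → ℂ} (hΦ : e.IsSliceModes V E Φ) : e.IsSliceBasis Φ where
  aestronglyMeasurable := hΦ.aestronglyMeasurable
  memL2k l hl b := ((hΦ.family l hl).state b).memL2k
  orthonormal l hl := (hΦ.family l hl).orthonormal
  complete _ hl _ hh h0 := hΦ.complete hV hl hh h0

variable (e) in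
lemma isSliceBasis_planeWave :
    e.IsSliceBasis fun m l x => ((Real.sqrt e.area)⁻¹ : ℂ) * e.planeWave m l x where
  aestronglyMeasurable m := by
    simp only [normalized_planeWave_eq]
    exact (e.continuous_phase_slice.mul
      ((e.continuous_mode m).comp continuous_snd)).aestronglyMeasurable
  memL2k l _ m := e.memL2k_normalized_planeWave m l
  orthonormal l _ := (e.isFloquetBlochFamily_planeWave l).orthonormal
  complete l _ h hh h0 := by
    have h1 := e.ae_eq_zero_of_integral_mode
      (h := fun x => phase (-(e.slice l)) x * h x) (memLp_phase_mul_iff.2 hh) fun m => by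
        rw [← h0 m]
        refine integral_congr_ae (Eventually.of_forall fun x => ?_)
        simp only [normalized_planeWave_eq, map_mul, conj_phase]
        ring
    filter_upwards [h1] with x hx
    exact (mul_eq_zero.1 hx).resolve_left (phase_ne_zero _ _)

lemma IsSliceField.const_mul {B : ℝ≥0∞} {φ : ℝ → Plane → ℂ} (hφ : e.IsSliceField B φ) (a : ℂ) :
    e.IsSliceField (‖a‖ₑ ^ 2 * B) fun l x => a * φ l x where
  aestronglyMeasurable := hφ.aestronglyMeasurable.const_mul a
  memL2k l hl := by
    have h := MemL2k.sum (fun _ : Unit => hφ.memL2k l hl) Finset.univ fun _ => a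
    simpa using h
  ne_top := ENNReal.mul_ne_top (by simp) hφ.ne_top
  bound l hl := by
    simp only [enorm_mul, mul_pow]
    rw [lintegral_const_mul' _ _ (by simp)]
    gcongr
    exact hφ.bound l hl

lemma HasSumL2.phase_mul {ι : Type} {u : ι → Plane → ℂ} {f : Plane → ℂ} (h : e.HasSumL2 u f)
    (k : Plane) : e.HasSumL2 (fun i x => phase k x * u i x) fun x => phase k x * f x := by
  refine Tendsto.congr (fun s => ?_) h
  refine eLpNorm_congr_norm_ae (Eventually.of_forall fun x => ?_)
  rw [← Finset.mul_sum, ← mul_sub, norm_mul, norm_phase, one_mul]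

lemma superpose_periodicPart (c : ℝ → ℂ) (φ : ℝ → Plane → ℂ) (x : Plane) :
    superpose c (fun l x => phase (l • e.KK₂) x * e.periodicPart φ l x) x =
      phase (-K) x * superpose c φ x := by
  rw [superpose, superpose, ← integral_const_mul]
  refine integral_congr_ae (Eventually.of_forall fun l => ?_)
  simp only [periodicPart, slice, neg_add, phase_add_left]
  linear_combination (c l * φ l x * phase (-K) x) * phase_neg_mul_phase (l • e.KK₂) x

lemma inv_area_mul_planeWave (m : ℤ × ℤ) (l : ℝ) (x : Plane) :
    ((e.area)⁻¹ : ℂ) * e.planeWave m l x =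
      ((Real.sqrt e.area)⁻¹ : ℂ) * (((Real.sqrt e.area)⁻¹ : ℂ) * e.planeWave m l x) := by
  rw [← mul_assoc, ← mul_inv, ← Complex.ofReal_mul, Real.mul_self_sqrt e.area_pos.le]

/-- The factor `1/|Ω|` in the Fourier coefficient splits as `|Ω|^{-1/2}` twice: one normalizes the
mode in the inner product, the other the mode in the superposition. -/
lemma cellInner_planeWave (m : ℤ × ℤ) (F : ℝ → Plane → ℂ) (l : ℝ) :
    e.cellInner (fun l x => ((e.area)⁻¹ : ℂ) * e.planeWave m l x) F l =
      ((Real.sqrt e.area)⁻¹ : ℂ) *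
        e.cellInner (fun l x => ((Real.sqrt e.area)⁻¹ : ℂ) * e.planeWave m l x) F l := by
  rw [cellInner, cellInner, ← integral_const_mul]
  refine integral_congr_ae (Eventually.of_forall fun x => ?_)
  simp only [inv_area_mul_planeWave, map_mul, map_inv₀, Complex.conj_ofReal]
  ring

lemma superpose_planeWave (m : ℤ × ℤ) (c : ℝ → ℂ) (x : Plane) :
    superpose c (fun l x => ((Real.sqrt e.area)⁻¹ : ℂ) * e.planeWave m l x) x =
      phase (K + e.dualVec m) x * ∫ l in (-(1 / 2) : ℝ)..(1 / 2),
        ((Real.sqrt e.area)⁻¹ : ℂ) * c l * phase (l • e.KK₂) x := by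
  rw [intervalIntegral.integral_of_le (by norm_num), ← integral_Icc_eq_integral_Ioc, superpose,
    sliceMeasure, ← integral_const_mul]
  refine integral_congr_ae (Eventually.of_forall fun l => ?_)
  simp only [planeWave, slice, phase_add_left]
  ring

end Edge

end FloquetBloch

end

theorem mainTheorem7 (e : FloquetBloch.Edge) (V : FloquetBloch.Plane → ℝ)
    (hV : ContDiff ℝ ∞ V)
    (hVper : ∀ (m n : ℤ) (x : FloquetBloch.Plane),
      V (x + FloquetBloch.latticeVec m n) = V x) :
    -- a measurable choice of modes along the slice exists
    (∃ (E : ℕ → ℝ → ℝ) (Φ : ℕ → ℝ → FloquetBloch.Plane → ℂ), e.IsSliceModes V E Φ) ∧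
    -- and for every such choice the modes expand every `f`
    (∀ (E : ℕ → ℝ → ℝ) (Φ : ℕ → ℝ → FloquetBloch.Plane → ℂ), e.IsSliceModes V E Φ →
      ∀ f : FloquetBloch.Plane → ℂ, e.MemL2kpar e.kpar f →
      ∃ c : ℕ → ℝ → ℂ,
        (∀ b, e.IsSliceCoeff (Φ b) f (c b)) ∧
        (∀ b, ∀ᵐ x : FloquetBloch.Plane,
          Integrable (fun l => c b l * Φ b l x) FloquetBloch.Edge.sliceMeasure) ∧
        (∀ b, e.MemL2kpar e.kpar (FloquetBloch.Edge.superpose (c b) (Φ b))) ∧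
        e.HasSumL2 (fun b => FloquetBloch.Edge.superpose (c b) (Φ b)) f ∧
        e.HasSumL2
          (fun b => FloquetBloch.Edge.superpose (c b)
            (fun l x => FloquetBloch.phase (l • e.KK₂) x * e.periodicPart (Φ b) l x))
          (fun x => FloquetBloch.phase (-FloquetBloch.K) x * f x)) ∧
    -- for the zero potential the modes are the normalized plane waves,
    (∀ l : ℝ, e.IsFloquetBlochFamily (fun _ => 0) (e.slice l)
      (fun m : ℤ × ℤ => ‖e.slice l + e.dualVec m‖ ^ 2)
      (fun m x => ((Real.sqrt e.area)⁻¹ : ℂ) * e.planeWave m l x)) ∧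
    -- and the expansion is the Fourier decomposition
    (∀ f : FloquetBloch.Plane → ℂ, e.MemL2kpar e.kpar f →
      ∃ fhat : ℤ × ℤ → ℝ → ℂ,
        (∀ m, e.IsSliceCoeff (fun l x => ((e.area)⁻¹ : ℂ) * e.planeWave m l x) f (fhat m)) ∧
        e.HasSumL2
          (fun m x => FloquetBloch.phase (FloquetBloch.K + e.dualVec m) x *
            ∫ l in (-(1 / 2) : ℝ)..(1 / 2),
              fhat m l * FloquetBloch.phase (l • e.KK₂) x)
          f) := by
  have hmem : ∀ {f : FloquetBloch.Plane → ℂ}, e.MemL2kpar e.kpar f →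
      MemLp f 2 (volume.restrict e.strip) := fun hf => FloquetBloch.memLp_phase_mul_iff.1 hf.memLp
  refine ⟨?_, fun E Φ hΦ f hf => ?_, e.isFloquetBlochFamily_planeWave, fun f hf => ?_⟩
  · obtain ⟨E, Φ, hΦ, -⟩ := e.exists_complete_sliceModes hV.continuous
    exact ⟨E, Φ, hΦ⟩
  · obtain ⟨F, hF, hfF⟩ := e.exists_blochTransform hf.aestronglyMeasurable (hmem hf)
    have hB := hΦ.isSliceBasis hV.continuous
    have hc := fun b => (hB.isSliceField b).memLp_cellInner hF
    refine ⟨fun b => e.cellInner (Φ b) F, fun b => (hB.isSliceField b).isSliceCoeff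
      hf.aestronglyMeasurable (hmem hf) hF hfF, fun b => (hB.isSliceField b).ae_integrable (hc b),
      fun b => (hB.isSliceField b).memL2kpar_superpose (hc b), hB.hasSumL2 hF hfF, ?_⟩
    -- The periodic form of the expansion is the first one multiplied by the unimodular factor
    -- `e^{-iK·x}`, which preserves the norm of each remainder.
    have h := (hB.hasSumL2 hF hfF).phase_mul (-FloquetBloch.K)
    simpa only [FloquetBloch.Edge.HasSumL2, FloquetBloch.Edge.superpose_periodicPart] using h
  · obtain ⟨F, hF, hfF⟩ := e.exists_blochTransform hf.aestronglyMeasurable (hmem hf)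
    have hB := e.isSliceBasis_planeWave
    refine ⟨fun m => e.cellInner (fun l x => ((e.area)⁻¹ : ℂ) * e.planeWave m l x) F,
      fun m => ?_, ?_⟩
    · have h := ((hB.isSliceField m).const_mul ((Real.sqrt e.area)⁻¹ : ℂ)).isSliceCoeff
        hf.aestronglyMeasurable (hmem hf) hF hfF
      simp only [← FloquetBloch.Edge.inv_area_mul_planeWave] at h
      exact h
    · have h := hB.hasSumL2 hF hfF
      have heq : ∀ m x, FloquetBloch.Edge.superpose (e.cellInner
          (fun l x => ((Real.sqrt e.area)⁻¹ : ℂ) * e.planeWave m l x) F)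
          (fun l x => ((Real.sqrt e.area)⁻¹ : ℂ) * e.planeWave m l x) x = _ := fun m x =>
        FloquetBloch.Edge.superpose_planeWave m _ x
      simp only [FloquetBloch.Edge.HasSumL2, heq, ← FloquetBloch.Edge.cellInner_planeWave] at h
      exact h
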